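/- **Setting.** Let $\mathbb L\subset\mathbb R^3$ be a Bravais lattice with basis $a_1,a_2,a_3$ and unit cell $\Omega$, let $\mathbb L^*$ be the reciprocal lattice, with basis $b_1,b_2,b_3$ determined by $a_i\cdot b_j=2\pi\delta_{ij}$, and let $\Omega^*=\{\sum_l x_l b_l: 0\le x_l<1\}$ (and $\Omega=\{\sum_l x_l a_l: 0\le x_l<1\}$). Let $\psi_{n\mathbf k}(\mathbf r)$ be Bloch orbitals, with band index $n$ running over finitely many occupied bands $i,j$ ($n_{\rm occ}$ of them) and finitely many virtual bands $a,b$ ($n_{\rm vir}$ of them), $\mathbf k,\mathbf r\in\mathbb R^3$, such that * $e^{-\mathrm i\mathbf k\cdot\mathbf r}\psi_{n\mathbf k}(\mathbf r)$ is $\mathbb L$-periodic in $\mathbf r$, and $\psi_{n\mathbf k}(\mathbf r)$ is $\mathbb L^*$-periodic in $\mathbf k$; * $\psi_{n\mathbf k}(\mathbf r)$ is $C^\infty$ in $\mathbf k$, all derivatives in $\mathbf k$ being continuous in $(\mathbf k,\mathbf r)$; * $\int_\Omega\overline{\psi_{n\mathbf k}}\,\psi_{n'\mathbf k}\,d\mathbf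 r=\delta_{nn'}$ for every $\mathbf k$. Define the pair products $\hat\varrho_{n'\mathbf k',n\mathbf k}(\mathbf G)=\int_\Omega\overline{\psi_{n'\mathbf k'}(\mathbf r)}\,e^{\mathrm i(\mathbf k'-\mathbf k-\mathbf G)\cdot\mathbf r}\,\psi_{n\mathbf k}(\mathbf r)\,d\mathbf r$ and the electron repulsion integrals $$\langle n_1\mathbf k_1,n_2\mathbf k_2|n_3\mathbf k_3,n_4\mathbf k_4\rangle=\frac{4\pi}{|\Omega|}\sum_{\mathbf G\in\mathbb L^*,\ \mathbf q+\mathbf G\ne 0}\frac{\hat\varrho_{n_1\mathbf k_1,n_3(\mathbf k_1+\mathbf q)}(\mathbf G)\,\hat\varrho_{n_2\mathbf k_2,n_4(\mathbf k_2-\mathbf q)}(-\mathbf G)}{|\mathbf q+\mathbf G|^2},\qquad \mathbf q=\mathbf k_3-\mathbf k_1,$$ where $\mathbf k_4\equiv\mathbf k_1+\mathbf k_2-\mathbf k_3$ modulo $\mathbb L^*$. With $\mathbf k_b=\mathbf k_i+\mathbf k_j-\mathbf k_a$, put $$D_{ijab}=\langle i\mathbf k_i,j\mathbf k_j|a\mathbf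 k_a,b\mathbf k_b\rangle,\qquad X_{ijab}=\langle i\mathbf k_i,j\mathbf k_j|b\mathbf k_b,a\mathbf k_a\rangle,\qquad W_{ijab}=2D_{ijab}-X_{ijab}$$ (direct, exchange and antisymmetrized interaction), as functions of $(\mathbf k_i,\mathbf k_j,\mathbf k_a)$. Let $\mathbb T(\Omega^*)$ be the set of functions $f:(\mathbb R^3)^3\to\mathbb C$, $f=f(\mathbf k_i,\mathbf k_j,\mathbf k_a)$, that are $\mathbb L^*$-periodic in each variable, are $C^\infty$ near every point with $\mathbf k_a-\mathbf k_i\notin\mathbb L^*$, for which $(\mathbf k_i,\mathbf k_j)\mapsto f(\mathbf k_i,\mathbf k_j,\mathbf k_i)$ is $C^\infty$, and which have an algebraic singularity of order $0$ at $\mathbf k_a=\mathbf k_i$: the function $g(\mathbf q;\mathbf k_i,\mathbf k_j)=f(\mathbf k_i,\mathbf k_j,\mathbf k_i+\mathbf q)$ is $C^\infty$ in $(\mathbf k_i,\mathbf k_j)$ for each fixed $\mathbf q$, and there is $\delta>0$ such that for all multi-indices $\alpha,\beta$ there is a constant $C_{\alpha,\beta}$ with $$\bigl|\partial_{\mathbf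 q}^{\alpha}\partial_{(\mathbf k_i,\mathbf k_j)}^{\beta}g(\mathbf q;\mathbf k_i,\mathbf k_j)\bigr|\le C_{\alpha,\beta}|\mathbf q|^{-|\alpha|}\qquad(0<|\mathbf q|<\delta,\ \mathbf k_i,\mathbf k_j\in\Omega^*).$$ For $m\ge1$ and an offset $s\in[0,1)^3$ let $\mathcal K=\bigl\{\sum_l\frac{x_l+s_l}{m}b_l: x\in\{0,\dots,m-1\}^3\bigr\}$ be the corresponding Monkhorst–Pack mesh, with $N_{\mathbf k}=m^3$ points. For a kernel $V=(V_{ijab})$, put $$\mathcal G^V_{\rm TDL}(t)=\frac1{|\Omega^*|^3}\int_{(\Omega^*)^3}\sum_{ijab}V_{ijab}\,t_{ijab}\;d\mathbf k_i\,d\mathbf k_j\,d\mathbf k_a,\qquad \mathcal G^V_{N_{\mathbf k}}(T)=\frac1{N_{\mathbf k}^3}\sum_{\mathbf k_i,\mathbf k_j,\mathbf k_a\in\mathcal K}\sum_{ijab}V_{ijab}\,T_{ijab},$$ and let $\mathcal M_{\mathcal K}t$ be the restriction of $t$ to $\mathcal K\times\mathcal K\times\mathcal K$. The energy functionals are $\mathcal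 G_{\rm TDL}=\mathcal G^W_{\rm TDL}$ and $\mathcal G_{N_{\mathbf k}}=\mathcal G^W_{N_{\mathbf k}}$. **Lemma (energy error with exact amplitude).** Let $t=(t_{ijab})$ be an arbitrary amplitude all of whose entries lie in $\mathbb T(\Omega^*)$. Then the series defining the electron repulsion integrals converge absolutely, the integrands of $\mathcal G^D_{\rm TDL}(t)$ and $\mathcal G^X_{\rm TDL}(t)$ are integrable over $(\Omega^*)^3$, and there is a constant $C$ (independent of $m$ and $s$) such that for every $m\ge 1$ and every offset $s\in[0,1)^3$ $$\bigl|\mathcal G_{\rm TDL}(t)-\mathcal G_{N_{\mathbf k}}(\mathcal M_{\mathcal K}t)\bigr|\le C N_{\mathbf k}^{-1}.$$ The same bound holds separately for the direct and for the exchange term, that is, for $\mathcal G^V$ with $V=D$ and with $V=X$. -/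

import Mathlib

open scoped ContDiff ComplexConjugate

noncomputable section

namespace PeriodicCC

/-- Three-dimensional Euclidean space. -/
abbrev Vec3 : Type := EuclideanSpace ℝ (Fin 3)

/-! ### Lattices, cells and Monkhorst–Pack meshes -/

/-- The lattice generated by a basis. -/
def lattice (a : Module.Basis (Fin 3) ℝ Vec3) : Submodule ℤ Vec3 :=
  Submodule.span ℤ (Set.range a)

theorem inner_nondegenerate : LinearMap.BilinForm.Nondegenerate (innerₗ Vec3) := by
  constructor
  · intro x hx
    exact inner_self_eq_zero.mp (hx x)
  · intro x hx
    exact inner_self_eq_zero.mp (hx x)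

/-- The reciprocal basis `b`, characterised by `⟨a i, b j⟩ = 2 π δ i j`. -/
def recipBasis (a : Module.Basis (Fin 3) ℝ Vec3) : Module.Basis (Fin 3) ℝ Vec3 :=
  (LinearMap.BilinForm.dualBasis (innerₗ Vec3) inner_nondegenerate a).unitsSMul
    (fun _ => Units.mk0 (2 * Real.pi) (ne_of_gt Real.two_pi_pos))

theorem inner_recipBasis (a : Module.Basis (Fin 3) ℝ Vec3) (i j : Fin 3) :
    inner ℝ (a i) (recipBasis a j) = if i = j then 2 * Real.pi else 0 := by
  have h := LinearMap.BilinForm.apply_dualBasis_left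
    inner_nondegenerate a j i
  rw [innerₗ_apply_apply, real_inner_comm] at h
  rw [recipBasis, Module.Basis.unitsSMul_apply, Units.smul_def, Units.val_mk0,
    real_inner_smul_right, h]
  simp

/-- The reciprocal lattice. -/
def recipLattice (a : Module.Basis (Fin 3) ℝ Vec3) : Submodule ℤ Vec3 :=
  lattice (recipBasis a)

/-- The unit cell: the half-open parallelepiped spanned by `a`. -/
def unitCell (a : Module.Basis (Fin 3) ℝ Vec3) : Set Vec3 :=
  ZSpan.fundamentalDomain a

/-- The reciprocal cell (Brillouin zone). -/
def brillouinZone (a : Module.Basis (Fin 3) ℝ Vec3) : Set Vec3 :=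
  ZSpan.fundamentalDomain (recipBasis a)

/-- The points of the uniform `m × m × m` mesh of the Brillouin zone with relative offset `s`:
the zone is cut into `m ^ 3` congruent subcells and the point with relative coordinates `s` is taken
in each of them. -/
def meshPoint (a : Module.Basis (Fin 3) ℝ Vec3) (m : ℕ) (s : Fin 3 → ℝ)
    (x : Fin 3 → Fin m) : Vec3 :=
  ∑ l, ((((x l : ℕ) : ℝ) + s l) / (m : ℝ)) • recipBasis a l

/-! ### Orbitals and electron repulsion integrals -/

/-- An orthonormal family of Bloch orbitals `ψ n k r` (band `n`, crystal momentum `k`, position `r`)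
in a smooth periodic gauge.  The normalisation is per unit cell, so that the orbital normalised on a
supercell of `N` unit cells is `N ^ (-1/2) * ψ n k r`. -/
structure IsBlochOrbitals (a : Module.Basis (Fin 3) ℝ Vec3) {ι : Type} [DecidableEq ι]
    (ψ : ι → Vec3 → Vec3 → ℂ) : Prop where
  /-- `exp (-i k · r) ψ n k r` is periodic in `r` with respect to the lattice. -/
  bloch : ∀ n k r, ∀ R ∈ lattice a,
    ψ n k (r + R) = Complex.exp (Complex.I * ((inner ℝ k R : ℝ) : ℂ)) * ψ n k r
  /-- Periodicity in the crystal momentum. -/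
  periodic : ∀ n k r, ∀ G ∈ recipLattice a, ψ n (k + G) r = ψ n k r
  /-- Smoothness in the crystal momentum. -/
  smooth : ∀ n r, ContDiff ℝ ∞ (fun k => ψ n k r)
  /-- Every derivative in the crystal momentum is continuous in `(k, r)`.  No differentiability in
  the position `r` is required. -/
  continuous_deriv : ∀ n (l : ℕ),
    Continuous (fun p : Vec3 × Vec3 => iteratedFDeriv ℝ l (fun k => ψ n k p.2) p.1)
  orthonormal : ∀ k n₁ n₂,
    ∫ r in unitCell a, conj (ψ n₁ k r) * ψ n₂ k r = if n₁ = n₂ then 1 else 0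

section Orbitals

variable (a : Module.Basis (Fin 3) ℝ Vec3) {ι : Type} (ψ : ι → Vec3 → Vec3 → ℂ)

/-- The pair product `⟨ψ n₁ k₁ | exp (i (k₁ - k₂ - G) · r) | ψ n₂ k₂⟩` at the reciprocal lattice
vector `G`.  Its integrand is lattice periodic, so the normalised integral over a supercell is the
integral over the unit cell. -/
def pairProduct (n₁ : ι) (k₁ : Vec3) (n₂ : ι) (k₂ : Vec3) (G : Vec3) : ℂ :=
  ∫ r in unitCell a, conj (ψ n₁ k₁ r) *
    Complex.exp (Complex.I * ((inner ℝ (k₁ - k₂ - G) r : ℝ) : ℂ)) * ψ n₂ k₂ r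

open scoped Classical in
/-- The summand at `G` of the electron repulsion integral with momentum transfer `q = k₃ - k₁`;
the summand with `q + G = 0` is omitted. -/
def eriTerm (n₁ : ι) (k₁ : Vec3) (n₂ : ι) (k₂ : Vec3) (n₃ : ι) (k₃ : Vec3) (n₄ : ι)
    (G : recipLattice a) : ℂ :=
  let q := k₃ - k₁
  if q + (G : Vec3) = 0 then 0
  else ((1 / ‖q + (G : Vec3)‖ ^ 2 : ℝ) : ℂ) *
    pairProduct a ψ n₁ k₁ n₃ (k₁ + q) G * pairProduct a ψ n₂ k₂ n₄ (k₂ - q) (-G)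

/-- The normalised electron repulsion integral `⟨n₁ k₁, n₂ k₂ | n₃ k₃, n₄ k₄⟩`, where `k₄` is
determined by crystal momentum conservation as `k₁ + k₂ - k₃` up to the reciprocal lattice. -/
def eri (n₁ : ι) (k₁ : Vec3) (n₂ : ι) (k₂ : Vec3) (n₃ : ι) (k₃ : Vec3) (n₄ : ι) : ℂ :=
  ((4 * Real.pi / MeasureTheory.volume.real (unitCell a) : ℝ) : ℂ) *
    ∑' G : recipLattice a, eriTerm a ψ n₁ k₁ n₂ k₂ n₃ k₃ n₄ G

end Orbitals

/-! ### The space of exact amplitudes -/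

/-- `f x y` is smooth in `y ∈ VY` for every fixed `x`, and has an algebraic singularity of order `γ`
with respect to `x` at `x₀`, uniformly in `y ∈ VY`: it is smooth for `x ≠ x₀` near `x₀`, and
`|∂ₓ^α ∂_y^β f (x, y)| ≤ C (α, β) |x - x₀| ^ (γ - |α|)` there.  All partial derivatives of given
orders `α` and `β` are collected in the corresponding iterated Fréchet derivatives. -/
def HasAlgSingularity {X Y : Type} [NormedAddCommGroup X] [NormedSpace ℝ X]
    [NormedAddCommGroup Y] [NormedSpace ℝ Y]
    (f : X → Y → ℂ) (VY : Set Y) (x₀ : X) (γ : ℝ) : Prop :=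
  (∀ x, ∀ y ∈ VY, ContDiffAt ℝ ∞ (f x) y) ∧
  ∃ δ > 0,
    (∀ x, 0 < ‖x - x₀‖ → ‖x - x₀‖ < δ → ∀ y ∈ VY,
      ContDiffAt ℝ ∞ (fun p : X × Y => f p.1 p.2) (x, y)) ∧
    ∀ α β : ℕ, ∃ C : ℝ, ∀ x, 0 < ‖x - x₀‖ → ‖x - x₀‖ < δ → ∀ y ∈ VY,
      ‖iteratedFDeriv ℝ α (fun z => iteratedFDeriv ℝ β (f z) y) x‖
        ≤ C * ‖x - x₀‖ ^ (γ - (α : ℝ))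

/-- The function space `𝕋(Ω*)` of functions `f (kᵢ, kⱼ, kₐ)`. -/
structure MemAmplitudeSpace (a : Module.Basis (Fin 3) ℝ Vec3)
    (f : Vec3 → Vec3 → Vec3 → ℂ) : Prop where
  periodic : ∀ ki kj ka, ∀ G ∈ recipLattice a,
    f (ki + G) kj ka = f ki kj ka ∧ f ki (kj + G) ka = f ki kj ka ∧ f ki kj (ka + G) = f ki kj ka
  /-- Smooth away from `kₐ = kᵢ` and its periodic images. -/
  smooth : ∀ ki kj ka, ka - ki ∉ recipLattice a →
    ContDiffAt ℝ ∞ (fun p : Vec3 × Vec3 × Vec3 => f p.1 p.2.1 p.2.2) (ki, kj, ka)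
  /-- Algebraic singularity of order `0` at `kₐ = kᵢ`, in the variables `q = kₐ - kᵢ` and
  `(kᵢ, kⱼ)`. -/
  singular : HasAlgSingularity (fun (q : Vec3) (y : Vec3 × Vec3) => f y.1 y.2 (y.1 + q))
    (brillouinZone a ×ˢ brillouinZone a) 0 0
  /-- Smooth with respect to `(kᵢ, kⱼ)` at the nonsmooth point `kₐ = kᵢ`. -/
  smooth_diag : ContDiff ℝ ∞ (fun y : Vec3 × Vec3 => f y.1 y.2 y.1)

/-! ### Energy functionals -/

section Energy

variable (a : Module.Basis (Fin 3) ℝ Vec3) {nocc nvir : ℕ}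

/-- Functions of `(kᵢ, kⱼ, kₐ)` indexed by the bands `i j a b` (amplitudes, interaction kernels). -/
abbrev AmplitudeFun (nocc nvir : ℕ) : Type :=
  Fin nocc → Fin nocc → Fin nvir → Fin nvir → Vec3 → Vec3 → Vec3 → ℂ

/-- Amplitude tensors on a mesh with `m ^ 3` points. -/
abbrev AmplitudeTensor (nocc nvir m : ℕ) : Type :=
  Fin nocc → Fin nocc → Fin nvir → Fin nvir →
    (Fin 3 → Fin m) → (Fin 3 → Fin m) → (Fin 3 → Fin m) → ℂ

/-- The direct interaction `⟨i kᵢ, j kⱼ | a kₐ, b k_b⟩`. Occupied bands are `Sum.inl`, virtual bands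
are `Sum.inr`. -/
def directERI (ψ : Fin nocc ⊕ Fin nvir → Vec3 → Vec3 → ℂ) : AmplitudeFun nocc nvir :=
  fun i j c d ki kj kc => eri a ψ (.inl i) ki (.inl j) kj (.inr c) kc (.inr d)

/-- The exchange interaction `⟨i kᵢ, j kⱼ | b k_b, a kₐ⟩` with `k_b = kᵢ + kⱼ - kₐ`. -/
def exchangeERI (ψ : Fin nocc ⊕ Fin nvir → Vec3 → Vec3 → ℂ) : AmplitudeFun nocc nvir :=
  fun i j c d ki kj kc => eri a ψ (.inl i) ki (.inl j) kj (.inr d) (ki + kj - kc) (.inr c)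

/-- The antisymmetrized interaction `W`. -/
def antisymERI (ψ : Fin nocc ⊕ Fin nvir → Vec3 → Vec3 → ℂ) : AmplitudeFun nocc nvir :=
  fun i j c d ki kj kc =>
    2 * directERI a ψ i j c d ki kj kc - exchangeERI a ψ i j c d ki kj kc

/-- The integrand `∑ V t` of an energy with interaction kernel `V`. -/
def energyIntegrand (V t : AmplitudeFun nocc nvir) (k : Vec3 × Vec3 × Vec3) : ℂ :=
  ∑ i, ∑ j, ∑ c, ∑ d, V i j c d k.1 k.2.1 k.2.2 * t i j c d k.1 k.2.1 k.2.2

/-- The energy with interaction kernel `V` in the thermodynamic limit. -/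
def energyTDL (V t : AmplitudeFun nocc nvir) : ℂ :=
  ((1 / MeasureTheory.volume.real (brillouinZone a) ^ 3 : ℝ) : ℂ) *
    ∫ k in brillouinZone a ×ˢ brillouinZone a ×ˢ brillouinZone a, energyIntegrand V t k

/-- The energy with interaction kernel `V` on the mesh of `m ^ 3` points with offset `s`. -/
def energyMesh (V : AmplitudeFun nocc nvir) (m : ℕ) (s : Fin 3 → ℝ)
    (T : AmplitudeTensor nocc nvir m) : ℂ :=
  (1 / ((m ^ 3 : ℕ) : ℂ) ^ 3) *
    ∑ x, ∑ y, ∑ z, ∑ i, ∑ j, ∑ c, ∑ d,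
      V i j c d (meshPoint a m s x) (meshPoint a m s y) (meshPoint a m s z) * T i j c d x y z

/-- Evaluation of an exact amplitude on the mesh. -/
def meshEval (m : ℕ) (s : Fin 3 → ℝ) (t : AmplitudeFun nocc nvir) : AmplitudeTensor nocc nvir m :=
  fun i j c d x y z => t i j c d (meshPoint a m s x) (meshPoint a m s y) (meshPoint a m s z)

end Energy

end PeriodicCC

end

open PeriodicCC

open PeriodicCC
open MeasureTheory

/-! The integrands are bounded but not smooth: `directERI` and the amplitudes are singular at k_a =
k_i, and `exchangeERI` at k_b = k_i, that is at k_j = k_a, modulo the reciprocal lattice. All of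
them behave like symbols of order 0: at distance ρ from the singular set, an i-th difference with
step η is O((η/ρ)^i).

Quadrature. Average the fourth difference of F with step u/m over u in the product of three
Brillouin zones, and sum over the mesh. By periodicity each shifted sum Σ_x F(x + n u/m), n = 1, …,
4, averages to m^9 times the mean of F. The alternating binomial sum therefore leaves exactly the
mesh sum minus m^9 times the mean (`norm_integral_sub_mesh_le`). With η of order 1/m, the fourth
difference of a product of two symbols is O((mρ₁)^(-4) + (mρ₂)^(-4)), and O(1) near a singularity
(`IsSymbol.exists_norm_fwdDiff_mul_le`). Summed over one mesh variable this is bounded by a lattice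
sum of |G|^(-4), which converges because 4 > 3 (`exists_sum_mesh_decay_le`). The other two variables
contribute m^6, so the error is O(m^(-9) m^6) = O(N_k^(-1)).

Repulsion integrals (`exists_diffBound_eri`). For the lattice vector nearest to the singularity,
orthogonality of occupied and virtual bands makes both pair products vanish linearly in |q + G|,
which compensates |q + G|^(-2). For all other vectors the Coulomb factor is bounded, and the sum
over G converges by Bessel's inequality for the two pair densities, without any regularity in r.

Differences along sequences (`DiffBound`) replace derivatives throughout, so the lattice series
never has to be differentiated. -/

noncomputable section

/-! ### Sequences with controlled finite differences -/

/-- The differences of order `i ≤ n` of the sequence `a` are at most `C * ε ^ i` in norm, as far as they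
involve only the entries `a 0, …, a n`. -/
def DiffBound {F : Type*} [NormedAddCommGroup F] (ε : ℝ) (n : ℕ) (C : ℝ) (a : ℕ → F) : Prop :=
  ∀ i j, i + j ≤ n → ‖(fwdDiff 1)^[i] a j‖ ≤ C * ε ^ i

namespace DiffBound

variable {F : Type*} [NormedAddCommGroup F] {ε : ℝ} {n : ℕ} {C D : ℝ} {a b : ℕ → F}

/-- This recursion on the order drives the inductions below: one difference costs one order and
multiplies the constant by ε. -/
theorem succ_iff : DiffBound ε (n + 1) C a ↔
    (∀ j ≤ n + 1, ‖a j‖ ≤ C) ∧ DiffBound ε n (C * ε) (fwdDiff 1 a) := by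
  constructor
  · intro h
    refine ⟨fun j hj => by simpa using h 0 j (by omega), fun i j hij => ?_⟩
    have := h (i + 1) j (by omega)
    rw [Function.iterate_succ_apply] at this
    rw [mul_assoc, ← pow_succ']
    exact this
  · rintro ⟨h0, h1⟩ i j hij
    cases i with
    | zero => simpa using h0 j (by omega)
    | succ i =>
      have := h1 i j (by omega)
      rw [Function.iterate_succ_apply]
      rw [mul_assoc, ← pow_succ'] at this
      exact this

theorem norm_le (h : DiffBound ε n C a) {j : ℕ} (hj : j ≤ n) : ‖a j‖ ≤ C := by
  simpa using h 0 j (by omega)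

theorem nonneg (h : DiffBound ε n C a) : 0 ≤ C :=
  (norm_nonneg _).trans (h.norm_le (Nat.zero_le n))

theorem zero_iff : DiffBound ε 0 C a ↔ ‖a 0‖ ≤ C := by
  constructor
  · intro h
    simpa using h 0 0 le_rfl
  · intro h i j hij
    obtain ⟨rfl, rfl⟩ : i = 0 ∧ j = 0 := by omega
    simpa using h

theorem order_mono {n' : ℕ} (h : DiffBound ε n C a) (hn : n' ≤ n) : DiffBound ε n' C a :=
  fun i j hij => h i j (hij.trans hn)

theorem mono {C' ε' : ℝ} (h : DiffBound ε n C a) (hε : 0 ≤ ε) (hε' : ε ≤ ε') (hC : C ≤ C') :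
    DiffBound ε' n C' a := fun i j hij =>
  (h i j hij).trans (mul_le_mul hC (pow_le_pow_left₀ hε hε' i) (pow_nonneg hε i)
    (h.nonneg.trans hC))

/-- A factor in the step is moved into the constant, since at most n differences occur. It turns
estimates in the step η into estimates in ε = η/ρ, the distance ρ being bounded. -/
theorem of_scaled {κ : ℝ} (h : DiffBound (κ * ε) n C a) (hε : 0 ≤ ε) (hκ : 1 ≤ κ) :
    DiffBound ε n (C * κ ^ n) a := fun i j hij => by
  refine (h i j hij).trans ?_
  rw [mul_pow, mul_assoc]
  exact mul_le_mul_of_nonneg_left (mul_le_mul_of_nonneg_right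
    (pow_le_pow_right₀ hκ (by omega)) (pow_nonneg hε i)) h.nonneg

theorem shift (h : DiffBound ε (n + 1) C a) : DiffBound ε n C (fun j => a (j + 1)) := by
  have key : ∀ i (a : ℕ → F) j,
      (fwdDiff 1)^[i] (fun j => a (j + 1)) j = (fwdDiff 1)^[i] a (j + 1) := by
    intro i
    induction i with
    | zero => intro a j; rfl
    | succ i ih =>
      intro a j
      rw [Function.iterate_succ_apply, Function.iterate_succ_apply]
      exact ih (fwdDiff 1 a) j
  intro i j hij
  rw [key]
  exact h i (j + 1) (by omega)

theorem add (ha : DiffBound ε n C a) (hb : DiffBound ε n D b) :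
    DiffBound ε n (C + D) (fun j => a j + b j) := fun i j hij => by
  have : (fun j => a j + b j) = a + b := rfl
  rw [this, fwdDiff_iter_add, add_mul]
  exact (norm_add_le _ _).trans (add_le_add (ha i j hij) (hb i j hij))

theorem const_smul {𝕜 : Type*} [NormedField 𝕜] [NormedSpace 𝕜 F] (c : 𝕜)
    (ha : DiffBound ε n C a) : DiffBound ε n (‖c‖ * C) (fun j => c • a j) := fun i j hij => by
  have : (fun j => c • a j) = c • a := rfl
  rw [this, fwdDiff_iter_const_smul, Pi.smul_apply, norm_smul, mul_assoc]
  exact mul_le_mul_of_nonneg_left (ha i j hij) (norm_nonneg _)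

theorem neg (ha : DiffBound ε n C a) : DiffBound ε n C (fun j => -a j) := by
  intro i j hij
  have : (fun j => -a j) = (-1 : ℤ) • a := by ext; simp
  rw [this, fwdDiff_iter_const_smul, Pi.smul_apply, neg_smul, one_smul, norm_neg]
  exact ha i j hij

/-- Agreement up to index n is enough. This matters for formulas with denominators, which are known
not to vanish only on the first few points of a line. -/
theorem congr' (ha : DiffBound ε n C a) (h : ∀ j ≤ n, a j = b j) : DiffBound ε n C b := by
  induction n generalizing a b C with
  | zero =>
    rw [zero_iff] at ha ⊢
    rwa [← h 0 le_rfl]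
  | succ n ih =>
    rw [succ_iff] at ha ⊢
    refine ⟨fun j hj => by rw [← h j hj]; exact ha.1 j hj, ih ha.2 fun j hj => ?_⟩
    simp only [fwdDiff]
    rw [h j (by omega), h (j + 1) (by omega)]

end DiffBound

/-! ### Products, conjugates, reciprocals and geometric sequences -/

section Mul

variable {ε : ℝ} {n : ℕ} {C D : ℝ} {a b : ℕ → ℂ}

/-- Discrete Leibniz rule: Δ(ab)_j = Δa_j · b_(j+1) + a_j · Δb_j. The two terms per order produce
the factor 2^n. -/
theorem DiffBound.mul (ha : DiffBound ε n C a) (hb : DiffBound ε n D b) :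
    DiffBound ε n (2 ^ n * C * D) (fun j => a j * b j) := by
  induction n generalizing a b C D with
  | zero =>
    rw [DiffBound.zero_iff] at *
    rw [norm_mul, pow_zero, one_mul]
    exact mul_le_mul ha hb (norm_nonneg _) ((norm_nonneg _).trans ha)
  | succ n ih =>
    have h1 := ih (DiffBound.succ_iff.mp ha).2 hb.shift
    have h2 := ih (ha.order_mono (Nat.le_succ n)) (DiffBound.succ_iff.mp hb).2
    refine DiffBound.succ_iff.mpr ⟨fun j hj => ?_, ?_⟩
    · rw [norm_mul]
      calc ‖a j‖ * ‖b j‖ ≤ C * D :=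
            mul_le_mul (ha.norm_le hj) (hb.norm_le hj) (norm_nonneg _) ha.nonneg
        _ ≤ 2 ^ (n + 1) * (C * D) :=
            le_mul_of_one_le_left (mul_nonneg ha.nonneg hb.nonneg) (one_le_pow₀ one_le_two)
        _ = _ := by ring
    · convert h1.add h2 using 1
      · ring
      · ext j
        simp only [fwdDiff]
        ring

theorem DiffBound.conj (ha : DiffBound ε n C a) : DiffBound ε n C (fun j => conj (a j)) := by
  have key : ∀ i (a : ℕ → ℂ) j,
      (fwdDiff 1)^[i] (fun j => starRingEnd ℂ (a j)) j = starRingEnd ℂ ((fwdDiff 1)^[i] a j) := by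
    intro i
    induction i with
    | zero => intro a j; rfl
    | succ i ih =>
      intro a j
      rw [Function.iterate_succ_apply, Function.iterate_succ_apply, ← ih]
      refine congrArg (fun g => (fwdDiff 1)^[i] g j) ?_
      ext j
      simp [fwdDiff]
  intro i j hij
  rw [key, Complex.norm_conj]
  exact ha i j hij

/-- The constant in the estimate for reciprocals. -/
def invConst (C c : ℝ) : ℕ → ℝ
  | 0 => c⁻¹
  | n + 1 => max c⁻¹ (2 ^ n * C * (2 ^ n * invConst C c n * invConst C c n))

/-- Discrete quotient rule: Δ(1/a)_j = −Δa_j · (1/a_j) · (1/a_(j+1)), where the reciprocals are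
already estimated to the lower order. The recursion of `invConst` records this. -/
theorem DiffBound.inv {c : ℝ} (hε : 0 ≤ ε) (hc : 0 < c) (ha : DiffBound ε n C a)
    (hac : ∀ j ≤ n, c ≤ ‖a j‖) : DiffBound ε n (invConst C c n) (fun j => (a j)⁻¹) := by
  have hinv : ∀ {z : ℂ}, c ≤ ‖z‖ → ‖z⁻¹‖ ≤ c⁻¹ := fun hz => by
    rw [norm_inv]; exact inv_anti₀ hc hz
  induction n generalizing a with
  | zero =>
    rw [DiffBound.zero_iff]
    exact hinv (hac 0 le_rfl)
  | succ n ih =>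
    have h1 := ih (ha.order_mono (Nat.le_succ n)) fun j hj => hac j (by omega)
    have h2 := ih ha.shift fun j hj => hac (j + 1) (by omega)
    have h3 := ((DiffBound.succ_iff.mp ha).2.mul (h1.mul h2)).neg
    refine DiffBound.succ_iff.mpr ⟨fun j hj => (hinv (hac j hj)).trans (le_max_left _ _), ?_⟩
    refine DiffBound.congr' (h3.mono hε le_rfl ?_) fun j hj => ?_
    · rw [invConst]
      calc _ = (2 ^ n * C * (2 ^ n * invConst C c n * invConst C c n)) * ε := by ring
        _ ≤ _ := mul_le_mul_of_nonneg_right (le_max_right _ _) hε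
    · have e1 : a j ≠ 0 := norm_pos_iff.mp (hc.trans_le (hac j (by omega)))
      have e2 : a (j + 1) ≠ 0 := norm_pos_iff.mp (hc.trans_le (hac (j + 1) (by omega)))
      simp only [fwdDiff]
      field_simp
      ring

/-- Geometric sequences. -/
theorem DiffBound.geometric {z : ℂ} {w : ℂ} (hz : ‖z‖ = 1) (hw : ‖w‖ ≤ C) (hε : ‖z - 1‖ ≤ ε) :
    DiffBound ε n C (fun j => w * z ^ j) := by
  have hC : 0 ≤ C := (norm_nonneg _).trans hw
  have hε0 : 0 ≤ ε := (norm_nonneg _).trans hε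
  induction n with
  | zero => rw [DiffBound.zero_iff]; simpa using hw
  | succ n ih =>
    refine DiffBound.succ_iff.mpr ⟨fun j _ => by simpa [hz] using hw, ?_⟩
    have := ih.const_smul (z - 1)
    refine DiffBound.congr' (this.mono hε0 le_rfl ?_) fun j _ => ?_
    · rw [mul_comm]; exact mul_le_mul_of_nonneg_left hε hC
    · simp only [fwdDiff, smul_eq_mul]; ring

end Mul

/-! ### Differences of smooth functions -/

section Smooth

variable {E F : Type*} [NormedAddCommGroup E] [NormedSpace ℝ E] [NormedAddCommGroup F]
  [NormedSpace ℝ F]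

omit [NormedSpace ℝ F] in
theorem fwdDiff_iter_comp_line (f : E → F) (x h : E) (i j : ℕ) :
    (fwdDiff 1)^[i] (fun j : ℕ => f (x + (j : ℝ) • h)) j = (fwdDiff h)^[i] f (x + (j : ℝ) • h) := by
  induction i generalizing f with
  | zero => rfl
  | succ i ih =>
    rw [Function.iterate_succ_apply, Function.iterate_succ_apply, ← ih]
    refine congrArg (fun g => (fwdDiff 1)^[i] g j) ?_
    ext j
    simp only [fwdDiff, Nat.cast_add, Nat.cast_one, add_smul, one_smul, add_assoc]

/-- Induction on the order: the mean value inequality bounds the i-th derivative of `fwdDiff h f` by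
M‖h‖. Regularity is asked only on the segment actually visited, so the function may be singular
elsewhere. -/
theorem norm_fwdDiff_iter_le {f : E → F} {x h : E} {M : ℝ} (i : ℕ)
    (hf : ∀ τ ∈ Set.Icc (0 : ℝ) i, ContDiffAt ℝ i f (x + τ • h))
    (hM : ∀ τ ∈ Set.Icc (0 : ℝ) i, ‖iteratedFDeriv ℝ i f (x + τ • h)‖ ≤ M) :
    ‖(fwdDiff h)^[i] f x‖ ≤ M * ‖h‖ ^ i := by
  induction i generalizing f M with
  | zero => simpa using hM 0 (by simp)
  | succ i ih =>
    rw [Function.iterate_succ_apply, pow_succ', ← mul_assoc]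
    have hshift : ∀ τ ∈ Set.Icc (0 : ℝ) i, ContDiffAt ℝ i (fun y => f (y + h)) (x + τ • h) := by
      intro τ hτ
      have h1 := hf (τ + 1) ⟨by linarith [hτ.1], by push_cast; linarith [hτ.2]⟩
      rw [add_smul, one_smul, ← add_assoc] at h1
      have h2 : ContDiffAt ℝ i f ((x + τ • h) + h) := h1.of_le (by exact_mod_cast Nat.le_succ i)
      exact h2.comp (x + τ • h) (contDiffAt_id.add contDiffAt_const)
    have hcd : ∀ τ ∈ Set.Icc (0 : ℝ) i, ContDiffAt ℝ i f (x + τ • h) := by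
      intro τ hτ
      refine (hf τ ⟨hτ.1, by push_cast; linarith [hτ.2]⟩).of_le (by exact_mod_cast Nat.le_succ i)
    refine ih (fun τ hτ => (hshift τ hτ).sub (hcd τ hτ)) fun τ hτ => ?_
    have e : fwdDiff h f = (fun y => f (y + h)) - f := rfl
    rw [e, iteratedFDeriv_sub_apply (hshift τ hτ) (hcd τ hτ), iteratedFDeriv_comp_add_right]
    have hseg : ∀ y ∈ segment ℝ (x + τ • h) (x + τ • h + h),
        ∃ σ ∈ Set.Icc (0 : ℝ) (i + 1 : ℕ), y = x + σ • h := by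
      intro y hy
      rw [segment_eq_image'] at hy
      obtain ⟨θ, hθ, rfl⟩ := hy
      refine ⟨τ + θ, ⟨by linarith [hτ.1, hθ.1], by push_cast; linarith [hτ.2, hθ.2]⟩, ?_⟩
      simp only [add_sub_cancel_left, add_smul]
      abel
    have := Convex.norm_image_sub_le_of_norm_fderiv_le (𝕜 := ℝ) (f := iteratedFDeriv ℝ i f) (C := M)
      (s := segment ℝ (x + τ • h) (x + τ • h + h)) (fun y hy => ?_) (fun y hy => ?_)
      (convex_segment _ _) (left_mem_segment ℝ _ _) (right_mem_segment ℝ _ _)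
    · simpa using this
    · obtain ⟨σ, hσ, rfl⟩ := hseg y hy
      exact (hf σ hσ).differentiableAt_iteratedFDeriv (by exact_mod_cast Nat.lt_succ_self i)
    · obtain ⟨σ, hσ, rfl⟩ := hseg y hy
      rw [norm_fderiv_iteratedFDeriv]
      exact hM σ hσ

/-- Values of a smooth function at equidistant points on a line. -/
theorem DiffBound.of_contDiffAt {f : E → F} {x h : E} {M ε : ℝ} {n : ℕ}
    (hf : ∀ τ ∈ Set.Icc (0 : ℝ) n, ContDiffAt ℝ n f (x + τ • h)) (hε : ‖h‖ ≤ ε)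
    (hM : ∀ i ≤ n, ∀ τ ∈ Set.Icc (0 : ℝ) n, ‖iteratedFDeriv ℝ i f (x + τ • h)‖ ≤ M) :
    DiffBound ε n M (fun j => f (x + (j : ℝ) • h)) := by
  intro i j hij
  have hij' : (i : ℝ) + j ≤ n := by exact_mod_cast hij
  rw [fwdDiff_iter_comp_line]
  have hτ : ∀ τ ∈ Set.Icc (0 : ℝ) i, (j + τ : ℝ) ∈ Set.Icc (0 : ℝ) n := fun τ hτ =>
    ⟨by have := hτ.1; positivity, by linarith [hτ.2]⟩
  have e : ∀ τ : ℝ, x + (j : ℝ) • h + τ • h = x + (j + τ : ℝ) • h := fun τ => by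
    rw [add_smul, add_assoc]
  have hM0 : 0 ≤ M := (norm_nonneg _).trans (hM 0 (Nat.zero_le n) 0 (by simp))
  refine (norm_fwdDiff_iter_le (M := M) i (fun τ h => ?_) (fun τ h => ?_)).trans
    (mul_le_mul_of_nonneg_left (pow_le_pow_left₀ (norm_nonneg _) hε i) hM0)
  · rw [e]; exact (hf _ (hτ τ h)).of_le (by exact_mod_cast (by omega : i ≤ n))
  · rw [e]; exact hM i (by omega) _ (hτ τ h)

end Smooth

/-! ### Double sequences -/

section Double

variable {F : Type*} [NormedAddCommGroup F]

/-- A diagonal step is a step in x followed by one in y: f(j+1,j+1) − f(j,j) = [f(j+1,j+1) −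
f(j,j+1)] + [f(j,j+1) − f(j,j)]. It is needed because the amplitude estimates separate q from (k_i,
k_j), whereas a line moves both. -/
theorem DiffBound.diagonal {ε C : ℝ} {n : ℕ} {f : ℕ → ℕ → F}
    (h : ∀ i j a b, i + a ≤ n → j + b ≤ n →
      ‖(fwdDiff 1)^[j] (fun y => (fwdDiff 1)^[i] (fun x => f x y) a) b‖ ≤ C * ε ^ (i + j)) :
    DiffBound ε n (2 ^ n * C) (fun j => f j j) := by
  induction n generalizing f C with
  | zero =>
    rw [DiffBound.zero_iff]
    simpa using h 0 0 0 0 le_rfl le_rfl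
  | succ n ih =>
    have hC : 0 ≤ C := by
      simpa using (norm_nonneg _).trans (h 0 0 0 0 (by omega) (by omega))
    have h1 := ih (f := fun x y => f (x + 1) (y + 1) - f x (y + 1)) (C := C * ε) ?_
    · have h2 := ih (f := fun x y => f x (y + 1) - f x y) (C := C * ε) ?_
      · refine DiffBound.succ_iff.mpr ⟨fun j hj => ?_, ?_⟩
        · have := h 0 0 j j (by omega) (by omega)
          simp only [Function.iterate_zero, id, pow_zero, mul_one, add_zero] at this
          exact this.trans (le_mul_of_one_le_left hC (one_le_pow₀ one_le_two))
        · convert h1.add h2 using 1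
          · ring
          · ext j
            simp only [fwdDiff]
            abel
      · intro i j a b hi hj
        have := h i (j + 1) a b (by omega) (by omega)
        rw [Function.iterate_succ_apply] at this
        rw [mul_assoc, ← pow_succ']
        rw [show i + j + 1 = i + (j + 1) by ring]
        convert this using 3
        ext y
        have e : (fun x => f x (y + 1) - f x y) = (fun x => f x (y + 1)) - fun x => f x y := rfl
        rw [e, sub_eq_add_neg, fwdDiff_iter_add,
          show (-fun x => f x y) = (-1 : ℤ) • fun x => f x y by ext; simp,
          fwdDiff_iter_const_smul]
        simp [fwdDiff, sub_eq_add_neg]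
    · intro i j a b hi hj
      have key : ∀ j (g : ℕ → F) b,
          (fwdDiff 1)^[j] (fun y => g (y + 1)) b = (fwdDiff 1)^[j] g (b + 1) := by
        intro j
        induction j with
        | zero => intro a j; rfl
        | succ i ih =>
          intro a j
          rw [Function.iterate_succ_apply, Function.iterate_succ_apply]
          exact ih (fwdDiff 1 a) j
      have := h (i + 1) j a (b + 1) (by omega) (by omega)
      simp only [Function.iterate_succ_apply] at this
      rw [← key j] at this
      rw [mul_assoc, ← pow_succ', show i + j + 1 = i + 1 + j by ring]
      exact this

end Double

/-! ### The cell of a lattice and the torus -/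

section Torus

variable (b : Module.Basis (Fin 3) ℝ Vec3)

/-- The uniform probability measure on the unit cell of a lattice. -/
def cellMeasure : Measure Vec3 := ProbabilityTheory.cond volume (unitCell b)

theorem measurableSet_unitCell : MeasurableSet (unitCell b) :=
  ZSpan.fundamentalDomain_measurableSet b

theorem volume_unitCell_ne_zero : volume (unitCell b) ≠ 0 :=
  ZSpan.measure_fundamentalDomain_ne_zero b

theorem isBounded_unitCell : Bornology.IsBounded (unitCell b) :=
  ZSpan.fundamentalDomain_isBounded b

theorem volume_unitCell_ne_top : volume (unitCell b) ≠ ⊤ :=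
  (isBounded_unitCell b).measure_lt_top.ne

instance : IsProbabilityMeasure (cellMeasure b) :=
  ProbabilityTheory.cond_isProbabilityMeasure_of_finite (volume_unitCell_ne_zero b)
    (volume_unitCell_ne_top b)

/-- Relative coordinates modulo `1`. -/
def toTorus (k : Vec3) : UnitAddTorus (Fin 3) := fun l => ((b.repr k l : ℝ) : UnitAddCircle)

/-- The representative in the unit cell. -/
def ofTorus (y : UnitAddTorus (Fin 3)) : Vec3 :=
  ∑ l, ((AddCircle.equivIco 1 0 (y l) : ℝ)) • b l

theorem measurable_toTorus : Measurable (toTorus b) := by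
  refine measurable_pi_lambda _ fun l => AddCircle.measurable_mk'.comp ?_
  exact ((b.coord l).continuous_of_finiteDimensional).measurable

theorem measurable_ofTorus : Measurable (ofTorus b) := by
  refine Finset.measurable_sum _ fun l _ => Measurable.smul_const ?_ _
  exact (measurable_subtype_coe.comp (AddCircle.measurableEquivIco 1 0).measurable).comp
    (measurable_pi_apply l)

theorem ofTorus_toTorus (k : Vec3) : ofTorus b (toTorus b k) = ZSpan.fract b k := by
  refine b.ext_elem fun l => ?_
  rw [ZSpan.repr_fract_apply, ofTorus]
  simp [toTorus, Finsupp.single_apply, AddCircle.coe_equivIco_mk_apply]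

theorem measurePreserving_toTorus : MeasurePreserving (toTorus b) (cellMeasure b) volume := by
  let e : Vec3 ≃L[ℝ] (Fin 3 → ℝ) := b.equivFun.toContinuousLinearEquiv
  have hem : Measurable e := e.continuous.measurable
  have : (Measure.map e (volume : Measure Vec3)).IsAddHaarMeasure :=
    e.isAddHaarMeasure_map volume
  -- Coordinates with respect to b scale Lebesgue measure by a constant. It equals the volume of the
  -- cell and cancels against the normalisation of `cellMeasure`.
  obtain ⟨c, hc⟩ : ∃ c : ENNReal, Measure.map e (volume : Measure Vec3) = c • volume :=
    ⟨_, Measure.isAddLeftInvariant_eq_smul _ _⟩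
  let B : Set (Fin 3 → ℝ) := Set.univ.pi fun _ => Set.Ico (0 : ℝ) 1
  have hB : MeasurableSet B := MeasurableSet.univ_pi fun _ => measurableSet_Ico
  have hvB : volume B = 1 := by simp [B, volume_pi_pi]
  have hpre : unitCell b = e ⁻¹' B := by
    ext k
    simp only [unitCell, ZSpan.mem_fundamentalDomain, Set.mem_preimage, B, Set.mem_univ_pi]
    rfl
  have hcell : volume (unitCell b) = c := by
    rw [hpre, ← Measure.map_apply hem hB, hc, Measure.smul_apply, hvB, smul_eq_mul, mul_one]
  have hmap : Measure.map e (cellMeasure b) = volume.restrict B := by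
    rw [cellMeasure, ProbabilityTheory.cond, Measure.map_smul, hcell, hpre,
      ← Measure.restrict_map hem hB, hc, Measure.restrict_smul, smul_smul,
      ENNReal.inv_mul_cancel, one_smul]
    · rw [← hcell]; exact volume_unitCell_ne_zero b
    · rw [← hcell]; exact volume_unitCell_ne_top b
  have h1 : MeasurePreserving e (cellMeasure b) (volume.restrict B) := ⟨hem, hmap⟩
  have h2 : MeasurePreserving (fun (x : Fin 3 → ℝ) (i : Fin 3) => ((x i : ℝ) : UnitAddCircle))
      (volume.restrict B) volume := by
    have := measurePreserving_pi (fun _ : Fin 3 => (volume : Measure ℝ).restrict (Set.Ioc 0 (0 + 1)))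
      (fun _ => (volume : Measure UnitAddCircle))
      (fun _ => UnitAddCircle.measurePreserving_mk 0)
    have e1 : (volume : Measure (Fin 3 → ℝ)).restrict B
        = Measure.pi (fun _ : Fin 3 => (volume : Measure ℝ).restrict (Set.Ioc 0 (0 + 1))) := by
      simp only [zero_add, ← Measure.restrict_congr_set
        (Ico_ae_eq_Ioc (μ := (volume : Measure ℝ)) (a := 0) (b := 1))]
      exact Measure.restrict_pi_pi _ _
    rw [e1]
    exact this
  exact h2.comp h1

variable {b}

theorem toTorus_add (k k' : Vec3) : toTorus b (k + k') = toTorus b k + toTorus b k' := by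
  ext l; simp [toTorus]

theorem toTorus_nsmul (n : ℕ) (k : Vec3) : toTorus b ((n : ℝ) • k) = (n : ℤ) • toTorus b k := by
  ext l
  rw [Nat.cast_smul_eq_nsmul, Pi.smul_apply, natCast_zsmul]
  simp only [toTorus]
  rw [map_nsmul]
  rfl

/-- The map `u ↦ s + n u` on the torus preserves the measure. -/
theorem measurePreserving_affine_torus (s : UnitAddTorus (Fin 3)) {n : ℤ} (hn : n ≠ 0) :
    MeasurePreserving (fun y : UnitAddTorus (Fin 3) => s + n • y) volume volume :=
  (measurePreserving_add_left volume s).comp (Measure.measurePreserving_zsmul volume hn)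

/-- Averaging a lattice periodic function over the image of the cell under an affine map
`u ↦ s + n u`. -/
theorem integral_affine_of_periodic {P : Vec3 × Vec3 × Vec3 → ℂ} (hP : Measurable P)
    (hper : ∀ v, ∀ G₁ ∈ lattice b, ∀ G₂ ∈ lattice b, ∀ G₃ ∈ lattice b,
      P (v + (G₁, G₂, G₃)) = P v) (s : Vec3 × Vec3 × Vec3) {n : ℕ} (hn : n ≠ 0) :
    ∫ u, P (s + (n : ℝ) • u) ∂((cellMeasure b).prod ((cellMeasure b).prod (cellMeasure b))) =
      ∫ u, P u ∂((cellMeasure b).prod ((cellMeasure b).prod (cellMeasure b))) := by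
  set ν := (cellMeasure b).prod ((cellMeasure b).prod (cellMeasure b))
  let T := UnitAddTorus (Fin 3)
  let π : Vec3 × Vec3 × Vec3 → T × T × T := Prod.map (toTorus b) (Prod.map (toTorus b) (toTorus b))
  let σ : T × T × T → Vec3 × Vec3 × Vec3 :=
    Prod.map (ofTorus b) (Prod.map (ofTorus b) (ofTorus b))
  have hσ : Measurable σ :=
    (measurable_ofTorus b).prodMap ((measurable_ofTorus b).prodMap (measurable_ofTorus b))
  have hπ : MeasurePreserving π ν volume := (measurePreserving_toTorus b).prod
    ((measurePreserving_toTorus b).prod (measurePreserving_toTorus b))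
  -- A periodic P factors measurably through the torus. There y ↦ s + n y preserves Haar measure,
  -- although u ↦ s + n u does not preserve the measure of the cell.
  have hfac : ∀ v, P v = P (σ (π v)) := by
    rintro ⟨v₁, v₂, v₃⟩
    have := hper (σ (π (v₁, v₂, v₃))) (ZSpan.floor b v₁) (ZSpan.floor b v₁).2
      (ZSpan.floor b v₂) (ZSpan.floor b v₂).2 (ZSpan.floor b v₃) (ZSpan.floor b v₃).2
    rw [← this]
    simp [σ, π, ofTorus_toTorus, ZSpan.fract_apply]
  have hn' : (n : ℤ) ≠ 0 := by exact_mod_cast hn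
  let A : T × T × T → T × T × T := Prod.map (fun y => toTorus b s.1 + (n : ℤ) • y)
    (Prod.map (fun y => toTorus b s.2.1 + (n : ℤ) • y) (fun y => toTorus b s.2.2 + (n : ℤ) • y))
  have hA : MeasurePreserving A volume volume := (measurePreserving_affine_torus _ hn').prod
    ((measurePreserving_affine_torus _ hn').prod (measurePreserving_affine_torus _ hn'))
  have hAπ : ∀ u, π (s + (n : ℝ) • u) = A (π u) := by
    rintro ⟨u₁, u₂, u₃⟩
    obtain ⟨s₁, s₂, s₃⟩ := s
    simp only [π, A, Prod.map_apply, Prod.mk_add_mk, Prod.smul_mk, toTorus_add, toTorus_nsmul]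
  have hf : ∀ (μ : Measure (T × T × T)), AEStronglyMeasurable (fun y => P (σ y)) μ :=
    fun μ => (hP.comp hσ).aestronglyMeasurable
  calc ∫ u, P (s + (n : ℝ) • u) ∂ν = ∫ u, P (σ (A (π u))) ∂ν :=
        integral_congr_ae (.of_forall fun u => by
          show P (s + (n : ℝ) • u) = _
          rw [hfac, hAπ])
    _ = ∫ y, P (σ y) ∂volume := by
        rw [← (hA.comp hπ).map_eq, integral_map (hA.comp hπ).measurable.aemeasurable (hf _)]; rfl
    _ = ∫ u, P (σ (π u)) ∂ν := by
        rw [← hπ.map_eq, integral_map hπ.measurable.aemeasurable (hf _)]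
    _ = ∫ u, P u ∂ν := integral_congr_ae (.of_forall fun u => (hfac u).symm)

end Torus

/-! ### Quadrature error through fourth differences -/

section Quadrature

theorem mem_lattice_iff {b : Module.Basis (Fin 3) ℝ Vec3} {G : Vec3} :
    G ∈ lattice b ↔ ∃ N : Fin 3 → ℤ, G = ∑ l, (N l : ℝ) • b l := by
  rw [lattice, Submodule.mem_span_range_iff_exists_fun]
  simp only [Int.cast_smul_eq_zsmul, eq_comm]

variable {a : Module.Basis (Fin 3) ℝ Vec3}

/-- Translation by G/m permutes the mesh modulo the reciprocal lattice: indices are shifted in `Fin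
m`, and the multiples of m lost in the wrap-around form G'. -/
theorem meshPoint_shift {m : ℕ} [NeZero m] (s : Fin 3 → ℝ) {G : Vec3} (hG : G ∈ recipLattice a) :
    ∃ n : Fin 3 → Fin m, ∀ x, ∃ G' ∈ recipLattice a,
      meshPoint a m s x + (m : ℝ)⁻¹ • G = meshPoint a m s (x + n) + G' := by
  have hm : (m : ℝ) ≠ 0 := by exact_mod_cast NeZero.ne m
  obtain ⟨N, rfl⟩ := mem_lattice_iff.mp hG
  have hlt : ∀ l, (N l % m).toNat < m := fun l => by
    have h1 := Int.emod_lt_of_pos (N l) (by exact_mod_cast NeZero.pos m : (0 : ℤ) < m)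
    have h2 := Int.emod_nonneg (N l) (by exact_mod_cast NeZero.ne m : (m : ℤ) ≠ 0)
    omega
  refine ⟨fun l => ⟨(N l % m).toNat, hlt l⟩, fun x => ?_⟩
  have key : ∀ l, ∃ c : ℤ, ((x l : ℕ) : ℤ) + N l
      = (((x + fun l => (⟨(N l % m).toNat, hlt l⟩ : Fin m)) l : ℕ) : ℤ) + m * c := by
    intro l
    have h2 := Int.emod_nonneg (N l) (by exact_mod_cast NeZero.ne m : (m : ℤ) ≠ 0)
    rw [Pi.add_apply, Fin.val_add]
    push_cast [Int.toNat_of_nonneg h2]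
    refine ⟨((x l : ℕ) + N l % m) / m + N l / m, ?_⟩
    have e1 := Int.emod_add_mul_ediv (N l) m
    have e2 := Int.emod_add_mul_ediv (((x l : ℕ) : ℤ) + N l % m) m
    linear_combination -e1 - e2
  choose c hc using key
  refine ⟨∑ l, (c l : ℝ) • recipBasis a l, mem_lattice_iff.mpr ⟨c, rfl⟩, ?_⟩
  simp only [meshPoint, Finset.smul_sum, ← Finset.sum_add_distrib, smul_smul, ← add_smul]
  refine Finset.sum_congr rfl fun l _ => ?_
  congr 1
  have := hc l
  have h' : ((x l : ℕ) : ℝ) + N l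
      = (((x + fun l => (⟨(N l % m).toNat, hlt l⟩ : Fin m)) l : ℕ) : ℝ) + m * c l := by
    exact_mod_cast this
  rw [← sub_eq_zero] at h' ⊢
  field_simp
  linear_combination h'

/-- The points of the product mesh. -/
def meshPoint₃ (a : Module.Basis (Fin 3) ℝ Vec3) (m : ℕ) (s : Fin 3 → ℝ)
    (x : (Fin 3 → Fin m) × (Fin 3 → Fin m) × (Fin 3 → Fin m)) : Vec3 × Vec3 × Vec3 :=
  (meshPoint a m s x.1, meshPoint a m s x.2.1, meshPoint a m s x.2.2)

/-- Periodicity in each of three variables. -/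
def IsPeriodic₃ (a : Module.Basis (Fin 3) ℝ Vec3) (F : Vec3 × Vec3 × Vec3 → ℂ) : Prop :=
  ∀ v, ∀ G₁ ∈ recipLattice a, ∀ G₂ ∈ recipLattice a, ∀ G₃ ∈ recipLattice a,
    F (v + (G₁, G₂, G₃)) = F v

theorem IsPeriodic₃.sum_mesh {F : Vec3 × Vec3 × Vec3 → ℂ} (hF : IsPeriodic₃ a F) {m : ℕ} (hm : 0 < m)
    (s : Fin 3 → ℝ) : IsPeriodic₃ a fun v => ∑ x, F (meshPoint₃ a m s x + (m : ℝ)⁻¹ • v) := by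
  intro v G₁ h₁ G₂ h₂ G₃ h₃
  have : NeZero m := ⟨hm.ne'⟩
  obtain ⟨n₁, hn₁⟩ := meshPoint_shift (m := m) s h₁
  obtain ⟨n₂, hn₂⟩ := meshPoint_shift (m := m) s h₂
  obtain ⟨n₃, hn₃⟩ := meshPoint_shift (m := m) s h₃
  refine Fintype.sum_equiv (Equiv.addRight ((n₁, n₂, n₃) :
    (Fin 3 → Fin m) × (Fin 3 → Fin m) × (Fin 3 → Fin m))) _ _ fun x => ?_
  obtain ⟨G₁', h₁', e₁⟩ := hn₁ x.1
  obtain ⟨G₂', h₂', e₂⟩ := hn₂ x.2.1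
  obtain ⟨G₃', h₃', e₃⟩ := hn₃ x.2.2
  rw [← hF (meshPoint₃ a m s _ + (m : ℝ)⁻¹ • v) G₁' h₁' G₂' h₂' G₃' h₃']
  congr 1
  obtain ⟨v₁, v₂, v₃⟩ := v
  simp only [meshPoint₃, Prod.smul_mk, Prod.mk_add_mk, smul_add, Equiv.coe_addRight, Prod.fst_add,
    Prod.snd_add, Prod.mk.injEq]
  refine ⟨?_, ?_, ?_⟩
  · rw [add_left_comm, add_comm ((m : ℝ)⁻¹ • v₁), e₁]; abel_nf
  · rw [add_left_comm, add_comm ((m : ℝ)⁻¹ • v₂), e₂]; abel_nf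
  · rw [add_left_comm, add_comm ((m : ℝ)⁻¹ • v₃), e₃]; abel_nf

/-- The uniform probability measure on the product of three Brillouin zones. -/
def zoneMeasure₃ (a : Module.Basis (Fin 3) ℝ Vec3) : Measure (Vec3 × Vec3 × Vec3) :=
  (cellMeasure (recipBasis a)).prod
    ((cellMeasure (recipBasis a)).prod (cellMeasure (recipBasis a)))

instance : IsProbabilityMeasure (zoneMeasure₃ a) := by
  unfold zoneMeasure₃; infer_instance

theorem zoneMeasure₃_eq : zoneMeasure₃ a =
    ((volume (brillouinZone a))⁻¹ ^ 3) • (volume : Measure (Vec3 × Vec3 × Vec3)).restrict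
      (brillouinZone a ×ˢ brillouinZone a ×ˢ brillouinZone a) := by
  rw [zoneMeasure₃, cellMeasure, ProbabilityTheory.cond]
  simp only [Measure.prod_smul_left, Measure.prod_smul_right, Measure.prod_restrict, smul_smul]
  rw [pow_three, ← mul_assoc]
  rfl

theorem ae_mem_zone : ∀ᵐ u ∂(zoneMeasure₃ a),
    u ∈ brillouinZone a ×ˢ brillouinZone a ×ˢ brillouinZone a := by
  rw [zoneMeasure₃_eq]
  refine Measure.ae_smul_measure (ae_restrict_mem ?_) _
  exact (measurableSet_unitCell _).prod ((measurableSet_unitCell _).prod (measurableSet_unitCell _))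

/-- The error of the product mesh is controlled by fourth differences. -/
theorem norm_integral_sub_mesh_le {F : Vec3 × Vec3 × Vec3 → ℂ} (hF : Measurable F) {M : ℝ}
    (hM : ∀ v, ‖F v‖ ≤ M) (hper : IsPeriodic₃ a F) {m : ℕ} (hm : 0 < m) (s : Fin 3 → ℝ)
    {B : (Fin 3 → Fin m) × (Fin 3 → Fin m) × (Fin 3 → Fin m) → ℝ}
    (hB : ∀ x, ∀ u ∈ brillouinZone a ×ˢ brillouinZone a ×ˢ brillouinZone a,
      ‖(fwdDiff ((m : ℝ)⁻¹ • u))^[4] F (meshPoint₃ a m s x)‖ ≤ B x) :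
    ‖∫ u, F u ∂(zoneMeasure₃ a) - ((m : ℂ) ^ 9)⁻¹ * ∑ x, F (meshPoint₃ a m s x)‖
      ≤ ((m : ℝ) ^ 9)⁻¹ * ∑ x, B x := by
  have hm0 : (m : ℝ) ≠ 0 := by exact_mod_cast hm.ne'
  set ν := zoneMeasure₃ a
  -- A single v ↦ F(x + v/m) only has the m-fold periods. Summed over the mesh it acquires the
  -- reciprocal lattice itself as periods, so P(n u) has the same mean for every n ≥ 1.
  set P : Vec3 × Vec3 × Vec3 → ℂ := fun v => ∑ x, F (meshPoint₃ a m s x + (m : ℝ)⁻¹ • v) with hP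
  have hinv : ∀ {Q : Vec3 × Vec3 × Vec3 → ℂ}, Measurable Q → IsPeriodic₃ a Q → ∀ v {n : ℕ}, n ≠ 0 →
      ∫ u, Q (v + (n : ℝ) • u) ∂ν = ∫ u, Q u ∂ν := fun hQ hQ' v _ hn =>
    integral_affine_of_periodic hQ hQ' v hn
  have hmeas : ∀ x (t : ℝ), Measurable fun u => F (meshPoint₃ a m s x + t • u) := fun x t =>
    hF.comp (measurable_const.add (measurable_id.const_smul t))
  have hint : ∀ x (t : ℝ), Integrable (fun u => F (meshPoint₃ a m s x + t • u)) ν := fun x t =>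
    Integrable.of_bound (hmeas x t).aestronglyMeasurable M (.of_forall fun u => hM _)
  have hPm : Measurable P := Finset.measurable_sum _ fun x _ => hmeas x _
  have hPper : IsPeriodic₃ a P := hper.sum_mesh hm s
  have hPint : ∫ u, P u ∂ν = (m : ℂ) ^ 9 * ∫ u, F u ∂ν := by
    rw [← hinv hPm hPper 0 hm.ne']
    simp only [hP, zero_add, smul_smul, inv_mul_cancel₀ hm0]
    rw [integral_finsetSum _ fun x _ => hint x 1]
    have : ∀ x, ∫ u, F (meshPoint₃ a m s x + (1 : ℝ) • u) ∂ν = ∫ u, F u ∂ν := fun x => by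
      have := hinv hF hper (meshPoint₃ a m s x) one_ne_zero
      simpa using this
    simp only [this, Finset.sum_const, Finset.card_univ, Fintype.card_prod, Fintype.card_pi,
      Fintype.card_fin, Finset.prod_const, nsmul_eq_mul]
    push_cast
    ring
  have hsum : ∀ n : ℕ, n ≠ 0 →
      ∑ x, ∫ u, F (meshPoint₃ a m s x + n • ((m : ℝ)⁻¹ • u)) ∂ν = (m : ℂ) ^ 9 * ∫ u, F u ∂ν := by
    intro n hn
    have := hinv hPm hPper 0 hn
    rw [← hPint]
    refine Eq.trans ?_ this
    simp only [hP, zero_add, smul_smul, ← Nat.cast_smul_eq_nsmul ℝ]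
    rw [integral_finsetSum _ fun x _ => hint x ((m : ℝ)⁻¹ * n)]
    simp only [mul_comm]
  have hint' : ∀ x (n : ℕ),
      Integrable (fun u => F (meshPoint₃ a m s x + n • ((m : ℝ)⁻¹ • u))) ν := fun x n => by
    simp only [← Nat.cast_smul_eq_nsmul ℝ, smul_smul]
    exact hint x _
  -- The terms n = 1, …, 4 of the binomial expansion all equal m^9 ∫F, with coefficients adding up
  -- to −1. The term n = 0 is the mesh sum.
  have hD : ∑ x, ∫ u, (fwdDiff ((m : ℝ)⁻¹ • u))^[4] F (meshPoint₃ a m s x) ∂ν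
      = ∑ x, F (meshPoint₃ a m s x) - (m : ℂ) ^ 9 * ∫ u, F u ∂ν := by
    have h0 : ∑ x, ∫ u, F (meshPoint₃ a m s x + 0 • ((m : ℝ)⁻¹ • u)) ∂ν
        = ∑ x, F (meshPoint₃ a m s x) := by simp
    have e : ∀ x, ∫ u, (fwdDiff ((m : ℝ)⁻¹ • u))^[4] F (meshPoint₃ a m s x) ∂ν
        = ∑ n ∈ Finset.range 5, ((-1 : ℤ) ^ (4 - n) * (Nat.choose 4 n : ℤ)) •
          ∫ u, F (meshPoint₃ a m s x + n • ((m : ℝ)⁻¹ • u)) ∂ν := by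
      intro x
      simp only [fwdDiff_iter_eq_sum_shift, zsmul_eq_mul]
      rw [integral_finsetSum _ fun n _ => (hint' x n).const_mul _]
      exact Finset.sum_congr rfl fun n _ => integral_const_mul _ _
    simp only [e]
    rw [Finset.sum_comm]
    simp only [← Finset.smul_sum]
    rw [Finset.sum_range_succ, Finset.sum_range_succ, Finset.sum_range_succ, Finset.sum_range_succ,
      Finset.sum_range_one, h0, hsum 1 one_ne_zero, hsum 2 two_ne_zero, hsum 3 three_ne_zero,
      hsum 4 four_ne_zero]
    norm_num [Nat.choose]
    ring
  have hm9 : (m : ℂ) ^ 9 ≠ 0 := pow_ne_zero _ (by exact_mod_cast hm.ne')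
  have hfin : ∫ u, F u ∂ν - ((m : ℂ) ^ 9)⁻¹ * ∑ x, F (meshPoint₃ a m s x) = -(((m : ℂ) ^ 9)⁻¹ *
      ∑ x, ∫ u, (fwdDiff ((m : ℝ)⁻¹ • u))^[4] F (meshPoint₃ a m s x) ∂ν) := by
    rw [hD, mul_sub, inv_mul_cancel_left₀ hm9]
    ring
  rw [hfin, norm_neg, norm_mul, norm_inv, norm_pow, Complex.norm_natCast]
  refine mul_le_mul_of_nonneg_left ?_ (by positivity)
  refine (norm_sum_le _ _).trans (Finset.sum_le_sum fun x _ => ?_)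
  refine (norm_integral_le_of_norm_le_const (C := B x) ?_).trans (by simp)
  filter_upwards [ae_mem_zone] with u hu
  exact hB x u hu

end Quadrature

/-! ### Distances to the lattice and sums over the mesh -/

section Lattice

variable (b : Module.Basis (Fin 3) ℝ Vec3)

instance : DiscreteTopology (lattice b) := by unfold lattice; infer_instance

instance : IsZLattice ℝ (lattice b) := by unfold lattice; infer_instance

instance : Countable (lattice b) := by
  unfold lattice; infer_instance

theorem isClosed_lattice : IsClosed (lattice b : Set Vec3) := by
  have : DiscreteTopology (lattice b).toAddSubgroup := inferInstanceAs (DiscreteTopology (lattice b))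
  exact AddSubgroup.isClosed_of_discrete (H := (lattice b).toAddSubgroup)

/-- The distance to the lattice. -/
def latticeDist (q : Vec3) : ℝ := Metric.infDist q (lattice b : Set Vec3)

variable {b}

theorem latticeDist_nonneg (q : Vec3) : 0 ≤ latticeDist b q := Metric.infDist_nonneg

theorem exists_latticeDist_eq (q : Vec3) : ∃ G ∈ lattice b, latticeDist b q = ‖q + G‖ := by
  obtain ⟨G, hG, h⟩ := (isClosed_lattice b).exists_infDist_eq_dist ⟨0, (lattice b).zero_mem⟩ q
  exact ⟨-G, (lattice b).neg_mem hG, by rw [← sub_eq_add_neg, ← dist_eq_norm]; exact h⟩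

theorem latticeDist_le (q : Vec3) {G : Vec3} (hG : G ∈ lattice b) : latticeDist b q ≤ ‖q + G‖ := by
  have := Metric.infDist_le_dist_of_mem (x := q) (s := (lattice b : Set Vec3)) ((lattice b).neg_mem hG)
  rwa [dist_eq_norm, sub_neg_eq_add] at this

theorem latticeDist_le_add (q h : Vec3) : latticeDist b q ≤ latticeDist b (q + h) + ‖h‖ := by
  have := Metric.infDist_le_infDist_add_dist (s := (lattice b : Set Vec3)) (x := q) (y := q + h)
  rwa [dist_eq_norm, sub_add_cancel_left, norm_neg] at this

theorem latticeDist_eq_zero {q : Vec3} : latticeDist b q = 0 ↔ q ∈ lattice b :=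
  ((isClosed_lattice b).mem_iff_infDist_zero ⟨0, (lattice b).zero_mem⟩).symm

theorem continuous_latticeDist : Continuous (latticeDist b) := Metric.continuous_infDist_pt _

variable (b) in
theorem exists_latticeDist_le : ∃ R > 0, ∀ q, latticeDist b q ≤ R := by
  refine ⟨∑ i, ‖b i‖ + 1, by positivity, fun q => ?_⟩
  have h1 := latticeDist_le (b := b) q ((lattice b).neg_mem (ZSpan.floor b q).2)
  rw [← sub_eq_add_neg] at h1
  have h2 := ZSpan.norm_fract_le b q
  rw [ZSpan.fract_apply] at h2
  linarith

variable (b) in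
/-- Nonzero lattice vectors are bounded away from zero. -/
theorem exists_pos_le_norm : ∃ c > 0, ∀ G ∈ lattice b, G ≠ 0 → c ≤ ‖G‖ := by
  obtain ⟨ε, hε, h⟩ := Metric.isOpen_singleton_iff.mp (isOpen_discrete ({0} : Set (lattice b)))
  refine ⟨ε, hε, fun G hG hG0 => ?_⟩
  by_contra! hlt
  have := h ⟨G, hG⟩ (by rw [dist_eq_norm, sub_zero]; exact hlt)
  exact hG0 (by simpa using congrArg Subtype.val this)

/-- The decay profile of the quadrature error away from the singularity. -/
def decay (t : ℝ) : ℝ := t ^ (-4 : ℤ) + if t = 0 then 1 else 0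

theorem decay_nonneg {t : ℝ} (ht : 0 ≤ t) : 0 ≤ decay t := by
  unfold decay; split_ifs <;> positivity

variable (b) in
-- The exponent 4 exceeds the dimension 3, which is why fourth differences are taken. Since `0 ^
-- (-4)` is 0 by convention, `decay` carries an extra value 1 at the origin.
theorem summable_decay_norm : Summable fun G : lattice b => decay ‖(G : Vec3)‖ := by
  unfold decay
  refine Summable.add ?_ ?_
  · have h := ZLattice.summable_norm_zpow (lattice b) (-4) (by
      rw [ZLattice.rank ℝ]; simp)
    exact h
  · refine summable_of_ne_finset_zero (s := {0}) fun G hG => if_neg ?_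
    simpa using hG

/-- For fixed x, choose G_z with z − x + G_z shortest. Then m(z − x + G_z) is a lattice vector, and
it determines z: a coincidence would make m divide a difference of two indices below m. The mesh sum
is thus part of the lattice sum, uniformly in m, s and x. -/
theorem exists_sum_mesh_decay_le (a : Module.Basis (Fin 3) ℝ Vec3) :
    ∃ C, ∀ m : ℕ, 0 < m → ∀ s : Fin 3 → ℝ, ∀ x : Fin 3 → Fin m,
      ∑ z, decay (m * latticeDist (recipBasis a) (meshPoint a m s z - meshPoint a m s x)) ≤ C := by
  refine ⟨∑' G : lattice (recipBasis a), decay ‖(G : Vec3)‖, fun m hm s x => ?_⟩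
  have hm0 : (m : ℝ) ≠ 0 := by exact_mod_cast hm.ne'
  set b := recipBasis a
  have hdiff : ∀ z x, (m : ℝ) • (meshPoint a m s z - meshPoint a m s x)
      = ∑ l, (((z l : ℕ) : ℤ) - ((x l : ℕ) : ℤ) : ℤ) • b l := by
    intro z x
    simp only [meshPoint, ← Finset.sum_sub_distrib, Finset.smul_sum, ← sub_smul, smul_smul]
    refine Finset.sum_congr rfl fun l _ => ?_
    rw [← Int.cast_smul_eq_zsmul ℝ]
    congr 1
    push_cast
    field_simp
    ring
  choose G hG hGd using fun z => exists_latticeDist_eq (b := b) (meshPoint a m s z - meshPoint a m s x)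
  have hW : ∀ z, (m : ℝ) • (meshPoint a m s z - meshPoint a m s x + G z) ∈ lattice b := by
    intro z
    rw [smul_add, hdiff, Nat.cast_smul_eq_nsmul]
    refine add_mem (sum_mem fun l _ => zsmul_mem (Submodule.subset_span (Set.mem_range_self l)) _)
      (nsmul_mem (hG z) _)
  let W : (Fin 3 → Fin m) → lattice b := fun z => ⟨_, hW z⟩
  have hinj : Function.Injective W := by
    intro z z' h
    have h1 := smul_right_injective Vec3 hm0 (congrArg Subtype.val h)
    have h2 : meshPoint a m s z - meshPoint a m s z' = G z' - G z := by
      rw [sub_add_eq_add_sub, sub_add_eq_add_sub] at h1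
      have := sub_left_inj.mp h1
      rw [sub_eq_sub_iff_add_eq_add, this]
      abel
    obtain ⟨N, hN⟩ := mem_lattice_iff.mp (sub_mem (hG z') (hG z))
    have h3 := hdiff z z'
    rw [h2, hN, Finset.smul_sum] at h3
    funext l
    have h4 := congrArg (fun v => b.repr v l) h3
    simp only [map_sum, map_smul, map_zsmul, Module.Basis.repr_self, Finsupp.coe_finsetSum,
      Finset.sum_apply, Finsupp.smul_apply, Finsupp.single_apply, smul_eq_mul, zsmul_eq_mul] at h4
    simp only [mul_ite, mul_one, mul_zero, Finset.sum_ite_eq', Finset.mem_univ, if_true] at h4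
    have h5 : (m : ℤ) * N l = ((z l : ℕ) : ℤ) - ((z' l : ℕ) : ℤ) := by exact_mod_cast h4
    have hz := (z l).2
    have hz' := (z' l).2
    have h6 : |(m : ℤ) * N l| < m := by rw [h5, abs_lt]; omega
    have h7 : N l = 0 := by
      by_contra h0
      have : (1 : ℤ) ≤ |N l| := Int.one_le_abs h0
      rw [abs_mul, Nat.abs_cast] at h6
      nlinarith
    rw [h7] at h5
    exact Fin.ext (by omega)
  have hle : ∀ z, decay (m * latticeDist b (meshPoint a m s z - meshPoint a m s x))
      = decay ‖(W z : Vec3)‖ := by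
    intro z
    simp only [W]
    rw [hGd z, norm_smul, Real.norm_natCast]
  simp only [hle]
  have h1 := (summable_decay_norm b).sum_le_tsum (Finset.univ.map ⟨W, hinj⟩)
    fun i _ => decay_nonneg (norm_nonneg _)
  rw [Finset.sum_map] at h1
  exact h1

end Lattice

/-! ### Fourier coefficients on the unit cell -/

section Bessel

variable (a : Module.Basis (Fin 3) ℝ Vec3)

/-- The unnormalised Fourier coefficient of a function on the unit cell. -/
def cellFourier (p : Vec3 → ℂ) (G : Vec3) : ℂ :=
  ∫ r in unitCell a, p r * Complex.exp (-(Complex.I * ((inner ℝ G r : ℝ) : ℂ)))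

theorem ofTorus_mem (b : Module.Basis (Fin 3) ℝ Vec3) (y : UnitAddTorus (Fin 3)) :
    ofTorus b y ∈ unitCell b := by
  rw [unitCell, ZSpan.mem_fundamentalDomain]
  intro l
  have := (AddCircle.equivIco 1 0 (y l)).2
  simpa [ofTorus, Finsupp.single_apply] using this

theorem mFourier_toTorus (n : Fin 3 → ℤ) (r : Vec3) :
    UnitAddTorus.mFourier (-n) (toTorus a r) = Complex.exp (-(Complex.I *
      ((inner ℝ (∑ l, (n l : ℝ) • recipBasis a l) r : ℝ) : ℂ))) := by
  have h1 : inner ℝ (∑ l, (n l : ℝ) • recipBasis a l) r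
      = ∑ l, (n l : ℝ) * (2 * Real.pi * a.repr r l) := by
    rw [sum_inner]
    refine Finset.sum_congr rfl fun l _ => ?_
    rw [real_inner_smul_left]
    congr 1
    conv_lhs => rw [← a.sum_repr r, inner_sum]
    simp only [real_inner_smul_right, real_inner_comm, inner_recipBasis]
    simp [mul_comm]
  rw [h1]
  simp only [UnitAddTorus.mFourier, toTorus, ContinuousMap.coe_mk, Pi.neg_apply,
    fourier_coe_apply, ← Complex.exp_sum]
  congr 1
  push_cast
  rw [Finset.mul_sum, ← Finset.sum_neg_distrib]
  refine Finset.sum_congr rfl fun l _ => ?_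
  ring

/-- The normalised Haar measure of the torus, as used in Parseval's identity. -/
def torusHaar : Measure (UnitAddTorus (Fin 3)) :=
  Measure.pi fun _ => (AddCircle.haarAddCircle : Measure UnitAddCircle)

instance : IsProbabilityMeasure torusHaar := by unfold torusHaar; infer_instance

theorem measurePreserving_toTorus_haar : MeasurePreserving (toTorus a) (cellMeasure a) torusHaar := by
  have h : (AddCircle.haarAddCircle : Measure UnitAddCircle) = volume := by
    rw [AddCircle.volume_eq_smul_haarAddCircle, ENNReal.ofReal_one, one_smul]
  rw [torusHaar, h]
  exact measurePreserving_toTorus a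

theorem hasSum_sq_mFourierCoeff_torusHaar (f : Lp ℂ 2 torusHaar) :
    HasSum (fun n => ‖UnitAddTorus.mFourierCoeff f n‖ ^ 2) (∫ y, ‖f y‖ ^ 2 ∂torusHaar) :=
  UnitAddTorus.hasSum_sq_mFourierCoeff f

theorem mFourierCoeff_eq_integral_torusHaar (f : UnitAddTorus (Fin 3) → ℂ) (n : Fin 3 → ℤ) :
    UnitAddTorus.mFourierCoeff f n = ∫ y, UnitAddTorus.mFourier (-n) y • f y ∂torusHaar := rfl

theorem cellFourier_eq {p : Vec3 → ℂ} (hp : Measurable p) (n : Fin 3 → ℤ) :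
    cellFourier a p (∑ l, (n l : ℝ) • recipBasis a l) =
      (volume.real (unitCell a) : ℂ) * UnitAddTorus.mFourierCoeff (fun y => p (ofTorus a y)) n := by
  have hv : volume.real (unitCell a) ≠ 0 :=
    (ENNReal.toReal_pos (volume_unitCell_ne_zero a) (volume_unitCell_ne_top a)).ne'
  have hm : Measurable fun y => UnitAddTorus.mFourier (-n) y • p (ofTorus a y) :=
    (UnitAddTorus.mFourier (-n)).continuous.measurable.smul (hp.comp (measurable_ofTorus a))
  have h1 : UnitAddTorus.mFourierCoeff (fun y => p (ofTorus a y)) n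
      = ∫ r, UnitAddTorus.mFourier (-n) (toTorus a r) • p (ofTorus a (toTorus a r))
        ∂(cellMeasure a) := by
    rw [mFourierCoeff_eq_integral_torusHaar, ← (measurePreserving_toTorus_haar a).map_eq,
      integral_map (measurable_toTorus a).aemeasurable hm.aestronglyMeasurable]
  rw [h1, cellMeasure, ProbabilityTheory.cond, integral_smul_measure, ENNReal.toReal_inv,
    Complex.real_smul, ← mul_assoc, ← Complex.ofReal_mul, ← Measure.real, mul_inv_cancel₀ hv,
    Complex.ofReal_one, one_mul, cellFourier]
  refine setIntegral_congr_fun (measurableSet_unitCell a) fun r hr => ?_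
  rw [ofTorus_toTorus, ZSpan.fract_eq_self.mpr hr, mFourier_toTorus, smul_eq_mul, mul_comm]

/-- Bessel's inequality on the unit cell. -/
theorem sum_sq_cellFourier_le {p : Vec3 → ℂ} (hp : Measurable p) {M : ℝ}
    (hM : ∀ r ∈ unitCell a, ‖p r‖ ≤ M) (s : Finset (recipLattice a)) :
    ∑ G ∈ s, ‖cellFourier a p G‖ ^ 2 ≤ (volume.real (unitCell a) * M) ^ 2 := by
  choose n hn using fun G : recipLattice a => mem_lattice_iff.mp G.2
  have hinj : Function.Injective n := fun G G' h => Subtype.ext (by rw [hn G, hn G', h])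
  have hM0 : 0 ≤ M := (norm_nonneg _).trans (hM _ (ofTorus_mem a 0))
  have hpm : Measurable fun y => p (ofTorus a y) := hp.comp (measurable_ofTorus a)
  have hmem : MemLp (fun y => p (ofTorus a y)) 2 torusHaar :=
    MemLp.of_bound hpm.aestronglyMeasurable M (.of_forall fun y => hM _ (ofTorus_mem a y))
  have hco : ∀ n, UnitAddTorus.mFourierCoeff (hmem.toLp _) n
      = UnitAddTorus.mFourierCoeff (fun y => p (ofTorus a y)) n := fun n => by
    rw [mFourierCoeff_eq_integral_torusHaar, mFourierCoeff_eq_integral_torusHaar]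
    refine integral_congr_ae ?_
    filter_upwards [hmem.coeFn_toLp] with y hy
    rw [hy]
  have hsum := hasSum_sq_mFourierCoeff_torusHaar (hmem.toLp _)
  have hle : ∫ y, ‖hmem.toLp _ y‖ ^ 2 ∂torusHaar ≤ M ^ 2 := by
    have h1 : ∫ y, ‖hmem.toLp _ y‖ ^ 2 ∂torusHaar = ∫ y, ‖p (ofTorus a y)‖ ^ 2 ∂torusHaar := by
      refine integral_congr_ae ?_
      filter_upwards [hmem.coeFn_toLp] with y hy
      rw [hy]
    rw [h1]
    refine (le_abs_self _).trans ((Real.norm_eq_abs _).symm.le.trans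
      ((norm_integral_le_of_norm_le_const (C := M ^ 2) (.of_forall fun y => ?_)).trans (by simp)))
    rw [norm_pow, norm_norm]
    exact pow_le_pow_left₀ (norm_nonneg _) (hM _ (ofTorus_mem a y)) 2
  have hfin := (sum_le_hasSum (s.map ⟨n, hinj⟩) (fun i _ => by positivity) hsum).trans hle
  rw [Finset.sum_map] at hfin
  rw [mul_pow]
  refine le_trans (le_of_eq ?_) (mul_le_mul_of_nonneg_left hfin (sq_nonneg _))
  rw [Finset.mul_sum]
  refine Finset.sum_congr rfl fun G _ => ?_
  conv_lhs => rw [hn G]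
  rw [cellFourier_eq a hp, norm_mul, mul_pow, hco, Complex.norm_real, Real.norm_eq_abs, sq_abs]
  rfl

theorem norm_cellFourier_le {p : Vec3 → ℂ} {M : ℝ}
    (hM : ∀ r ∈ unitCell a, ‖p r‖ ≤ M) (G : Vec3) :
    ‖cellFourier a p G‖ ≤ volume.real (unitCell a) * M := by
  rw [mul_comm]
  refine norm_setIntegral_le_of_norm_le_const (volume_unitCell_ne_top a).lt_top fun r hr => ?_
  rw [norm_mul, Complex.norm_exp]
  simpa using hM r hr

theorem integrableOn_cell_of_continuous {p : Vec3 → ℂ} (hp : Continuous p) :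
    IntegrableOn p (unitCell a) :=
  (hp.continuousOn.integrableOn_compact (isBounded_unitCell a).isCompact_closure).mono_set
    subset_closure

theorem fwdDiff_iter_cellFourier {p : ℕ → Vec3 → ℂ} (hp : ∀ j, Continuous (p j)) (G : Vec3)
    (i j : ℕ) : (fwdDiff 1)^[i] (fun j => cellFourier a (p j) G) j
      = cellFourier a (fun r => (fwdDiff 1)^[i] (fun j => p j r) j) G := by
  induction i generalizing p with
  | zero => rfl
  | succ i ih =>
    have h := ih (p := fun j r => p (j + 1) r - p j r) fun j => (hp (j + 1)).sub (hp j)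
    have e : fwdDiff 1 (fun j => cellFourier a (p j) G)
        = fun j => cellFourier a (fun r => p (j + 1) r - p j r) G := by
      funext j
      have hc : Continuous fun r : Vec3 => Complex.exp (-(Complex.I * ((inner ℝ G r : ℝ) : ℂ))) := by
        fun_prop
      simp only [fwdDiff, cellFourier, sub_mul]
      exact (integral_sub (integrableOn_cell_of_continuous a ((hp (j + 1)).mul hc))
        (integrableOn_cell_of_continuous a ((hp j).mul hc))).symm
    rw [Function.iterate_succ_apply, e, h]
    rfl

theorem measurable_fwdDiff_iter {p : ℕ → Vec3 → ℂ} (hp : ∀ j, Continuous (p j)) (i j : ℕ) :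
    Measurable fun r => (fwdDiff 1)^[i] (fun j => p j r) j := by
  induction i generalizing p with
  | zero => exact (hp j).measurable
  | succ i ih =>
    exact ih (p := fun j r => p (j + 1) r - p j r) fun j => (hp (j + 1)).sub (hp j)

/-- Finite differences of a sequence of Fourier coefficients, in the square-summable sense. -/
theorem DiffBound.sum_sq_cellFourier_le {p : ℕ → Vec3 → ℂ} (hp : ∀ j, Continuous (p j)) {ε C : ℝ}
    {n : ℕ} (h : ∀ r ∈ unitCell a, DiffBound ε n C (fun j => p j r)) {i j : ℕ} (hij : i + j ≤ n)
    (s : Finset (recipLattice a)) :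
    ∑ G ∈ s, ‖(fwdDiff 1)^[i] (fun j => cellFourier a (p j) G) j‖ ^ 2
      ≤ (volume.real (unitCell a) * C * ε ^ i) ^ 2 := by
  simp only [fwdDiff_iter_cellFourier a hp]
  rw [mul_assoc]
  exact _root_.sum_sq_cellFourier_le a (measurable_fwdDiff_iter hp i j) (fun r hr => h r hr i j hij) s

theorem DiffBound.cellFourier {p : ℕ → Vec3 → ℂ} (hp : ∀ j, Continuous (p j)) {ε C : ℝ}
    {n : ℕ} (h : ∀ r ∈ unitCell a, DiffBound ε n C (fun j => p j r)) (G : Vec3) :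
    DiffBound ε n (volume.real (unitCell a) * C) (fun j => cellFourier a (p j) G) := by
  intro i j hij
  rw [fwdDiff_iter_cellFourier a hp, mul_assoc]
  exact norm_cellFourier_le a (fun r hr => h r hr i j hij) G

end Bessel

/-! ### Sums of sequences with controlled differences -/

section TsumDiff

theorem DiffBound.tsum {Γ : Type*} {ε : ℝ} {n : ℕ} {c : Γ → ℝ} {f : Γ → ℕ → ℂ} (hc : Summable c)
    (h : ∀ G, DiffBound ε n (c G) (f G)) : DiffBound ε n (∑' G, c G) (fun j => ∑' G, f G j) := by
  have hsum : ∀ {n : ℕ} {c : Γ → ℝ} {f : Γ → ℕ → ℂ}, Summable c → (∀ G, DiffBound ε n (c G) (f G)) →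
      ∀ j ≤ n, Summable fun G => f G j := fun hc h j hj =>
    Summable.of_norm_bounded hc fun G => (h G).norm_le hj
  have hval : ∀ {n : ℕ} {c : Γ → ℝ} {f : Γ → ℕ → ℂ}, Summable c → (∀ G, DiffBound ε n (c G) (f G)) →
      ∀ j ≤ n, ‖∑' G, f G j‖ ≤ ∑' G, c G := fun hc h j hj =>
    tsum_of_norm_bounded hc.hasSum fun G => (h G).norm_le hj
  induction n generalizing c f with
  | zero => exact DiffBound.zero_iff.mpr (hval hc h 0 le_rfl)
  | succ n ih =>
    refine DiffBound.succ_iff.mpr ⟨hval hc h, ?_⟩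
    rw [← tsum_mul_right]
    refine (ih (hc.mul_right ε) fun G => (DiffBound.succ_iff.mp (h G)).2).congr' fun j hj => ?_
    exact (hsum hc h (j + 1) (by omega)).tsum_sub (hsum hc h j (by omega))

/-- The sum of the scaled finite differences of a sequence. -/
def diffSize (ε : ℝ) (n : ℕ) (a : ℕ → ℂ) : ℝ :=
  ∑ p ∈ (Finset.range (n + 1) ×ˢ Finset.range (n + 1)).filter (fun p => p.1 + p.2 ≤ n),
    ‖(fwdDiff 1)^[p.1] a p.2‖ / ε ^ p.1

theorem DiffBound.of_diffSize {ε : ℝ} (hε : 0 < ε) (n : ℕ) (a : ℕ → ℂ) :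
    DiffBound ε n (diffSize ε n a) a := by
  intro i j hij
  rw [← div_le_iff₀ (pow_pos hε i)]
  refine Finset.single_le_sum (f := fun p : ℕ × ℕ => ‖(fwdDiff 1)^[p.1] a p.2‖ / ε ^ p.1)
    (fun p _ => by positivity) (a := (i, j)) ?_
  simp only [Finset.mem_filter, Finset.mem_product, Finset.mem_range]
  omega

theorem diffSize_nonneg {ε : ℝ} (hε : 0 < ε) (n : ℕ) (a : ℕ → ℂ) : 0 ≤ diffSize ε n a :=
  Finset.sum_nonneg fun p _ => by positivity

/-- Cauchy–Schwarz over the at most (n+1)² pairs (i, j) reduces this to Bessel's inequality for each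
pair. It provides a constant for every G that is square summable in G, which the uniform bound of a
single coefficient does not give. -/
theorem sum_sq_diffSize_le {Γ : Type*} {ε : ℝ} (hε : 0 < ε) {n : ℕ} {A : Γ → ℕ → ℂ} {C : ℝ}
    {s : Finset Γ}
    (h : ∀ i j, i + j ≤ n → ∑ G ∈ s, ‖(fwdDiff 1)^[i] (A G) j‖ ^ 2 ≤ (C * ε ^ i) ^ 2) :
    ∑ G ∈ s, diffSize ε n (A G) ^ 2 ≤ ((n + 1) ^ 2 * C) ^ 2 := by
  set T := (Finset.range (n + 1) ×ˢ Finset.range (n + 1)).filter (fun p : ℕ × ℕ => p.1 + p.2 ≤ n)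
    with hT
  have hcard : (T.card : ℝ) ≤ (n + 1) ^ 2 := by
    have : T.card ≤ (n + 1) * (n + 1) := (Finset.card_filter_le _ _).trans (by simp)
    rw [sq]
    exact_mod_cast this
  calc ∑ G ∈ s, diffSize ε n (A G) ^ 2
      ≤ ∑ G ∈ s, T.card * ∑ p ∈ T, (‖(fwdDiff 1)^[p.1] (A G) p.2‖ / ε ^ p.1) ^ 2 :=
        Finset.sum_le_sum fun G _ => sq_sum_le_card_mul_sum_sq
    _ = T.card * ∑ p ∈ T, ∑ G ∈ s, (‖(fwdDiff 1)^[p.1] (A G) p.2‖ / ε ^ p.1) ^ 2 := by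
        rw [← Finset.mul_sum, Finset.sum_comm]
    _ ≤ T.card * ∑ p ∈ T, C ^ 2 := by
        refine mul_le_mul_of_nonneg_left (Finset.sum_le_sum fun p hp => ?_) (by positivity)
        have hp' := (Finset.mem_filter.mp hp).2
        simp only [div_pow, ← Finset.sum_div]
        rw [div_le_iff₀ (by positivity), ← mul_pow]
        exact h p.1 p.2 hp'
    _ = (T.card * C) ^ 2 := by rw [Finset.sum_const, nsmul_eq_mul]; ring
    _ ≤ ((n + 1) ^ 2 * C) ^ 2 := by
        rw [mul_pow, mul_pow]
        exact mul_le_mul_of_nonneg_right (pow_le_pow_left₀ (by positivity) hcard 2) (sq_nonneg _)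

theorem sum_diffSize_mul_le {Γ : Type*} {ε : ℝ} {n : ℕ} {A B : Γ → ℕ → ℂ} {D : ℝ}
    {s : Finset Γ} (hA : ∑ G ∈ s, diffSize ε n (A G) ^ 2 ≤ D)
    (hB : ∑ G ∈ s, diffSize ε n (B G) ^ 2 ≤ D) :
    ∑ G ∈ s, diffSize ε n (A G) * diffSize ε n (B G) ≤ D := by
  have : ∑ G ∈ s, diffSize ε n (A G) * diffSize ε n (B G)
      ≤ ∑ G ∈ s, (diffSize ε n (A G) ^ 2 + diffSize ε n (B G) ^ 2) / 2 :=
    Finset.sum_le_sum fun G _ => by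
      linarith [two_mul_le_add_sq (diffSize ε n (A G)) (diffSize ε n (B G))]
  rw [← Finset.sum_div, Finset.sum_add_distrib] at this
  linarith

end TsumDiff

/-! ### The Coulomb kernel along a line -/

section Coulomb

theorem DiffBound.const {F : Type*} [NormedAddCommGroup F] {ε : ℝ} (hε : 0 ≤ ε) (n : ℕ) (c : F) :
    DiffBound ε n ‖c‖ (fun _ => c) := by
  have h0 : ∀ C, 0 ≤ C → DiffBound ε n C (fun _ => (0 : F)) := by
    intro C hC
    induction n generalizing C with
    | zero => rw [DiffBound.zero_iff]; simpa using hC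
    | succ n ih =>
      refine DiffBound.succ_iff.mpr ⟨fun j _ => by simpa using hC, ?_⟩
      simpa using ih (C * ε) (by positivity)
  cases n with
  | zero => rw [DiffBound.zero_iff]
  | succ n =>
    refine DiffBound.succ_iff.mpr ⟨fun j _ => le_rfl, ?_⟩
    rw [fwdDiff_const]
    have h := h0 (‖c‖ * ε) (by positivity)
    exact h.order_mono (Nat.le_succ n)

theorem DiffBound.linear {ε : ℝ} (hε : 0 ≤ ε) {n : ℕ} {v h : ℂ} {C : ℝ}
    (hv : ∀ j ≤ n, ‖v + j * h‖ ≤ C) (hh : ‖h‖ ≤ C * ε) : DiffBound ε n C (fun j => v + j * h) := by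
  cases n with
  | zero => rw [DiffBound.zero_iff]; exact hv 0 le_rfl
  | succ n =>
    refine DiffBound.succ_iff.mpr ⟨hv, ?_⟩
    refine ((DiffBound.const hε n h).mono hε le_rfl hh).congr' fun j _ => ?_
    simp only [fwdDiff]
    push_cast
    ring

/-- Four steps of length at most ‖v‖/8 move v by at most ‖v‖/2. This is the origin of the factor 8
in all the conditions on distances. -/
theorem norm_add_smul_bounds {v h : Vec3} (h8 : 8 * ‖h‖ ≤ ‖v‖) {τ : ℝ} (h0 : 0 ≤ τ) (h4 : τ ≤ 4) :
    ‖v‖ / 2 ≤ ‖v + τ • h‖ ∧ ‖v + τ • h‖ ≤ 2 * ‖v‖ := by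
  have h1 : ‖τ • h‖ ≤ ‖v‖ / 2 := by
    rw [norm_smul, Real.norm_eq_abs, abs_of_nonneg h0]
    nlinarith [norm_nonneg h]
  have h2 := norm_add_le v (τ • h)
  have h3 := norm_sub_le_norm_add v (τ • h)
  constructor <;> linarith [norm_nonneg v]

/-- After division by ‖v‖², the squared norm along the line is a sum of three squares of affine
sequences, and it stays above 1/4. The reciprocal estimate then applies with constants independent
of v and h. -/
theorem exists_diffBound_coulomb : ∃ K : ℝ, 0 ≤ K ∧ ∀ (v h : Vec3) (ε : ℝ), 0 ≤ ε → v ≠ 0 →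
    8 * ‖h‖ ≤ ‖v‖ → ‖h‖ ≤ ε * ‖v‖ →
    DiffBound ε 4 (K * (‖v‖ ^ 2)⁻¹)
      (fun j : ℕ => ((1 / ‖v + (j : ℝ) • h‖ ^ 2 : ℝ) : ℂ)) := by
  -- 192 = 3 · 2^4 · 2²: three coordinates, the factor of the product rule, and |v_l + j h_l| ≤
  -- 2‖v‖. The lower bound 1/4 comes from ‖v + j h‖ ≥ ‖v‖/2.
  refine ⟨max 0 (invConst 192 (1 / 4) 4), le_max_left _ _, fun v h ε hε hv h8 hh => ?_⟩
  have hσ : 0 < ‖v‖ := norm_pos_iff.mpr hv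
  have hb : ∀ j : ℕ, j ≤ 4 → ‖v‖ / 2 ≤ ‖v + (j : ℝ) • h‖ ∧ ‖v + (j : ℝ) • h‖ ≤ 2 * ‖v‖ := fun j hj =>
    norm_add_smul_bounds h8 (by positivity) (by exact_mod_cast hj)
  have hx : ∀ l : Fin 3, DiffBound ε 4 (2 * ‖v‖) (fun j : ℕ => ((v l : ℝ) : ℂ) + j * ((h l : ℝ) : ℂ)) := by
    intro l
    refine DiffBound.linear hε (fun j hj => ?_) ?_
    · have h1 := PiLp.norm_apply_le (v + (j : ℝ) • h) l
      refine le_trans (le_of_eq ?_) (h1.trans (hb j hj).2)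
      rw [← Complex.norm_real]
      congr 1
      simp
    · rw [Complex.norm_real]
      have := PiLp.norm_apply_le h l
      nlinarith
  have hsq := fun l => (hx l).mul (hx l)
  have hsum := ((hsq 0).add (hsq 1)).add (hsq 2)
  have hsc := hsum.const_smul (((‖v‖ ^ 2)⁻¹ : ℝ) : ℂ)
  have hval : ∀ j : ℕ, ((v 0 : ℂ) + j * (h 0 : ℂ)) * ((v 0 : ℂ) + j * (h 0 : ℂ)) +
      ((v 1 : ℂ) + j * (h 1 : ℂ)) * ((v 1 : ℂ) + j * (h 1 : ℂ)) +
      ((v 2 : ℂ) + j * (h 2 : ℂ)) * ((v 2 : ℂ) + j * (h 2 : ℂ)) =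
        ((‖v + (j : ℝ) • h‖ ^ 2 : ℝ) : ℂ) := by
    intro j
    rw [EuclideanSpace.norm_sq_eq, Fin.sum_univ_three]
    simp only [PiLp.add_apply, PiLp.smul_apply, smul_eq_mul, Real.norm_eq_abs, sq_abs]
    push_cast
    ring
  have hn : ‖(((‖v‖ ^ 2)⁻¹ : ℝ) : ℂ)‖ = (‖v‖ ^ 2)⁻¹ := by
    rw [Complex.norm_real, Real.norm_eq_abs, abs_of_nonneg (by positivity)]
  have h192 : DiffBound ε 4 192
      (fun j : ℕ => (((‖v‖ ^ 2)⁻¹ : ℝ) : ℂ) • ((‖v + (j : ℝ) • h‖ ^ 2 : ℝ) : ℂ)) := by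
    refine (hsc.mono hε le_rfl ?_).congr' fun j _ => by rw [hval j]
    rw [hn]
    refine le_of_eq ?_
    field_simp
    norm_num
  have hinv := h192.inv hε (c := 1 / 4) (by norm_num) fun j hj => by
    rw [norm_smul, hn, Complex.norm_real, Real.norm_eq_abs, abs_of_nonneg (by positivity),
      inv_mul_eq_div, le_div_iff₀ (by positivity)]
    nlinarith [(hb j hj).1]
  have hfin := hinv.const_smul (((‖v‖ ^ 2)⁻¹ : ℝ) : ℂ)
  rw [hn] at hfin
  refine (hfin.mono hε le_rfl ?_).congr' fun j hj => ?_
  · rw [mul_comm]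
    exact mul_le_mul_of_nonneg_right (le_max_right _ _) (by positivity)
  · have h1 : ((‖v‖ : ℝ) : ℂ) ≠ 0 := by exact_mod_cast hσ.ne'
    have h2 : ((‖v + (j : ℝ) • h‖ : ℝ) : ℂ) ≠ 0 := by
      have := (hb j hj).1
      exact_mod_cast (by linarith : 0 < ‖v + (j : ℝ) • h‖).ne'
    simp only [smul_eq_mul]
    push_cast
    field_simp

end Coulomb

/-! ### Pair densities of Bloch orbitals -/

section PairDensity

variable {a : Module.Basis (Fin 3) ℝ Vec3} {ι : Type} {ψ : ι → Vec3 → Vec3 → ℂ}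

theorem exists_mem_lattice_add_mem_unitCell (b : Module.Basis (Fin 3) ℝ Vec3) (k : Vec3) :
    ∃ G ∈ lattice b, k + G ∈ unitCell b :=
  ⟨-(ZSpan.floor b k : Vec3), (lattice b).neg_mem (ZSpan.floor b k).2, by
    rw [← sub_eq_add_neg]; exact ZSpan.fract_mem_fundamentalDomain b k⟩

theorem PeriodicCC.IsBlochOrbitals.continuous [DecidableEq ι] (hψ : IsBlochOrbitals a ψ) (n : ι) :
    Continuous fun p : Vec3 × Vec3 => ψ n p.1 p.2 := by
  have h0 := hψ.continuous_deriv n 0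
  have : (fun p : Vec3 × Vec3 => ψ n p.1 p.2)
      = fun p => (iteratedFDeriv ℝ 0 (fun k => ψ n k p.2) p.1) (fun _ => 0) := by
    funext p; simp
  rw [this]
  exact (ContinuousMultilinearMap.apply ℝ (fun _ : Fin 0 => Vec3) ℂ (fun _ => 0)).continuous.comp h0

theorem PeriodicCC.IsBlochOrbitals.exists_deriv_bound [DecidableEq ι] [Finite ι]
    (hψ : IsBlochOrbitals a ψ) (N : ℕ) :
    ∃ M, ∀ n, ∀ i ≤ N, ∀ k, ∀ r ∈ unitCell a, ‖iteratedFDeriv ℝ i (fun k => ψ n k r) k‖ ≤ M := by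
  have h1 : ∀ n i, ∃ M, ∀ k, ∀ r ∈ unitCell a, ‖iteratedFDeriv ℝ i (fun k => ψ n k r) k‖ ≤ M := by
    intro n i
    obtain ⟨M, hM⟩ := ((isBounded_unitCell (recipBasis a)).isCompact_closure.prod
      (isBounded_unitCell a).isCompact_closure).exists_bound_of_continuousOn
      (hψ.continuous_deriv n i).continuousOn
    refine ⟨M, fun k r hr => ?_⟩
    obtain ⟨G, hG, hk⟩ := exists_mem_lattice_add_mem_unitCell (recipBasis a) k
    have h2 := hM (k + G, r) ⟨subset_closure hk, subset_closure hr⟩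
    have h3 := iteratedFDeriv_comp_add_right (𝕜 := ℝ) (f := fun k => ψ n k r) i G k
    simp only [hψ.periodic n _ r G hG] at h3
    rw [h3]
    exact h2
  choose M hM using h1
  have := Fintype.ofFinite ι
  refine ⟨∑ n, ∑ i ∈ Finset.range (N + 1), |M n i|, fun n i hi k r hr => (hM n i k r hr).trans ?_⟩
  calc M n i ≤ |M n i| := le_abs_self _
    _ ≤ ∑ i ∈ Finset.range (N + 1), |M n i| :=
      Finset.single_le_sum (f := fun i => |M n i|) (fun _ _ => abs_nonneg _)
        (Finset.mem_range.mpr (by omega))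
    _ ≤ _ := Finset.single_le_sum (f := fun n => ∑ i ∈ Finset.range (N + 1), |M n i|)
        (fun _ _ => Finset.sum_nonneg fun _ _ => abs_nonneg _) (Finset.mem_univ n)

variable (ψ) in
/-- The product of two orbitals, with the phase of the momentum transfer removed. -/
def pairDensity (n₁ : ι) (k₁ : Vec3) (n₂ : ι) (k₂ : Vec3) (r : Vec3) : ℂ :=
  conj (ψ n₁ k₁ r) * Complex.exp (Complex.I * ((inner ℝ (k₁ - k₂) r : ℝ) : ℂ)) * ψ n₂ k₂ r

variable (a ψ) in
theorem pairProduct_eq (n₁ : ι) (k₁ : Vec3) (n₂ : ι) (k₂ : Vec3) (G : Vec3) :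
    pairProduct a ψ n₁ k₁ n₂ k₂ G = cellFourier a (pairDensity ψ n₁ k₁ n₂ k₂) G := by
  refine integral_congr_ae (.of_forall fun r => ?_)
  simp only [pairDensity]
  rw [inner_sub_left (k₁ - k₂) G r, Complex.ofReal_sub, mul_sub, sub_eq_add_neg, Complex.exp_add]
  ring

theorem continuous_pairDensity [DecidableEq ι] (hψ : IsBlochOrbitals a ψ) (n₁ : ι) (k₁ : Vec3)
    (n₂ : ι) (k₂ : Vec3) : Continuous (pairDensity ψ n₁ k₁ n₂ k₂) := by
  have h : ∀ n k, Continuous (ψ n k) := fun n k =>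
    (hψ.continuous n).comp (Continuous.prodMk_right k)
  unfold pairDensity
  refine ((Complex.continuous_conj.comp (h n₁ k₁)).mul ?_).mul (h n₂ k₂)
  fun_prop

/-- Along a line the phase is a geometric sequence whose ratio differs from 1 by at most 2Rη, where
R bounds ‖r‖ on the unit cell. The orbitals have k-derivatives bounded uniformly, by periodicity and
compactness. -/
theorem exists_diffBound_pairDensity [DecidableEq ι] [Finite ι] (hψ : IsBlochOrbitals a ψ) :
    ∃ C, 0 ≤ C ∧ ∀ n₁ k₁ h₁ n₂ k₂ h₂ η, ‖h₁‖ ≤ η → ‖h₂‖ ≤ η → ∀ r ∈ unitCell a,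
      DiffBound η 4 C
        (fun j : ℕ => pairDensity ψ n₁ (k₁ + (j : ℝ) • h₁) n₂ (k₂ + (j : ℝ) • h₂) r) := by
  obtain ⟨M, hM⟩ := hψ.exists_deriv_bound 4
  obtain ⟨R, hR⟩ := (isBounded_unitCell a).exists_norm_le
  refine ⟨max 0 (2 ^ 4 * (2 ^ 4 * M * (1 * max 1 (2 * R) ^ 4)) * M), le_max_left _ _,
    fun n₁ k₁ h₁ n₂ k₂ h₂ η hh₁ hh₂ r hr => ?_⟩
  have hη : 0 ≤ η := (norm_nonneg _).trans hh₁
  have horb : ∀ n k (h : Vec3), ‖h‖ ≤ η → DiffBound η 4 M (fun j : ℕ => ψ n (k + (j : ℝ) • h) r) := by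
    intro n k h hh
    exact DiffBound.of_contDiffAt (f := fun k => ψ n k r)
      (fun τ _ => (contDiff_infty.mp (hψ.smooth n r) 4).contDiffAt) hh
      fun i hi τ _ => hM n i hi _ r hr
  have hexp : DiffBound η 4 (1 * max 1 (2 * R) ^ 4) (fun j : ℕ => Complex.exp (Complex.I *
      ((inner ℝ ((k₁ + (j : ℝ) • h₁) - (k₂ + (j : ℝ) • h₂)) r : ℝ) : ℂ))) := by
    refine DiffBound.of_scaled ?_ hη (le_max_left _ _)
    refine (DiffBound.geometric (z := Complex.exp (Complex.I * ((inner ℝ (h₁ - h₂) r : ℝ) : ℂ)))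
      (w := Complex.exp (Complex.I * ((inner ℝ (k₁ - k₂) r : ℝ) : ℂ))) ?_ ?_ ?_).congr' ?_
    · rw [Complex.norm_exp]; simp
    · rw [Complex.norm_exp]; simp
    · refine Real.norm_exp_I_mul_ofReal_sub_one_le.trans ((norm_inner_le_norm _ _).trans ?_)
      have h1 : ‖h₁ - h₂‖ ≤ 2 * η := (norm_sub_le _ _).trans (by linarith)
      calc ‖h₁ - h₂‖ * ‖r‖ ≤ (2 * η) * R := mul_le_mul h1 (hR r hr) (norm_nonneg _) (by positivity)
        _ = 2 * R * η := by ring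
        _ ≤ _ := mul_le_mul_of_nonneg_right (le_max_right _ _) hη
    · intro j _
      rw [← Complex.exp_nat_mul, ← Complex.exp_add]
      congr 1
      rw [show (k₁ + (j : ℝ) • h₁) - (k₂ + (j : ℝ) • h₂) = (k₁ - k₂) + (j : ℝ) • (h₁ - h₂) by module,
        inner_add_left (k₁ - k₂), real_inner_smul_left]
      push_cast
      ring
  exact (((horb n₁ k₁ h₁ hh₁).conj.mul hexp).mul (horb n₂ k₂ h₂ hh₂)).mono hη le_rfl
    (le_max_right _ _)

/-- Orthogonal bands: the pair product vanishes linearly at zero momentum transfer. -/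
theorem exists_norm_pairProduct_le [DecidableEq ι] [Finite ι] (hψ : IsBlochOrbitals a ψ) :
    ∃ C, 0 ≤ C ∧ ∀ n₁ k₁ n₂ k₂, n₁ ≠ n₂ → ∀ G ∈ recipLattice a,
      ‖pairProduct a ψ n₁ k₁ n₂ k₂ G‖ ≤ C * ‖k₂ - k₁ + G‖ := by
  obtain ⟨C, hC0, hC⟩ := exists_diffBound_pairDensity hψ
  refine ⟨volume.real (unitCell a) * C, by positivity, fun n₁ k₁ n₂ k₂ hn G hG => ?_⟩
  -- A single step leads from k₁ − G to k₂, with k₁ fixed. At its starting point the pair product is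
  -- an overlap of two different bands at k₁, hence zero, so the first difference is the pair
  -- product itself.
  have h := DiffBound.cellFourier a (ε := ‖k₂ - k₁ + G‖) (fun j : ℕ =>
    continuous_pairDensity hψ n₁ (k₁ + (j : ℝ) • (0 : Vec3)) n₂ (k₁ - G + (j : ℝ) • (k₂ - k₁ + G)))
    (hC n₁ k₁ 0 n₂ (k₁ - G) (k₂ - k₁ + G) _ (by simp) le_rfl) G 1 0 (by norm_num)
  have hzero : cellFourier a (pairDensity ψ n₁ k₁ n₂ (k₁ - G)) G = 0 := by
    have := hψ.orthonormal k₁ n₁ n₂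
    rw [if_neg hn] at this
    rw [← this]
    refine integral_congr_ae (.of_forall fun r => ?_)
    simp only [pairDensity]
    rw [show k₁ - (k₁ - G) = G by abel, mul_right_comm, mul_assoc (conj (ψ n₁ k₁ r)) (Complex.exp _),
      ← Complex.exp_add, add_neg_cancel, Complex.exp_zero, mul_one,
      ← hψ.periodic n₂ (k₁ - G) r G hG, sub_add_cancel]
  rw [pairProduct_eq]
  simp only [Function.iterate_one, fwdDiff, pow_one, smul_zero, add_zero, Nat.cast_zero, zero_smul,
    zero_add, Nat.cast_one, one_smul] at h
  rw [hzero, sub_zero, show k₁ - G + (k₂ - k₁ + G) = k₂ by abel] at h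
  exact h

end PairDensity

/-! ### Electron repulsion integrals -/

section ERI

variable {a : Module.Basis (Fin 3) ℝ Vec3} {ι : Type} {ψ : ι → Vec3 → Vec3 → ℂ}

theorem eriTerm_of_ne {n₁ n₂ n₃ n₄ : ι} {k₁ k₂ k₃ : Vec3} {G : recipLattice a}
    (h : k₃ - k₁ + (G : Vec3) ≠ 0) : eriTerm a ψ n₁ k₁ n₂ k₂ n₃ k₃ n₄ G =
      ((1 / ‖k₃ - k₁ + (G : Vec3)‖ ^ 2 : ℝ) : ℂ) *
        (cellFourier a (pairDensity ψ n₁ k₁ n₃ k₃) G *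
          cellFourier a (pairDensity ψ n₂ k₂ n₄ (k₂ - (k₃ - k₁))) (-G)) := by
  simp only [eriTerm, if_neg h, pairProduct_eq, add_sub_cancel]
  rw [mul_assoc]

theorem eriTerm_of_eq {n₁ n₂ n₃ n₄ : ι} {k₁ k₂ k₃ : Vec3} {G : recipLattice a}
    (h : k₃ - k₁ + (G : Vec3) = 0) : eriTerm a ψ n₁ k₁ n₂ k₂ n₃ k₃ n₄ G = 0 := by
  simp only [eriTerm, if_pos h]

theorem exists_diffSize_cellFourier_le [DecidableEq ι] [Finite ι] (hψ : IsBlochOrbitals a ψ)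
    {R : ℝ} (hR : 1 ≤ R) :
    ∃ D, 0 ≤ D ∧ ∀ n₁ k₁ h₁ n₂ k₂ h₂ η ε, 0 < ε → η ≤ R * ε → ‖h₁‖ ≤ η → ‖h₂‖ ≤ η →
      ∀ s : Finset (recipLattice a), ∑ G ∈ s, diffSize ε 4 (fun j : ℕ => cellFourier a
        (pairDensity ψ n₁ (k₁ + (j : ℝ) • h₁) n₂ (k₂ + (j : ℝ) • h₂)) G) ^ 2 ≤ D := by
  obtain ⟨C, hC0, hC⟩ := exists_diffBound_pairDensity hψ
  refine ⟨(((4 : ℕ) + 1) ^ 2 * (volume.real (unitCell a) * (C * R ^ 4))) ^ 2, by positivity,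
    fun n₁ k₁ h₁ n₂ k₂ h₂ η ε hε hηε hh₁ hh₂ s => ?_⟩
  refine sum_sq_diffSize_le hε fun i j hij => ?_
  refine DiffBound.sum_sq_cellFourier_le a (fun j => continuous_pairDensity hψ _ _ _ _)
    (fun r hr => ?_) hij s
  exact (hC n₁ k₁ h₁ n₂ k₂ h₂ (R * ε) (hh₁.trans hηε) (hh₂.trans hηε) r hr).of_scaled hε.le hR

/-- The sum over the reciprocal lattice, one of whose terms is treated separately. -/
theorem exists_diffBound_eri_sum [DecidableEq ι] [Finite ι] (hψ : IsBlochOrbitals a ψ)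
    {R : ℝ} (hR : 1 ≤ R) :
    ∃ D, 0 ≤ D ∧ ∀ n₁ k₁ h₁ n₂ k₂ h₂ n₃ k₃ h₃ n₄ η ε, 0 < ε → η ≤ R * ε → ‖h₁‖ ≤ η → ‖h₂‖ ≤ η →
      ‖h₃‖ ≤ η → ‖h₃ - h₁‖ ≤ η → ‖h₂ - (h₃ - h₁)‖ ≤ η → ∀ G₀ : recipLattice a,
      latticeDist (recipBasis a) (k₃ - k₁) = ‖k₃ - k₁ + (G₀ : Vec3)‖ →
      (∀ G : recipLattice a, G ≠ G₀ →
        8 * η ≤ ‖k₃ - k₁ + (G : Vec3)‖ ∧ η ≤ ε * ‖k₃ - k₁ + (G : Vec3)‖) →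
      ∀ C₀, DiffBound ε 4 C₀ (fun j : ℕ => eriTerm a ψ n₁ (k₁ + (j : ℝ) • h₁) n₂ (k₂ + (j : ℝ) • h₂)
        n₃ (k₃ + (j : ℝ) • h₃) n₄ G₀) →
      (Summable (eriTerm a ψ n₁ k₁ n₂ k₂ n₃ k₃ n₄)) ∧
      DiffBound ε 4 (C₀ + D) (fun j : ℕ => ∑' G, eriTerm a ψ n₁ (k₁ + (j : ℝ) • h₁) n₂
        (k₂ + (j : ℝ) • h₂) n₃ (k₃ + (j : ℝ) • h₃) n₄ G) := by
  classical
  obtain ⟨D, hD0, hD⟩ := exists_diffSize_cellFourier_le hψ hR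
  obtain ⟨K, hK0, hK⟩ := exists_diffBound_coulomb
  obtain ⟨c, hc0, hc⟩ := exists_pos_le_norm (recipBasis a)
  set W : ℝ := 2 ^ 4 * (K * ((c / 2) ^ 2)⁻¹) * 2 ^ 4
  have hW : 0 ≤ W := by positivity
  refine ⟨W * D, by positivity,
    fun n₁ k₁ h₁ n₂ k₂ h₂ n₃ k₃ h₃ n₄ η ε hε hηε hh₁ hh₂ hh₃ hq hp G₀ hG₀ hG C₀ hC₀ => ?_⟩
  let A : recipLattice a → ℕ → ℂ := fun G j => cellFourier a
    (pairDensity ψ n₁ (k₁ + (j : ℝ) • h₁) n₃ (k₃ + (j : ℝ) • h₃)) G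
  let B : recipLattice a → ℕ → ℂ := fun G j => cellFourier a
    (pairDensity ψ n₂ (k₂ + (j : ℝ) • h₂) n₄ (k₂ - (k₃ - k₁) + (j : ℝ) • (h₂ - (h₃ - h₁)))) (-(G : Vec3))
  have hA : ∀ s : Finset (recipLattice a), ∑ G ∈ s, diffSize ε 4 (A G) ^ 2 ≤ D :=
    hD n₁ k₁ h₁ n₃ k₃ h₃ η ε hε hηε hh₁ hh₃
  have hB : ∀ s : Finset (recipLattice a), ∑ G ∈ s, diffSize ε 4 (B G) ^ 2 ≤ D := by
    intro s
    have := hD n₂ k₂ h₂ n₄ (k₂ - (k₃ - k₁)) (h₂ - (h₃ - h₁)) η ε hε hηε hh₂ hp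
      (s.map (Equiv.neg _).toEmbedding)
    rw [Finset.sum_map] at this
    exact this
  -- Convergence over G comes entirely from this product of two square-summable families; the
  -- Coulomb factor is only used as a bounded one.
  have hAB : ∀ s : Finset (recipLattice a), ∑ G ∈ s, diffSize ε 4 (A G) * diffSize ε 4 (B G) ≤ D :=
    fun s => sum_diffSize_mul_le (hA s) (hB s)
  have hnn : ∀ G, 0 ≤ diffSize ε 4 (A G) * diffSize ε 4 (B G) := fun G =>
    mul_nonneg (diffSize_nonneg hε _ _) (diffSize_nonneg hε _ _)
  have hsumAB : Summable fun G => W * (diffSize ε 4 (A G) * diffSize ε 4 (B G)) :=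
    (summable_of_sum_le hnn hAB).mul_left W
  have hterm : ∀ G : recipLattice a, G ≠ G₀ →
      DiffBound ε 4 (W * (diffSize ε 4 (A G) * diffSize ε 4 (B G)))
        (fun j : ℕ => eriTerm a ψ n₁ (k₁ + (j : ℝ) • h₁) n₂ (k₂ + (j : ℝ) • h₂) n₃
          (k₃ + (j : ℝ) • h₃) n₄ G) := by
    intro G hne
    obtain ⟨h8, hεG⟩ := hG G hne
    have hmin : ‖k₃ - k₁ + (G₀ : Vec3)‖ ≤ ‖k₃ - k₁ + (G : Vec3)‖ := by
      rw [← hG₀]; exact latticeDist_le _ G.2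
    -- G and G₀ are at least c apart and q + G₀ is no longer than q + G, so the triangle inequality
    -- gives c ≤ 2‖q + G‖.
    have hc2 : c / 2 ≤ ‖k₃ - k₁ + (G : Vec3)‖ := by
      have h1 := hc (G - G₀ : Vec3) (sub_mem G.2 G₀.2) (sub_ne_zero.mpr fun h => hne (Subtype.ext h))
      have h2 := norm_sub_le (k₃ - k₁ + (G : Vec3)) (k₃ - k₁ + (G₀ : Vec3))
      rw [add_sub_add_left_eq_sub] at h2
      linarith
    have hpos : 0 < ‖k₃ - k₁ + (G : Vec3)‖ := lt_of_lt_of_le (by positivity) hc2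
    have h8' : 8 * ‖h₃ - h₁‖ ≤ ‖k₃ - k₁ + (G : Vec3)‖ := by linarith
    have hw := hK (k₃ - k₁ + (G : Vec3)) (h₃ - h₁) ε hε.le (norm_pos_iff.mp hpos) h8' (hq.trans hεG)
    have hw' := hw.mono (C' := K * ((c / 2) ^ 2)⁻¹) hε.le le_rfl (mul_le_mul_of_nonneg_left
      (inv_anti₀ (by positivity) (pow_le_pow_left₀ (by positivity) hc2 2)) hK0)
    have hprod := hw'.mul ((DiffBound.of_diffSize hε 4 (A G)).mul (DiffBound.of_diffSize hε 4 (B G)))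
    refine (hprod.mono hε.le le_rfl (le_of_eq ?_)).congr' fun j hj => ?_
    · simp only [W]; ring
    · have e : k₃ + (j : ℝ) • h₃ - (k₁ + (j : ℝ) • h₁) + (G : Vec3)
          = k₃ - k₁ + (G : Vec3) + (j : ℝ) • (h₃ - h₁) := by module
      have e2 : k₂ + (j : ℝ) • h₂ - (k₃ + (j : ℝ) • h₃ - (k₁ + (j : ℝ) • h₁))
          = k₂ - (k₃ - k₁) + (j : ℝ) • (h₂ - (h₃ - h₁)) := by module
      rw [eriTerm_of_ne, e, e2]
      rw [e]
      have := (norm_add_smul_bounds h8' (τ := j) (by positivity) (by exact_mod_cast hj)).1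
      exact norm_pos_iff.mp (by linarith)
  set cst : recipLattice a → ℝ := fun G => (if G = G₀ then C₀ else 0)
    + W * (diffSize ε 4 (A G) * diffSize ε 4 (B G))
  have hs0 : HasSum (fun G : recipLattice a => if G = G₀ then C₀ else 0) C₀ := hasSum_ite_eq G₀ C₀
  have hcst : Summable cst := hs0.summable.add hsumAB
  have hall : ∀ G, DiffBound ε 4 (cst G) (fun j : ℕ => eriTerm a ψ n₁ (k₁ + (j : ℝ) • h₁) n₂
      (k₂ + (j : ℝ) • h₂) n₃ (k₃ + (j : ℝ) • h₃) n₄ G) := by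
    intro G
    by_cases hne : G = G₀
    · subst hne
      refine hC₀.mono hε.le le_rfl ?_
      simp only [cst, if_true]
      linarith [mul_nonneg hW (hnn G)]
    · simp only [cst, if_neg hne, zero_add]
      exact hterm G hne
  have htot : ∑' G, cst G ≤ C₀ + W * D := by
    rw [hs0.summable.tsum_add hsumAB, hs0.tsum_eq, tsum_mul_left]
    exact add_le_add le_rfl (mul_le_mul_of_nonneg_left
      ((summable_of_sum_le hnn hAB).tsum_le_of_sum_le hAB) hW)
  refine ⟨?_, (DiffBound.tsum hcst hall).mono hε.le le_rfl htot⟩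
  refine Summable.of_norm_bounded hcst fun G => ?_
  simpa using (hall G).norm_le (Nat.zero_le 4)

theorem exists_tsum_eriTerm_le [DecidableEq ι] [Finite ι] (hψ : IsBlochOrbitals a ψ) :
    ∃ D, 0 ≤ D ∧ ∀ n₁ k₁ n₂ k₂ n₃ k₃ n₄,
      Summable (eriTerm a ψ n₁ k₁ n₂ k₂ n₃ k₃ n₄) ∧
      ∀ G₀ : recipLattice a, latticeDist (recipBasis a) (k₃ - k₁) = ‖k₃ - k₁ + (G₀ : Vec3)‖ →
      ‖∑' G, eriTerm a ψ n₁ k₁ n₂ k₂ n₃ k₃ n₄ G‖ ≤ ‖eriTerm a ψ n₁ k₁ n₂ k₂ n₃ k₃ n₄ G₀‖ + D := by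
  obtain ⟨D, hD0, hD⟩ := exists_diffBound_eri_sum hψ le_rfl
  have key : ∀ n₁ k₁ n₂ k₂ n₃ k₃ n₄ (G₀ : recipLattice a),
      latticeDist (recipBasis a) (k₃ - k₁) = ‖k₃ - k₁ + (G₀ : Vec3)‖ →
      Summable (eriTerm a ψ n₁ k₁ n₂ k₂ n₃ k₃ n₄) ∧ ‖∑' G, eriTerm a ψ n₁ k₁ n₂ k₂ n₃ k₃ n₄ G‖
        ≤ ‖eriTerm a ψ n₁ k₁ n₂ k₂ n₃ k₃ n₄ G₀‖ + D := by
    intro n₁ k₁ n₂ k₂ n₃ k₃ n₄ G₀ hG₀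
    -- Constant lines, with η = 0 and ε = 1, turn the estimate of differences into summability and a
    -- bound on the sum.
    have h := hD n₁ k₁ 0 n₂ k₂ 0 n₃ k₃ 0 n₄ 0 1 one_pos (by norm_num) (by simp) (by simp) (by simp)
      (by simp) (by simp) G₀ hG₀ (fun G _ => by simp) _ (by
        simp only [smul_zero, add_zero]
        exact DiffBound.const zero_le_one 4 _)
    refine ⟨h.1, ?_⟩
    simpa using h.2.norm_le (Nat.zero_le 4)
  refine ⟨D, hD0, fun n₁ k₁ n₂ k₂ n₃ k₃ n₄ => ⟨?_, fun G₀ h => (key n₁ k₁ n₂ k₂ n₃ k₃ n₄ G₀ h).2⟩⟩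
  obtain ⟨G, hG, h⟩ := exists_latticeDist_eq (b := recipBasis a) (k₃ - k₁)
  exact (key n₁ k₁ n₂ k₂ n₃ k₃ n₄ ⟨G, hG⟩ h).1

/-- Each of the two pair products is at most C‖q + G‖, which cancels ‖q + G‖^(-2). -/
theorem norm_eriTerm_le [DecidableEq ι] {C : ℝ} (hC0 : 0 ≤ C)
    (hC : ∀ n₁ k₁ n₂ k₂, n₁ ≠ n₂ → ∀ G ∈ recipLattice a,
      ‖pairProduct a ψ n₁ k₁ n₂ k₂ G‖ ≤ C * ‖k₂ - k₁ + G‖) {n₁ n₂ n₃ n₄ : ι} (h13 : n₁ ≠ n₃)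
    (h24 : n₂ ≠ n₄) (k₁ k₂ k₃ : Vec3) (G : recipLattice a) :
    ‖eriTerm a ψ n₁ k₁ n₂ k₂ n₃ k₃ n₄ G‖ ≤ C ^ 2 := by
  by_cases h : k₃ - k₁ + (G : Vec3) = 0
  · rw [eriTerm_of_eq h, norm_zero]; positivity
  · have hpos := norm_pos_iff.mpr h
    rw [eriTerm_of_ne h, ← pairProduct_eq, ← pairProduct_eq, norm_mul, norm_mul, Complex.norm_real,
      Real.norm_eq_abs, abs_of_nonneg (by positivity)]
    have h1 := hC n₁ k₁ n₃ k₃ h13 G G.2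
    have h2 := hC n₂ k₂ n₄ (k₂ - (k₃ - k₁)) h24 (-G) (neg_mem G.2)
    rw [show k₂ - (k₃ - k₁) - k₂ + -(G : Vec3) = -(k₃ - k₁ + (G : Vec3)) by abel, norm_neg] at h2
    calc _ ≤ 1 / ‖k₃ - k₁ + (G : Vec3)‖ ^ 2 *
          ((C * ‖k₃ - k₁ + (G : Vec3)‖) * (C * ‖k₃ - k₁ + (G : Vec3)‖)) := by gcongr
      _ = C ^ 2 := by field_simp

/-- The electron repulsion integrals between orthogonal bands are bounded, and along a line that
stays away from the singularity their finite differences obey the estimates of a symbol of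
order `0`. -/
theorem exists_diffBound_eri [DecidableEq ι] [Finite ι] (hψ : IsBlochOrbitals a ψ) :
    ∃ D, 0 ≤ D ∧ ∀ n₁ n₂ n₃ n₄, n₁ ≠ n₃ → n₂ ≠ n₄ → ∀ k₁ k₂ k₃,
      ‖eri a ψ n₁ k₁ n₂ k₂ n₃ k₃ n₄‖ ≤ D ∧
      ∀ h₁ h₂ h₃ η, 0 < η → ‖h₁‖ ≤ η → ‖h₂‖ ≤ η → ‖h₃‖ ≤ η → ‖h₃ - h₁‖ ≤ η →
        ‖h₂ - (h₃ - h₁)‖ ≤ η → 8 * η ≤ latticeDist (recipBasis a) (k₃ - k₁) →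
        DiffBound (η / latticeDist (recipBasis a) (k₃ - k₁)) 4 D (fun j : ℕ =>
          eri a ψ n₁ (k₁ + (j : ℝ) • h₁) n₂ (k₂ + (j : ℝ) • h₂) n₃ (k₃ + (j : ℝ) • h₃) n₄) := by
  obtain ⟨R₀, hR₀, hR⟩ := exists_latticeDist_le (recipBasis a)
  set R := max 1 R₀
  have hR1 : 1 ≤ R := le_max_left _ _
  obtain ⟨D₁, hD₁0, hD₁⟩ := exists_tsum_eriTerm_le hψ
  obtain ⟨D₂, hD₂0, hD₂⟩ := exists_diffBound_eri_sum hψ hR1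
  obtain ⟨C, hC0, hC⟩ := exists_norm_pairProduct_le hψ
  obtain ⟨P, hP0, hP⟩ := exists_diffBound_pairDensity hψ
  obtain ⟨K, hK0, hK⟩ := exists_diffBound_coulomb
  set V := volume.real (unitCell a)
  have hV0 : 0 ≤ V := measureReal_nonneg
  -- The first entry serves the pair product itself, where orthogonality gives C · 2ρ; the second
  -- serves its differences of positive order.
  set Q := max (2 * C) (V * P * R ^ 4)
  have hQ0 : 0 ≤ Q := le_max_of_le_left (by positivity)
  set E := max (C ^ 2 + D₁) (2 ^ 4 * K * (2 ^ 4 * Q * Q) + D₂)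
  have hE0 : 0 ≤ E := le_max_of_le_left (by positivity)
  set c : ℂ := ((4 * Real.pi / V : ℝ) : ℂ)
  refine ⟨‖c‖ * E, by positivity, fun n₁ n₂ n₃ n₄ h13 h24 k₁ k₂ k₃ => ?_⟩
  obtain ⟨G, hG, hGd⟩ := exists_latticeDist_eq (b := recipBasis a) (k₃ - k₁)
  set G₀ : recipLattice a := ⟨G, hG⟩ with hG₀
  constructor
  · rw [eri, norm_mul]
    refine mul_le_mul_of_nonneg_left (le_trans ?_ (le_max_left _ _)) (norm_nonneg _)
    exact ((hD₁ n₁ k₁ n₂ k₂ n₃ k₃ n₄).2 G₀ hGd).trans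
      (add_le_add (norm_eriTerm_le hC0 hC h13 h24 k₁ k₂ k₃ G₀) le_rfl)
  · intro h₁ h₂ h₃ η hη hh₁ hh₂ hh₃ hq hp h8
    set ρ := latticeDist (recipBasis a) (k₃ - k₁) with hρ
    have hρ0 : 0 < ρ := by linarith
    set ε := η / ρ
    have hε : 0 < ε := by positivity
    have hηε : η = ρ * ε := by simp only [ε]; field_simp
    have hρR : ρ ≤ R := (hR _).trans (le_max_right _ _)
    have hηR : η ≤ R * ε := by rw [hηε]; exact mul_le_mul_of_nonneg_right hρR hε.le
    -- pair products at the singular lattice vector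
    have hpair : ∀ n n' k k' h h' (G' : Vec3), n ≠ n' → G' ∈ recipLattice a → ‖h‖ ≤ η → ‖h'‖ ≤ η →
        ‖h' - h‖ ≤ η → ‖k' - k + G'‖ = ρ →
        DiffBound ε 4 (Q * ρ) (fun j : ℕ => cellFourier a
          (pairDensity ψ n (k + (j : ℝ) • h) n' (k' + (j : ℝ) • h')) G') := by
      intro n n' k k' h h' G' hn hG' hh hh' hhh hk
      have hb := DiffBound.cellFourier a (ε := η) (fun j : ℕ => continuous_pairDensity hψ n
        (k + (j : ℝ) • h) n' (k' + (j : ℝ) • h')) (hP n k h n' k' h' η hh hh') G'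
      intro i j hij
      cases i with
      | zero =>
        simp only [Function.iterate_zero, id, pow_zero, mul_one]
        rw [← pairProduct_eq]
        refine (hC _ _ _ _ hn G' hG').trans ?_
        have e : k' + (j : ℝ) • h' - (k + (j : ℝ) • h) + G' = (k' - k + G') + (j : ℝ) • (h' - h) := by
          module
        have := (norm_add_smul_bounds (v := k' - k + G') (h := h' - h) (by rw [hk]; linarith)
          (τ := j) (by positivity) (by exact_mod_cast (by omega : j ≤ 4))).2
        rw [e]
        rw [hk] at this
        calc _ ≤ C * (2 * ρ) := mul_le_mul_of_nonneg_left this hC0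
          _ = 2 * C * ρ := by ring
          _ ≤ _ := mul_le_mul_of_nonneg_right (le_max_left _ _) hρ0.le
      | succ i =>
        refine (hb (i + 1) j hij).trans ?_
        -- With η = ρε, a difference of positive order contains the factor ρ by itself, so no
        -- further cancellation is needed.
        have h1 : η ^ (i + 1) ≤ R ^ 4 * ρ * ε ^ (i + 1) := by
          rw [hηε, mul_pow]
          refine mul_le_mul_of_nonneg_right ?_ (by positivity)
          rw [pow_succ]
          refine mul_le_mul_of_nonneg_right ?_ hρ0.le
          exact (pow_le_pow_left₀ hρ0.le hρR i).trans (pow_le_pow_right₀ hR1 (by omega))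
        calc V * P * η ^ (i + 1) ≤ V * P * (R ^ 4 * ρ * ε ^ (i + 1)) :=
              mul_le_mul_of_nonneg_left h1 (by positivity)
          _ = V * P * R ^ 4 * ρ * ε ^ (i + 1) := by ring
          _ ≤ Q * ρ * ε ^ (i + 1) := by gcongr; exact le_max_right _ _
    have hv : k₃ - k₁ + G ≠ 0 := norm_pos_iff.mp (by rw [← hGd]; exact hρ0)
    have h8' : 8 * ‖h₃ - h₁‖ ≤ ‖k₃ - k₁ + G‖ := by rw [← hGd]; linarith
    have hA := hpair n₁ n₃ k₁ k₃ h₁ h₃ G h13 hG hh₁ hh₃ hq hGd.symm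
    have hB := hpair n₂ n₄ k₂ (k₂ - (k₃ - k₁)) h₂ (h₂ - (h₃ - h₁)) (-G) h24 (neg_mem hG) hh₂ hp
      (by rw [sub_sub_cancel_left, norm_neg]; exact hq)
      (by rw [hGd, ← norm_neg (k₃ - k₁ + G)]; congr 1; abel)
    have hw := hK (k₃ - k₁ + G) (h₃ - h₁) ε hε.le hv h8' (by rw [← hGd, mul_comm, ← hηε]; exact hq)
    have hterm : DiffBound ε 4 (2 ^ 4 * K * (2 ^ 4 * Q * Q)) (fun j : ℕ => eriTerm a ψ n₁
        (k₁ + (j : ℝ) • h₁) n₂ (k₂ + (j : ℝ) • h₂) n₃ (k₃ + (j : ℝ) • h₃) n₄ G₀) := by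
      -- The factors ρ of the two pair products cancel the ρ^(-2) of the Coulomb kernel.
      refine ((hw.mul (hA.mul hB)).mono hε.le le_rfl (le_of_eq ?_)).congr' fun j hj => ?_
      · rw [← hGd]; field_simp
      · have e : k₃ + (j : ℝ) • h₃ - (k₁ + (j : ℝ) • h₁) + G
            = k₃ - k₁ + G + (j : ℝ) • (h₃ - h₁) := by module
        have e2 : k₂ + (j : ℝ) • h₂ - (k₃ + (j : ℝ) • h₃ - (k₁ + (j : ℝ) • h₁))
            = k₂ - (k₃ - k₁) + (j : ℝ) • (h₂ - (h₃ - h₁)) := by module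
        rw [eriTerm_of_ne, e, e2]
        simp only [hG₀]
        rw [e]
        have := (norm_add_smul_bounds h8' (τ := j) (by positivity) (by exact_mod_cast hj)).1
        have := norm_pos_iff.mpr hv
        exact norm_pos_iff.mp (by linarith)
    have hmin : ∀ G' : recipLattice a, ρ ≤ ‖k₃ - k₁ + (G' : Vec3)‖ := fun G' => latticeDist_le _ G'.2
    have hsum := (hD₂ n₁ k₁ h₁ n₂ k₂ h₂ n₃ k₃ h₃ n₄ η ε hε hηR hh₁ hh₂ hh₃ hq hp G₀ hGd
      (fun G' _ => ⟨h8.trans (hmin G'), by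
        rw [hηε, mul_comm]; exact mul_le_mul_of_nonneg_left (hmin G') hε.le⟩) _ hterm).2
    exact ((hsum.mono hε.le le_rfl (le_max_right (C ^ 2 + D₁) _)).const_smul c)

end ERI

/-! ### Periodicity and measurability of the electron repulsion integrals -/

section ERIPeriodic

variable {a : Module.Basis (Fin 3) ℝ Vec3} {ι : Type} {ψ : ι → Vec3 → Vec3 → ℂ}

theorem pairProduct_add [DecidableEq ι] (hψ : IsBlochOrbitals a ψ) (n₁ : ι) (k₁ : Vec3) (n₂ : ι)
    (k₂ : Vec3) {G₁ G₂ : Vec3} (h₁ : G₁ ∈ recipLattice a) (h₂ : G₂ ∈ recipLattice a) (G : Vec3) :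
    pairProduct a ψ n₁ (k₁ + G₁) n₂ (k₂ + G₂) G
      = pairProduct a ψ n₁ k₁ n₂ k₂ (G - G₁ + G₂) := by
  simp only [pairProduct, hψ.periodic _ _ _ _ h₁, hψ.periodic _ _ _ _ h₂]
  rw [show k₁ + G₁ - (k₂ + G₂) - G = k₁ - k₂ - (G - G₁ + G₂) by abel]

/-- Reciprocal shifts of the momenta relabel the summation index by G₃ − G₁, so the full lattice sum
is invariant. -/
theorem eriTerm_add [DecidableEq ι] (hψ : IsBlochOrbitals a ψ) (n₁ : ι) (k₁ : Vec3) (n₂ : ι)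
    (k₂ : Vec3) (n₃ : ι) (k₃ : Vec3) (n₄ : ι) (G₁ G₂ G₃ G : recipLattice a) :
    eriTerm a ψ n₁ (k₁ + G₁) n₂ (k₂ + G₂) n₃ (k₃ + G₃) n₄ G
      = eriTerm a ψ n₁ k₁ n₂ k₂ n₃ k₃ n₄ (G + (G₃ - G₁)) := by
  have e : k₃ + (G₃ : Vec3) - (k₁ + G₁) + (G : Vec3)
      = k₃ - k₁ + ((G + (G₃ - G₁) : recipLattice a) : Vec3) := by push_cast; abel
  by_cases h : k₃ - k₁ + ((G + (G₃ - G₁) : recipLattice a) : Vec3) = 0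
  · rw [eriTerm_of_eq h, eriTerm_of_eq (e.trans h)]
  · rw [eriTerm_of_ne h, eriTerm_of_ne (by rw [e]; exact h), e]
    simp only [← pairProduct_eq]
    rw [pairProduct_add hψ _ _ _ _ G₁.2 G₃.2,
      show k₂ + (G₂ : Vec3) - (k₃ + (G₃ : Vec3) - (k₁ + (G₁ : Vec3)))
        = k₂ - (k₃ - k₁) + ((G₂ - G₃ + G₁ : recipLattice a) : Vec3) by push_cast; abel,
      pairProduct_add hψ _ _ _ _ G₂.2 (G₂ - G₃ + G₁).2]
    push_cast
    rw [show (G : Vec3) - G₁ + G₃ = G + (G₃ - G₁) by abel,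
      show -(G : Vec3) - G₂ + (G₂ - G₃ + G₁) = -(G + (G₃ - G₁)) by abel]

theorem eri_add [DecidableEq ι] (hψ : IsBlochOrbitals a ψ) (n₁ : ι) (k₁ : Vec3) (n₂ : ι)
    (k₂ : Vec3) (n₃ : ι) (k₃ : Vec3) (n₄ : ι) {G₁ G₂ G₃ : Vec3} (h₁ : G₁ ∈ recipLattice a)
    (h₂ : G₂ ∈ recipLattice a) (h₃ : G₃ ∈ recipLattice a) :
    eri a ψ n₁ (k₁ + G₁) n₂ (k₂ + G₂) n₃ (k₃ + G₃) n₄ = eri a ψ n₁ k₁ n₂ k₂ n₃ k₃ n₄ := by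
  rw [eri, eri]
  congr 1
  rw [← (Equiv.addRight ((⟨G₃, h₃⟩ : recipLattice a) - ⟨G₁, h₁⟩)).tsum_eq
    (eriTerm a ψ n₁ k₁ n₂ k₂ n₃ k₃ n₄)]
  exact tsum_congr fun G => eriTerm_add hψ n₁ k₁ n₂ k₂ n₃ k₃ n₄ ⟨G₁, h₁⟩ ⟨G₂, h₂⟩ ⟨G₃, h₃⟩ G

theorem measurable_pairProduct [DecidableEq ι] (hψ : IsBlochOrbitals a ψ) (n₁ n₂ : ι) (G : Vec3) :
    Measurable fun p : Vec3 × Vec3 => pairProduct a ψ n₁ p.1 n₂ p.2 G := by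
  have h : Continuous fun p : (Vec3 × Vec3) × Vec3 => conj (ψ n₁ p.1.1 p.2) *
      Complex.exp (Complex.I * ((inner ℝ (p.1.1 - p.1.2 - G) p.2 : ℝ) : ℂ)) * ψ n₂ p.1.2 p.2 := by
    have h1 : Continuous fun p : (Vec3 × Vec3) × Vec3 => ψ n₁ p.1.1 p.2 :=
      (hψ.continuous n₁).comp (by fun_prop : Continuous fun p : (Vec3 × Vec3) × Vec3 => (p.1.1, p.2))
    have h2 : Continuous fun p : (Vec3 × Vec3) × Vec3 => ψ n₂ p.1.2 p.2 :=
      (hψ.continuous n₂).comp (by fun_prop : Continuous fun p : (Vec3 × Vec3) × Vec3 => (p.1.2, p.2))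
    refine ((Complex.continuous_conj.comp h1).mul ?_).mul h2
    fun_prop
  exact (h.stronglyMeasurable.integral_prod_right (ν := volume.restrict (unitCell a))).measurable

open scoped Classical in
theorem measurable_coulomb_mul {P Q : Vec3 × Vec3 → ℂ} (hP : Measurable P) (hQ : Measurable Q)
    (G : Vec3) : Measurable fun k : Vec3 × Vec3 × Vec3 => if k.2.2 - k.1 + G = 0 then 0 else
      ((1 / ‖k.2.2 - k.1 + G‖ ^ 2 : ℝ) : ℂ) * P (k.1, k.1 + (k.2.2 - k.1)) *
        Q (k.2.1, k.2.1 - (k.2.2 - k.1)) := by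
  have hq : Measurable fun k : Vec3 × Vec3 × Vec3 => k.2.2 - k.1 + G := by fun_prop
  have hA : Measurable fun k : Vec3 × Vec3 × Vec3 => P (k.1, k.1 + (k.2.2 - k.1)) :=
    hP.comp (by fun_prop)
  have hB : Measurable fun k : Vec3 × Vec3 × Vec3 => Q (k.2.1, k.2.1 - (k.2.2 - k.1)) :=
    hQ.comp (by fun_prop)
  have hw : Measurable fun k : Vec3 × Vec3 × Vec3 => ((1 / ‖k.2.2 - k.1 + G‖ ^ 2 : ℝ) : ℂ) :=
    Complex.measurable_ofReal.comp ((hq.norm.pow_const 2).const_div 1)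
  exact Measurable.ite (hq (measurableSet_singleton 0)) measurable_const ((hw.mul hA).mul hB)

theorem measurable_eriTerm [DecidableEq ι] (hψ : IsBlochOrbitals a ψ) (n₁ n₂ n₃ n₄ : ι)
    (G : recipLattice a) : Measurable fun k : Vec3 × Vec3 × Vec3 =>
      eriTerm a ψ n₁ k.1 n₂ k.2.1 n₃ k.2.2 n₄ G :=
  measurable_coulomb_mul (measurable_pairProduct hψ n₁ n₃ G) (measurable_pairProduct hψ n₂ n₄ (-G)) G

theorem measurable_eri [DecidableEq ι] (hψ : IsBlochOrbitals a ψ) (n₁ n₂ n₃ n₄ : ι) :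
    Measurable fun k : Vec3 × Vec3 × Vec3 => eri a ψ n₁ k.1 n₂ k.2.1 n₃ k.2.2 n₄ := by
  have : Countable (recipLattice a) := inferInstanceAs (Countable (lattice (recipBasis a)))
  exact (Measurable.tsum fun G => measurable_eriTerm hψ n₁ n₂ n₃ n₄ G).const_mul _

end ERIPeriodic

/-! ### Partial derivatives and mixed differences -/

section Partial

variable {X Y F : Type*} [NormedAddCommGroup X] [NormedSpace ℝ X] [NormedAddCommGroup Y]
  [NormedSpace ℝ Y] [NormedAddCommGroup F] [NormedSpace ℝ F]

theorem ContDiffAt.partial_iteratedFDeriv {g : X → Y → F} {x : X} {y : Y}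
    (hg : ContDiffAt ℝ ∞ (fun p : X × Y => g p.1 p.2) (x, y)) (β : ℕ) :
    ContDiffAt ℝ ∞ (fun z => iteratedFDeriv ℝ β (g z) y) x := by
  -- The induction on β needs smoothness jointly in (x, y), because the next step differentiates in
  -- y again.
  have key : ContDiffAt ℝ ∞ (fun p : X × Y => iteratedFDeriv ℝ β (g p.1) p.2) (x, y) := by
    induction β with
    | zero =>
      exact hg.continuousLinearMap_comp
        ((continuousMultilinearCurryFin0 ℝ Y F).symm : _ →L[ℝ] Y [×0]→L[ℝ] F)
    | succ β ih =>
      have h1 : ContDiffAt ℝ ∞ (fun p : X × Y =>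
          fderiv ℝ ((fun (p : X × Y) (y : Y) => iteratedFDeriv ℝ β (g p.1) y) p) p.2) (x, y) := by
        refine ContDiffAt.fderiv (n := ∞) ?_ contDiffAt_snd (by simp)
        exact ContDiffAt.comp ((x, y), y) (f := fun q : (X × Y) × Y => (q.1.1, q.2)) ih
          (by fun_prop)
      exact h1.continuousLinearMap_comp
        ((continuousMultilinearCurryLeftEquiv ℝ (fun _ : Fin (β + 1) => Y) F).symm :
          _ →L[ℝ] Y [×(β + 1)]→L[ℝ] F)
  exact ContDiffAt.comp x key (f := fun z => (z, y)) (by fun_prop)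

omit [NormedSpace ℝ X] in
theorem contDiff_fwdDiff_iter {g : X → Y → F} (hg : ∀ z, ContDiff ℝ ∞ (g z)) (h x : X) (i : ℕ) :
    ContDiff ℝ ∞ (fun y => (fwdDiff h)^[i] (fun z => g z y) x) := by
  induction i generalizing g with
  | zero => exact hg x
  | succ i ih => exact ih (g := fun z y => g (z + h) y - g z y) fun z => (hg (z + h)).sub (hg z)

omit [NormedSpace ℝ X] in
theorem iteratedFDeriv_fwdDiff_iter {g : X → Y → F} (hg : ∀ z, ContDiff ℝ ∞ (g z)) (h x : X)
    (y : Y) (i β : ℕ) :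
    iteratedFDeriv ℝ β (fun y => (fwdDiff h)^[i] (fun z => g z y) x) y
      = (fwdDiff h)^[i] (fun z => iteratedFDeriv ℝ β (g z) y) x := by
  induction i generalizing g with
  | zero => rfl
  | succ i ih =>
    have h1 := ih (g := fun z y => g (z + h) y - g z y) fun z => (hg (z + h)).sub (hg z)
    refine h1.trans ?_
    rw [Function.iterate_succ_apply]
    refine congrArg (fun φ => (fwdDiff h)^[i] φ x) ?_
    funext z
    have hc : ∀ z, ContDiffAt ℝ β (g z) y := fun z => (contDiff_infty.mp (hg z) β).contDiffAt
    exact iteratedFDeriv_sub_apply (hc (z + h)) (hc z)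

/-- Mixed differences are controlled by mixed derivatives. -/
theorem norm_fwdDiff_mixed_le {g : X → Y → F} (hg : ∀ z, ContDiff ℝ ∞ (g z)) {x h : X} {y k : Y}
    {M : ℝ} {i j a : ℕ} (b : ℕ)
    (hcd : ∀ τ ∈ Set.Icc (0 : ℝ) (i + a : ℕ), ∀ y,
      ContDiffAt ℝ ∞ (fun p : X × Y => g p.1 p.2) (x + τ • h, y))
    (hM : ∀ τ ∈ Set.Icc (0 : ℝ) (i + a : ℕ), ∀ y,
      ‖iteratedFDeriv ℝ i (fun z => iteratedFDeriv ℝ j (g z) y) (x + τ • h)‖ ≤ M) :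
    ‖(fwdDiff 1)^[j] (fun t : ℕ => (fwdDiff 1)^[i]
      (fun s : ℕ => g (x + (s : ℝ) • h) (y + (t : ℝ) • k)) a) b‖ ≤ M * ‖h‖ ^ i * ‖k‖ ^ j := by
  simp only [fun t : ℕ => fwdDiff_iter_comp_line (fun z => g z (y + (t : ℝ) • k)) x h i a]
  rw [fwdDiff_iter_comp_line (fun y => (fwdDiff h)^[i] (fun z => g z y) (x + (a : ℝ) • h))]
  have hτ : ∀ τ ∈ Set.Icc (0 : ℝ) i, (a + τ : ℝ) ∈ Set.Icc (0 : ℝ) (i + a : ℕ) := fun τ hτ =>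
    ⟨by have := hτ.1; positivity, by push_cast; linarith [hτ.2]⟩
  have e : ∀ τ : ℝ, x + (a : ℝ) • h + τ • h = x + (a + τ : ℝ) • h := fun τ => by
    rw [add_smul, add_assoc]
  -- Differences in y are bounded by y-derivatives of a difference in x. The two operations commute,
  -- and the x-difference of the y-derivative is bounded by the mixed derivative.
  refine norm_fwdDiff_iter_le j (fun τ _ => ?_) fun τ _ => ?_
  · exact (contDiff_infty.mp (contDiff_fwdDiff_iter hg _ _ _) j).contDiffAt
  · rw [iteratedFDeriv_fwdDiff_iter hg]
    refine norm_fwdDiff_iter_le i (fun σ hσ => ?_) fun σ hσ => ?_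
    · rw [e]
      exact ((hcd _ (hτ σ hσ) _).partial_iteratedFDeriv j).of_le (by exact_mod_cast le_top)
    · rw [e]
      exact hM _ (hτ σ hσ) _

end Partial

/-! ### Exact amplitudes -/

section Amplitude

variable {a : Module.Basis (Fin 3) ℝ Vec3} {f : Vec3 → Vec3 → Vec3 → ℂ}

namespace PeriodicCC.MemAmplitudeSpace

theorem isPeriodic₃ (hf : MemAmplitudeSpace a f) :
    IsPeriodic₃ a (fun k => f k.1 k.2.1 k.2.2) := by
  rintro ⟨k₁, k₂, k₃⟩ G₁ h₁ G₂ h₂ G₃ h₃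
  simp only [Prod.mk_add_mk]
  rw [(hf.periodic _ _ _ G₁ h₁).1, (hf.periodic _ _ _ G₂ h₂).2.1, (hf.periodic _ _ _ G₃ h₃).2.2]

theorem eq_diag (hf : MemAmplitudeSpace a f) {ki kj ka : Vec3} (h : ka - ki ∈ recipLattice a) :
    f ki kj ka = f ki kj ki := by
  rw [← (hf.periodic ki kj ki _ h).2.2, add_sub_cancel]

/-- On the closed set k_a − k_i ∈ 𝕃*, periodicity replaces f by its smooth diagonal restriction; off
this set f is continuous. -/
theorem measurable (hf : MemAmplitudeSpace a f) :
    Measurable (fun k : Vec3 × Vec3 × Vec3 => f k.1 k.2.1 k.2.2) := by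
  classical
  let S : Set (Vec3 × Vec3 × Vec3) := {k | k.2.2 - k.1 ∈ recipLattice a}
  have hS : IsClosed S := (isClosed_lattice (recipBasis a)).preimage
    (by fun_prop : Continuous fun k : Vec3 × Vec3 × Vec3 => k.2.2 - k.1)
  have h1 : ContinuousOn (fun k : Vec3 × Vec3 × Vec3 => f k.1 k.2.1 k.1) S :=
    (hf.smooth_diag.continuous.comp
      (by fun_prop : Continuous fun k : Vec3 × Vec3 × Vec3 => (k.1, k.2.1))).continuousOn
  have h2 : ContinuousOn (fun k : Vec3 × Vec3 × Vec3 => f k.1 k.2.1 k.2.2) Sᶜ := fun k hk =>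
    (hf.smooth k.1 k.2.1 k.2.2 hk).continuousAt.continuousWithinAt
  have h3 := ContinuousOn.measurable_piecewise h1 h2 hS.measurableSet
  convert h3 using 1
  funext k
  by_cases hk : k ∈ S
  · rw [Set.piecewise_eq_of_mem _ _ _ hk]
    exact hf.eq_diag hk
  · rw [Set.piecewise_eq_of_notMem _ _ _ hk]

theorem exists_diag_bound (hf : MemAmplitudeSpace a f) : ∃ M, ∀ ki kj, ‖f ki kj ki‖ ≤ M := by
  have hK := (isBounded_unitCell (recipBasis a)).isCompact_closure
  obtain ⟨M, hM⟩ := (hK.prod hK).exists_bound_of_continuousOn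
    hf.smooth_diag.continuous.continuousOn
  refine ⟨M, fun ki kj => ?_⟩
  obtain ⟨G₁, h₁, m₁⟩ := exists_mem_lattice_add_mem_unitCell (recipBasis a) ki
  obtain ⟨G₂, h₂, m₂⟩ := exists_mem_lattice_add_mem_unitCell (recipBasis a) kj
  have h := hf.isPeriodic₃ (ki, kj, ki) G₁ h₁ G₂ h₂ G₁ h₁
  simp only [Prod.mk_add_mk] at h
  rw [← h]
  exact hM (ki + G₁, kj + G₂) ⟨subset_closure m₁, subset_closure m₂⟩

/-- Derivatives are bounded away from the singularity. -/
theorem exists_deriv_bound_far (hf : MemAmplitudeSpace a f) {d : ℝ} (hd : 0 < d) (N : ℕ) :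
    ∃ M, 0 ≤ M ∧ ∀ i ≤ N, ∀ k : Vec3 × Vec3 × Vec3, d ≤ latticeDist (recipBasis a) (k.2.2 - k.1) →
      ‖iteratedFDeriv ℝ i (fun k : Vec3 × Vec3 × Vec3 => f k.1 k.2.1 k.2.2) k‖ ≤ M := by
  set F : Vec3 × Vec3 × Vec3 → ℂ := fun k => f k.1 k.2.1 k.2.2
  have hK := (isBounded_unitCell (recipBasis a)).isCompact_closure
  have hcont : Continuous fun k : Vec3 × Vec3 × Vec3 => latticeDist (recipBasis a) (k.2.2 - k.1) :=
    continuous_latticeDist.comp (by fun_prop)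
  have hS := (hK.prod (hK.prod hK)).inter_right (isClosed_le continuous_const hcont : IsClosed
    {k : Vec3 × Vec3 × Vec3 | d ≤ latticeDist (recipBasis a) (k.2.2 - k.1)})
  have h1 : ∀ i : ℕ, ∃ M, ∀ k : Vec3 × Vec3 × Vec3,
      d ≤ latticeDist (recipBasis a) (k.2.2 - k.1) → ‖iteratedFDeriv ℝ i F k‖ ≤ M := by
    intro i
    obtain ⟨M, hM⟩ := hS.exists_bound_of_continuousOn (f := iteratedFDeriv ℝ i F) fun k hk => by
      refine (ContDiffAt.continuousAt_iteratedFDeriv (n := ∞) (hf.smooth k.1 k.2.1 k.2.2 fun hmem => ?_)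
        (by exact_mod_cast le_top)).continuousWithinAt
      have h0 := latticeDist_eq_zero.mpr hmem
      have h2 : d ≤ latticeDist (recipBasis a) (k.2.2 - k.1) := hk.2
      linarith
    refine ⟨M, fun k hk => ?_⟩
    obtain ⟨G₁, h₁, m₁⟩ := exists_mem_lattice_add_mem_unitCell (recipBasis a) k.1
    obtain ⟨G₂, h₂, m₂⟩ := exists_mem_lattice_add_mem_unitCell (recipBasis a) k.2.1
    obtain ⟨G₃, h₃, m₃⟩ := exists_mem_lattice_add_mem_unitCell (recipBasis a) k.2.2
    have h3 := iteratedFDeriv_comp_add_right (𝕜 := ℝ) (f := F) i (G₁, G₂, G₃) k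
    have h4 : (fun z => F (z + (G₁, G₂, G₃))) = F :=
      funext fun z => hf.isPeriodic₃ z G₁ h₁ G₂ h₂ G₃ h₃
    rw [h4] at h3
    rw [h3]
    refine hM _ ⟨⟨subset_closure m₁, subset_closure m₂, subset_closure m₃⟩, ?_⟩
    show d ≤ latticeDist (recipBasis a) (k.2.2 + G₃ - (k.1 + G₁))
    refine hk.trans ?_
    obtain ⟨G, hG, hGd⟩ := exists_latticeDist_eq (b := recipBasis a) (k.2.2 + G₃ - (k.1 + G₁))
    rw [hGd]
    refine (latticeDist_le (b := recipBasis a) (k.2.2 - k.1)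
      (add_mem (sub_mem h₃ h₁) hG)).trans (le_of_eq ?_)
    congr 1
    abel
  choose M hM using h1
  refine ⟨∑ i ∈ Finset.range (N + 1), |M i|, Finset.sum_nonneg fun _ _ => abs_nonneg _,
    fun i hi k hk => (hM i k hk).trans ((le_abs_self _).trans ?_)⟩
  exact Finset.single_le_sum (f := fun i => |M i|) (fun _ _ => abs_nonneg _)
    (Finset.mem_range.mpr (by omega))

/-- The singular estimate for all momenta, with integer powers and a uniform constant. -/
theorem exists_deriv_bound_near (hf : MemAmplitudeSpace a f) (N : ℕ) :
    ∃ δ > 0, (∀ x, 0 < ‖x‖ → ‖x‖ < δ → x ∉ recipLattice a) ∧ ∃ C, 0 ≤ C ∧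
      ∀ α ≤ N, ∀ β ≤ N, ∀ x : Vec3, 0 < ‖x‖ → ‖x‖ < δ → ∀ y : Vec3 × Vec3,
        ‖iteratedFDeriv ℝ α (fun z => iteratedFDeriv ℝ β
          (fun y : Vec3 × Vec3 => f y.1 y.2 (y.1 + z)) y) x‖ ≤ C * (‖x‖ ^ α)⁻¹ := by
  obtain ⟨-, δ, hδ, -, hC⟩ := hf.singular
  obtain ⟨c, hc0, hc⟩ := exists_pos_le_norm (recipBasis a)
  choose C hC using hC
  -- Below c, the length of the shortest nonzero reciprocal vector is not reached, so the punctured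
  -- ball contains no lattice point. Summing the constants over all orders makes them uniform.
  refine ⟨min δ c, lt_min hδ hc0, fun x h0 hx hmem => ?_, ∑ α ∈ Finset.range (N + 1),
    ∑ β ∈ Finset.range (N + 1), |C α β|, by positivity, fun α hα β hβ x h0 hx y => ?_⟩
  · exact absurd (hc x hmem (norm_pos_iff.mp h0)) (not_le.mpr (hx.trans_le (min_le_right _ _)))
  · obtain ⟨G₁, h₁, m₁⟩ := exists_mem_lattice_add_mem_unitCell (recipBasis a) y.1
    obtain ⟨G₂, h₂, m₂⟩ := exists_mem_lattice_add_mem_unitCell (recipBasis a) y.2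
    -- The hypothesis covers only y in the cells. At fixed q, a shift of k_i also shifts k_a, and
    -- periodicity extends the estimate to all y.
    have hper : ∀ z, iteratedFDeriv ℝ β (fun y : Vec3 × Vec3 => f y.1 y.2 (y.1 + z)) y
        = iteratedFDeriv ℝ β (fun y : Vec3 × Vec3 => f y.1 y.2 (y.1 + z)) (y + (G₁, G₂)) := by
      intro z
      rw [← iteratedFDeriv_comp_add_right]
      congr 1
      funext w
      have h := hf.isPeriodic₃ (w.1, w.2, w.1 + z) G₁ h₁ G₂ h₂ G₁ h₁
      simp only [Prod.mk_add_mk] at h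
      simp only [Prod.fst_add, Prod.snd_add]
      rw [← h, add_right_comm]
    simp only [hper]
    have h := hC α β x (by simpa using h0) (by simpa using hx.trans_le (min_le_left _ _))
      (y + (G₁, G₂)) ⟨m₁, m₂⟩
    refine h.trans ?_
    rw [sub_zero, zero_sub, Real.rpow_neg (norm_nonneg _), Real.rpow_natCast]
    refine mul_le_mul_of_nonneg_right ?_ (by positivity)
    calc C α β ≤ |C α β| := le_abs_self _
      _ ≤ ∑ β ∈ Finset.range (N + 1), |C α β| :=
        Finset.single_le_sum (f := fun β => |C α β|) (fun _ _ => abs_nonneg _)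
          (Finset.mem_range.mpr (by omega))
      _ ≤ _ := Finset.single_le_sum (f := fun α => ∑ β ∈ Finset.range (N + 1), |C α β|)
          (fun _ _ => Finset.sum_nonneg fun _ _ => abs_nonneg _) (Finset.mem_range.mpr (by omega))

theorem contDiff_fiber (hf : MemAmplitudeSpace a f) (z : Vec3) :
    ContDiff ℝ ∞ (fun y : Vec3 × Vec3 => f y.1 y.2 (y.1 + z)) := by
  rw [contDiff_iff_contDiffAt]
  intro y
  obtain ⟨G₁, h₁, m₁⟩ := exists_mem_lattice_add_mem_unitCell (recipBasis a) y.1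
  obtain ⟨G₂, h₂, m₂⟩ := exists_mem_lattice_add_mem_unitCell (recipBasis a) y.2
  have h := hf.singular.1 z (y + (G₁, G₂)) ⟨m₁, m₂⟩
  have h2 := ContDiffAt.comp y (f := fun w : Vec3 × Vec3 => w + (G₁, G₂)) h (by fun_prop)
  refine h2.congr_of_eventuallyEq (.of_forall fun w => ?_)
  have h := hf.isPeriodic₃ (w.1, w.2, w.1 + z) G₁ h₁ G₂ h₂ G₁ h₁
  simp only [Prod.mk_add_mk] at h
  simp only [Function.comp, Prod.fst_add, Prod.snd_add]
  rw [← h, add_right_comm]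

/-- Along a line that stays away from the singularity, the finite differences of an amplitude obey
the estimates of a symbol of order `0`. -/
theorem exists_diffBound (hf : MemAmplitudeSpace a f) :
    ∃ D, 0 ≤ D ∧ ∀ ki kj ka hi hj ha η, 0 < η → ‖hi‖ ≤ η → ‖hj‖ ≤ η → ‖ha‖ ≤ η → ‖ha - hi‖ ≤ η →
      8 * η ≤ latticeDist (recipBasis a) (ka - ki) →
      DiffBound (η / latticeDist (recipBasis a) (ka - ki)) 4 D
        (fun j : ℕ => f (ki + (j : ℝ) • hi) (kj + (j : ℝ) • hj) (ka + (j : ℝ) • ha)) := by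
  obtain ⟨R₀, hR₀, hR⟩ := exists_latticeDist_le (recipBasis a)
  set R := max 1 R₀
  have hR1 : 1 ≤ R := le_max_left _ _
  obtain ⟨δ, hδ, hδL, C, hC0, hC⟩ := hf.exists_deriv_bound_near 4
  obtain ⟨M, hM0, hM⟩ := hf.exists_deriv_bound_far (d := δ / 4) (by positivity) 4
  set D := max (M * R ^ 4) (2 ^ 4 * (C * 2 ^ 4 * R ^ 4))
  refine ⟨D, le_max_of_le_left (by positivity), fun ki kj ka hi hj ha η hη hhi hhj hha hq h8 => ?_⟩
  set ρ := latticeDist (recipBasis a) (ka - ki) with hρ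
  have hρ0 : 0 < ρ := by linarith
  set ε := η / ρ
  have hε : 0 < ε := by positivity
  have hηε : η = ρ * ε := by simp only [ε]; field_simp
  have hρR : ρ ≤ R := (hR _).trans (le_max_right _ _)
  -- Far from the singularity, ordinary derivative bounds suffice since η ≤ Rε. Close to it, the
  -- whole line stays in the ball where the singular estimate holds, as lengths at most double.
  rcases le_or_gt (δ / 2) ρ with hfar | hnear
  · have hdist : ∀ τ ∈ Set.Icc (0 : ℝ) (4 : ℕ), δ / 4 ≤
        latticeDist (recipBasis a) ((ka + τ • ha) - (ki + τ • hi)) := by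
      intro τ hτ
      have h1 := latticeDist_le_add (b := recipBasis a) (ka - ki) (τ • (ha - hi))
      have h2 : ‖τ • (ha - hi)‖ ≤ ρ / 2 := by
        rw [norm_smul, Real.norm_eq_abs, abs_of_nonneg hτ.1]
        have := hτ.2
        push_cast at this
        nlinarith [norm_nonneg (ha - hi)]
      rw [show ka + τ • ha - (ki + τ • hi) = ka - ki + τ • (ha - hi) by module]
      linarith
    have hstep : ‖((hi, hj, ha) : Vec3 × Vec3 × Vec3)‖ ≤ R * ε := by
      refine le_trans ?_ (hηε.le.trans (mul_le_mul_of_nonneg_right hρR hε.le))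
      simp only [Prod.norm_def, max_le_iff]
      exact ⟨hhi, hhj, hha⟩
    have h := DiffBound.of_contDiffAt (n := 4) (f := fun k : Vec3 × Vec3 × Vec3 => f k.1 k.2.1 k.2.2)
      (x := (ki, kj, ka)) (h := (hi, hj, ha)) (M := M) (fun τ hτ => by
        refine contDiffAt_infty.mp (hf.smooth _ _ _ fun hmem => ?_) 4
        have h0 : latticeDist (recipBasis a) ((ka + τ • ha) - (ki + τ • hi)) = 0 :=
          latticeDist_eq_zero.mpr hmem
        have h1 := hdist τ hτ
        linarith) hstep fun i hi' τ hτ => hM i hi' _ (hdist τ hτ)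
    exact (h.of_scaled hε.le hR1).mono hε.le le_rfl (le_max_left _ _)
  · obtain ⟨G, hG, hGd⟩ := exists_latticeDist_eq (b := recipBasis a) (ka - ki)
    set q := ka - ki + G with hqdef
    have hqn : ‖q‖ = ρ := hGd.symm
    have h8' : 8 * ‖ha - hi‖ ≤ ‖q‖ := by rw [hqn]; linarith
    have hrange : ∀ τ ∈ Set.Icc (0 : ℝ) (4 : ℕ), ρ / 2 ≤ ‖q + τ • (ha - hi)‖ ∧
        ‖q + τ • (ha - hi)‖ < δ := by
      intro τ hτ
      have := norm_add_smul_bounds h8' hτ.1 (by simpa using hτ.2)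
      rw [hqn] at this
      exact ⟨this.1, by linarith⟩
    have hdiag := DiffBound.diagonal (ε := ε) (n := 4) (C := C * 2 ^ 4 * R ^ 4)
      (f := fun s t : ℕ => (fun (z : Vec3) (y : Vec3 × Vec3) => f y.1 y.2 (y.1 + z))
        (q + (s : ℝ) • (ha - hi)) ((ki, kj) + (t : ℝ) • ((hi, hj) : Vec3 × Vec3))) ?_
    · refine (hdiag.mono hε.le le_rfl (le_max_right _ _)).congr' fun j _ => ?_
      simp only [Prod.fst_add, Prod.snd_add, Prod.smul_mk, hqdef]
      rw [← (hf.periodic (ki + (j : ℝ) • hi) (kj + (j : ℝ) • hj) (ka + (j : ℝ) • ha) G hG).2.2]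
      congr 1
      module
    · intro i j a' b' hi' hj'
      have hle : ((i + a' : ℕ) : ℝ) ≤ (4 : ℕ) := by exact_mod_cast hi'
      have h := norm_fwdDiff_mixed_le (g := fun (z : Vec3) (y : Vec3 × Vec3) => f y.1 y.2 (y.1 + z))
        hf.contDiff_fiber (x := q) (h := ha - hi) (y := (ki, kj)) (k := (hi, hj))
        (M := C * ((ρ / 2) ^ i)⁻¹) (i := i) (j := j) (a := a') b'
        (fun τ hτ y => by
          obtain ⟨h1, h2⟩ := hrange τ ⟨hτ.1, hτ.2.trans hle⟩
          have h3 := hf.smooth y.1 y.2 (y.1 + (q + τ • (ha - hi))) (by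
            rw [add_sub_cancel_left]
            exact hδL _ (by linarith) h2)
          exact ContDiffAt.comp (q + τ • (ha - hi), y)
            (f := fun p : Vec3 × (Vec3 × Vec3) => (p.2.1, p.2.2, p.2.1 + p.1)) h3 (by fun_prop))
        (fun τ hτ y => by
          obtain ⟨h1, h2⟩ := hrange τ ⟨hτ.1, hτ.2.trans hle⟩
          refine (hC i (by omega) j (by omega) _ (by linarith) h2 y).trans ?_
          exact mul_le_mul_of_nonneg_left (inv_anti₀ (by positivity)
            (pow_le_pow_left₀ (by positivity) h1 i)) hC0)
      refine h.trans ?_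
      have e1 : ‖ha - hi‖ ^ i ≤ η ^ i := pow_le_pow_left₀ (norm_nonneg _) hq i
      have e2 : ‖((hi, hj) : Vec3 × Vec3)‖ ^ j ≤ η ^ j := by
        refine pow_le_pow_left₀ (norm_nonneg _) ?_ j
        simp only [Prod.norm_def, max_le_iff]
        exact ⟨hhi, hhj⟩
      -- With η = ρε, differences in q lose ρ^(-i) and regain it from the step, while those in (k_i,
      -- k_j) leave a spare factor ρ^j ≤ R^4.
      calc C * ((ρ / 2) ^ i)⁻¹ * ‖ha - hi‖ ^ i * ‖((hi, hj) : Vec3 × Vec3)‖ ^ j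
          ≤ C * ((ρ / 2) ^ i)⁻¹ * η ^ i * η ^ j := by gcongr
        _ = C * 2 ^ i * ρ ^ j * ε ^ (i + j) := by
          rw [hηε, div_pow, inv_div, mul_pow, mul_pow, pow_add]; field_simp
        _ ≤ C * 2 ^ 4 * R ^ 4 * ε ^ (i + j) := by
          have e3 : (2 : ℝ) ^ i ≤ 2 ^ 4 := pow_le_pow_right₀ one_le_two (by omega)
          have e4 : ρ ^ j ≤ R ^ 4 := (pow_le_pow_left₀ hρ0.le hρR j).trans
            (pow_le_pow_right₀ hR1 (by omega))
          gcongr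

/-- Off the lattice, the difference estimate along a constant line contains the sup bound; on it, f
equals its bounded diagonal restriction. -/
theorem exists_bound (hf : MemAmplitudeSpace a f) : ∃ M, 0 ≤ M ∧ ∀ ki kj ka, ‖f ki kj ka‖ ≤ M := by
  obtain ⟨D, hD0, hD⟩ := hf.exists_diffBound
  obtain ⟨M, hM⟩ := hf.exists_diag_bound
  refine ⟨max D M, le_max_of_le_left hD0, fun ki kj ka => ?_⟩
  rcases (latticeDist_nonneg (b := recipBasis a) (ka - ki)).eq_or_lt with h | h
  · rw [hf.eq_diag (latticeDist_eq_zero.mp h.symm)]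
    exact (hM ki kj).trans (le_max_right _ _)
  · have hb := hD ki kj ka 0 0 0 (latticeDist (recipBasis a) (ka - ki) / 8) (by positivity)
      (by simp only [norm_zero]; positivity) (by simp only [norm_zero]; positivity)
      (by simp only [norm_zero]; positivity) (by simp only [sub_zero, norm_zero]; positivity)
      (by linarith)
    have := hb.norm_le (Nat.zero_le 4)
    simp only [smul_zero, add_zero] at this
    exact this.trans (le_max_left _ _)

end PeriodicCC.MemAmplitudeSpace

end Amplitude

/-! ### Quadrature of products of symbols -/

section Symbol

variable {a : Module.Basis (Fin 3) ℝ Vec3}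

/-- A bounded measurable periodic function of three momenta whose finite differences obey the
estimates of a symbol of order `0`, with the singularity on the lattice in the variable `q`. -/
structure IsSymbol (a : Module.Basis (Fin 3) ℝ Vec3) (q : Vec3 × Vec3 × Vec3 → Vec3)
    (V : Vec3 × Vec3 × Vec3 → ℂ) : Prop where
  measurable : Measurable V
  periodic : IsPeriodic₃ a V
  bound : ∃ D, 0 ≤ D ∧ (∀ k, ‖V k‖ ≤ D) ∧ ∀ k h η, 0 < η → ‖h‖ ≤ η →
    8 * (3 * η) ≤ latticeDist (recipBasis a) (q k) →
    DiffBound (3 * η / latticeDist (recipBasis a) (q k)) 4 D (fun j : ℕ => V (k + (j : ℝ) • h))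

theorem norm_fwdDiff_iter_le_two_pow {E : Type*} [AddCommMonoid E] {F : E → ℂ} {M : ℝ}
    (hF : ∀ x, ‖F x‖ ≤ M) (h : E) (i : ℕ) (x : E) : ‖(fwdDiff h)^[i] F x‖ ≤ 2 ^ i * M := by
  induction i generalizing F M with
  | zero => simpa using hF x
  | succ i ih =>
    have := ih (F := fwdDiff h F) (M := 2 * M) fun y =>
      (norm_sub_le _ _).trans (by linarith [hF (y + h), hF y])
    rw [Function.iterate_succ_apply]
    exact this.trans (le_of_eq (by ring))

theorem one_le_mul_decay {t L : ℝ} (ht : 0 ≤ t) (htL : t ≤ L) : 1 ≤ max 1 (L ^ 4) * decay t := by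
  rcases ht.eq_or_lt with rfl | h
  · simp [decay]
  · have h4 : t ^ 4 ≤ L ^ 4 := pow_le_pow_left₀ ht htL 4
    have e : decay t = (t ^ 4)⁻¹ := by
      rw [decay, if_neg h.ne', add_zero, zpow_neg]
      norm_cast
    rw [e, ← div_eq_mul_inv, le_div_iff₀ (by positivity), one_mul]
    exact h4.trans (le_max_right _ _)

theorem inv_pow_four_le_decay {t : ℝ} : (t ^ 4)⁻¹ ≤ decay t := by
  have e : t ^ (-4 : ℤ) = (t ^ 4)⁻¹ := by rw [zpow_neg]; norm_cast
  rw [decay, e]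
  split_ifs <;> simp

/-- If one of the distances is below 24R/m, the trivial bound 2^4 D₁ D₂ suffices, because `decay` is
bounded below there. Otherwise the product rule with the larger of ε₁, ε₂ applies, and max(ε₁, ε₂)^4
≤ ε₁^4 + ε₂^4. The two singular sets thus separate, even where they intersect. -/
theorem IsSymbol.exists_norm_fwdDiff_mul_le {q₁ q₂ : Vec3 × Vec3 × Vec3 → Vec3}
    {V T : Vec3 × Vec3 × Vec3 → ℂ} (hV : IsSymbol a q₁ V) (hT : IsSymbol a q₂ T) :
    ∃ C, 0 ≤ C ∧ ∀ m : ℕ, 0 < m → ∀ k,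
      ∀ u ∈ brillouinZone a ×ˢ brillouinZone a ×ˢ brillouinZone a,
      ‖(fwdDiff ((m : ℝ)⁻¹ • u))^[4] (fun k => V k * T k) k‖ ≤
        C * (decay (m * latticeDist (recipBasis a) (q₁ k)) +
          decay (m * latticeDist (recipBasis a) (q₂ k))) := by
  obtain ⟨D₁, hD₁0, hb₁, hd₁⟩ := hV.bound
  obtain ⟨D₂, hD₂0, hb₂, hd₂⟩ := hT.bound
  have hbd : Bornology.IsBounded (brillouinZone a ×ˢ brillouinZone a ×ˢ brillouinZone a) :=
    (isBounded_unitCell _).prod ((isBounded_unitCell _).prod (isBounded_unitCell _))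
  obtain ⟨R, hR0, hR⟩ := hbd.exists_pos_norm_le
  refine ⟨2 ^ 4 * D₁ * D₂ * max 1 ((24 * R) ^ 4), by positivity, fun m hm k u hu => ?_⟩
  have hm0 : (0 : ℝ) < m := by exact_mod_cast hm
  set η : ℝ := R / m with hη
  have hη0 : 0 < η := by positivity
  have hh : ‖(m : ℝ)⁻¹ • u‖ ≤ η := by
    rw [norm_smul, norm_inv, Real.norm_natCast, inv_mul_eq_div]
    exact div_le_div_of_nonneg_right (hR u hu) hm0.le
  set ρ₁ := latticeDist (recipBasis a) (q₁ k)
  set ρ₂ := latticeDist (recipBasis a) (q₂ k)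
  have hρ₁ : 0 ≤ ρ₁ := latticeDist_nonneg _
  have hρ₂ : 0 ≤ ρ₂ := latticeDist_nonneg _
  have hdec₁ : 0 ≤ decay (m * ρ₁) := decay_nonneg (by positivity)
  have hdec₂ : 0 ≤ decay (m * ρ₂) := decay_nonneg (by positivity)
  have hone : 1 ≤ max 1 ((24 * R) ^ 4) := le_max_left _ _
  have hcrude : 1 ≤ max 1 ((24 * R) ^ 4) * (decay (m * ρ₁) + decay (m * ρ₂)) →
      ‖(fwdDiff ((m : ℝ)⁻¹ • u))^[4] (fun k => V k * T k) k‖ ≤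
        2 ^ 4 * D₁ * D₂ * max 1 ((24 * R) ^ 4) * (decay (m * ρ₁) + decay (m * ρ₂)) := by
    intro h1
    refine (norm_fwdDiff_iter_le_two_pow (M := D₁ * D₂) (fun x => ?_) _ 4 k).trans ?_
    · rw [norm_mul]
      exact mul_le_mul (hb₁ x) (hb₂ x) (norm_nonneg _) hD₁0
    · rw [mul_assoc (2 ^ 4 * D₁ * D₂), ← mul_assoc ((2 : ℝ) ^ 4)]
      exact le_mul_of_one_le_right (by positivity) h1
  have hnear : ∀ ρ : ℝ, 0 ≤ ρ → ρ < 8 * (3 * η) → 1 ≤ max 1 ((24 * R) ^ 4) * decay (m * ρ) := by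
    intro ρ h0 hlt
    refine one_le_mul_decay (by positivity) ?_
    calc (m : ℝ) * ρ ≤ m * (8 * (3 * η)) := mul_le_mul_of_nonneg_left hlt.le hm0.le
      _ = 24 * R := by rw [hη]; field_simp; norm_num
  rcases lt_or_ge ρ₁ (8 * (3 * η)) with h1 | h1
  · exact hcrude ((hnear ρ₁ hρ₁ h1).trans (mul_le_mul_of_nonneg_left (by linarith) (by positivity)))
  rcases lt_or_ge ρ₂ (8 * (3 * η)) with h2 | h2
  · exact hcrude ((hnear ρ₂ hρ₂ h2).trans (mul_le_mul_of_nonneg_left (by linarith) (by positivity)))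
  have hρ₁' : 0 < ρ₁ := by linarith
  have hρ₂' : 0 < ρ₂ := by linarith
  set ε₁ := 3 * η / ρ₁ with hε₁
  set ε₂ := 3 * η / ρ₂ with hε₂
  have h10 : 0 ≤ ε₁ := by positivity
  have h20 : 0 ≤ ε₂ := by positivity
  have hVd := (hd₁ k _ η hη0 hh h1).mono h10 (le_max_left ε₁ ε₂) le_rfl
  have hTd := (hd₂ k _ η hη0 hh h2).mono h20 (le_max_right ε₁ ε₂) le_rfl
  have hprod := (hVd.mul hTd) 4 0 (by norm_num)
  rw [fwdDiff_iter_comp_line (fun k => V k * T k)] at hprod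
  simp only [Nat.cast_zero, zero_smul, add_zero] at hprod
  refine hprod.trans ?_
  have hpow : max ε₁ ε₂ ^ 4 ≤ ε₁ ^ 4 + ε₂ ^ 4 := by
    rcases max_choice ε₁ ε₂ with h | h <;> rw [h]
    · exact le_add_of_nonneg_right (by positivity)
    · exact le_add_of_nonneg_left (by positivity)
  have hε : ∀ ρ : ℝ, 0 < ρ → (3 * η / ρ) ^ 4 ≤ max 1 ((24 * R) ^ 4) * decay (m * ρ) := by
    intro ρ hρ
    have e : (3 * η / ρ) ^ 4 = (3 * R) ^ 4 * ((m * ρ) ^ 4)⁻¹ := by rw [hη]; field_simp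
    rw [e]
    refine mul_le_mul ?_ inv_pow_four_le_decay (by positivity) (by positivity)
    exact (pow_le_pow_left₀ (by positivity) (by linarith) 4).trans (le_max_right _ _)
  rw [mul_assoc (2 ^ 4 * D₁ * D₂), mul_add]
  exact mul_le_mul_of_nonneg_left (hpow.trans (add_le_add (hε ρ₁ hρ₁') (hε ρ₂ hρ₂')))
    (by positivity)

/-- The singularities in `q` are spread over the mesh. -/
def IsMeshSummable (a : Module.Basis (Fin 3) ℝ Vec3) (q : Vec3 × Vec3 × Vec3 → Vec3) : Prop :=
  ∃ C, ∀ m : ℕ, 0 < m → ∀ s : Fin 3 → ℝ,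
    ∑ x, decay (m * latticeDist (recipBasis a) (q (meshPoint₃ a m s x))) ≤ C * (m : ℝ) ^ 6

/-- One end of the difference is summed with the other fixed; the two remaining mesh variables
contribute m^6. -/
theorem isMeshSummable_direct : IsMeshSummable a (fun k => k.2.2 - k.1) := by
  obtain ⟨C, hC⟩ := exists_sum_mesh_decay_le a
  refine ⟨C, fun m hm s => ?_⟩
  simp only [Fintype.sum_prod_type, meshPoint₃]
  refine (Finset.sum_le_sum fun x _ => Finset.sum_le_sum fun y _ => hC m hm s x).trans (le_of_eq ?_)
  simp only [Finset.sum_const, Finset.card_univ, Fintype.card_pi, Fintype.card_fin,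
    Finset.prod_const, nsmul_eq_mul]
  push_cast
  ring

theorem isMeshSummable_exchange : IsMeshSummable a (fun k => k.2.1 - k.2.2) := by
  obtain ⟨C, hC⟩ := exists_sum_mesh_decay_le a
  refine ⟨C, fun m hm s => ?_⟩
  simp only [Fintype.sum_prod_type, meshPoint₃]
  refine (Finset.sum_le_sum fun x _ => (Finset.sum_comm.trans_le
    (Finset.sum_le_sum fun z _ => hC m hm s z))).trans (le_of_eq ?_)
  simp only [Finset.sum_const, Finset.card_univ, Fintype.card_pi, Fintype.card_fin,
    Finset.prod_const, nsmul_eq_mul]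
  push_cast
  ring

theorem IsSymbol.integrable_mul {q₁ q₂ : Vec3 × Vec3 × Vec3 → Vec3}
    {V T : Vec3 × Vec3 × Vec3 → ℂ} (hV : IsSymbol a q₁ V) (hT : IsSymbol a q₂ T)
    (μ : Measure (Vec3 × Vec3 × Vec3)) [IsFiniteMeasure μ] : Integrable (fun k => V k * T k) μ := by
  obtain ⟨D₁, hD₁0, hb₁, -⟩ := hV.bound
  obtain ⟨D₂, -, hb₂, -⟩ := hT.bound
  refine Integrable.of_bound (hV.measurable.mul hT.measurable).aestronglyMeasurable (D₁ * D₂)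
    (.of_forall fun k => ?_)
  rw [norm_mul]
  exact mul_le_mul (hb₁ k) (hb₂ k) (norm_nonneg _) hD₁0

theorem IsSymbol.exists_quadrature_error_le {q₁ q₂ : Vec3 × Vec3 × Vec3 → Vec3}
    {V T : Vec3 × Vec3 × Vec3 → ℂ} (hV : IsSymbol a q₁ V) (hT : IsSymbol a q₂ T)
    (h₁ : IsMeshSummable a q₁) (h₂ : IsMeshSummable a q₂) :
    ∃ C, ∀ m : ℕ, 0 < m → ∀ s : Fin 3 → ℝ,
      ‖∫ k, V k * T k ∂(zoneMeasure₃ a) -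
        ((m : ℂ) ^ 9)⁻¹ * ∑ x, V (meshPoint₃ a m s x) * T (meshPoint₃ a m s x)‖
      ≤ C * ((m : ℝ) ^ 3)⁻¹ := by
  obtain ⟨C, hC0, hC⟩ := hV.exists_norm_fwdDiff_mul_le hT
  obtain ⟨C₁, hC₁⟩ := h₁
  obtain ⟨C₂, hC₂⟩ := h₂
  obtain ⟨D₁, hD₁0, hb₁, -⟩ := hV.bound
  obtain ⟨D₂, -, hb₂, -⟩ := hT.bound
  refine ⟨C * (C₁ + C₂), fun m hm s => ?_⟩
  have hm0 : (0 : ℝ) < m := by exact_mod_cast hm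
  refine (norm_integral_sub_mesh_le (F := fun k => V k * T k) (hV.measurable.mul hT.measurable)
    (M := D₁ * D₂) (fun k => ?_)
    (fun v G₁ g₁ G₂ g₂ G₃ g₃ => ?_) hm s (fun x u hu => hC m hm (meshPoint₃ a m s x) u hu)).trans ?_
  · rw [norm_mul]
    exact mul_le_mul (hb₁ k) (hb₂ k) (norm_nonneg _) hD₁0
  · simp only [hV.periodic v G₁ g₁ G₂ g₂ G₃ g₃, hT.periodic v G₁ g₁ G₂ g₂ G₃ g₃]
  · rw [← Finset.mul_sum, Finset.sum_add_distrib]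
    calc ((m : ℝ) ^ 9)⁻¹ * (C * (_ + _)) ≤ ((m : ℝ) ^ 9)⁻¹ * (C * (C₁ * m ^ 6 + C₂ * m ^ 6)) :=
          mul_le_mul_of_nonneg_left (mul_le_mul_of_nonneg_left
            (add_le_add (hC₁ m hm s) (hC₂ m hm s)) hC0) (by positivity)
      _ = C * (C₁ + C₂) * ((m : ℝ) ^ 3)⁻¹ := by field_simp

end Symbol

/-! ### Interactions and amplitudes as symbols -/

section Instances

variable {a : Module.Basis (Fin 3) ℝ Vec3} {nocc nvir : ℕ}
  {ψ : Fin nocc ⊕ Fin nvir → Vec3 → Vec3 → ℂ}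

theorem norm_components_le {h : Vec3 × Vec3 × Vec3} {η : ℝ} (hh : ‖h‖ ≤ η) :
    ‖h.1‖ ≤ η ∧ ‖h.2.1‖ ≤ η ∧ ‖h.2.2‖ ≤ η := by
  simpa only [Prod.norm_def, max_le_iff] using hh

/-- The properties of the electron repulsion integrals from which both interactions are symbols. -/
structure IsInteraction (a : Module.Basis (Fin 3) ℝ Vec3) (E : Vec3 → Vec3 → Vec3 → ℂ) : Prop where
  measurable : Measurable fun k : Vec3 × Vec3 × Vec3 => E k.1 k.2.1 k.2.2
  periodic : ∀ k₁ k₂ k₃, ∀ G₁ ∈ recipLattice a, ∀ G₂ ∈ recipLattice a, ∀ G₃ ∈ recipLattice a,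
    E (k₁ + G₁) (k₂ + G₂) (k₃ + G₃) = E k₁ k₂ k₃
  bound : ∃ D, 0 ≤ D ∧ ∀ k₁ k₂ k₃, ‖E k₁ k₂ k₃‖ ≤ D ∧ ∀ h₁ h₂ h₃ η, 0 < η → ‖h₁‖ ≤ η → ‖h₂‖ ≤ η →
    ‖h₃‖ ≤ η → ‖h₃ - h₁‖ ≤ η → ‖h₂ - (h₃ - h₁)‖ ≤ η →
    8 * η ≤ latticeDist (recipBasis a) (k₃ - k₁) →
    DiffBound (η / latticeDist (recipBasis a) (k₃ - k₁)) 4 D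
      (fun j : ℕ => E (k₁ + (j : ℝ) • h₁) (k₂ + (j : ℝ) • h₂) (k₃ + (j : ℝ) • h₃))

/-- The increment of the fourth momentum combines three components of h, hence the 3η in `IsSymbol`.
-/
theorem IsInteraction.isSymbol_direct {E : Vec3 → Vec3 → Vec3 → ℂ} (hE : IsInteraction a E) :
    IsSymbol a (fun k => k.2.2 - k.1) (fun k => E k.1 k.2.1 k.2.2) where
  measurable := hE.measurable
  periodic := fun v G₁ h₁ G₂ h₂ G₃ h₃ => hE.periodic v.1 v.2.1 v.2.2 G₁ h₁ G₂ h₂ G₃ h₃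
  bound := by
    obtain ⟨D, hD0, hD⟩ := hE.bound
    refine ⟨D, hD0, fun k => (hD _ _ _).1, fun k h η hη hh h8 => ?_⟩
    obtain ⟨h1, h2, h3⟩ := norm_components_le hh
    refine (hD k.1 k.2.1 k.2.2).2 h.1 h.2.1 h.2.2 (3 * η) (by positivity)
      (by linarith) (by linarith) (by linarith) ?_ ?_ h8
    · linarith [norm_sub_le h.2.2 h.1]
    · linarith [norm_sub_le h.2.1 (h.2.2 - h.1), norm_sub_le h.2.2 h.1]

/-- Momentum conservation gives k_b − k_i = k_j − k_a, so the linear substitution k₃ = k_b moves the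
singularity there. The increment of the fourth momentum becomes that of k_a. -/
theorem IsInteraction.isSymbol_exchange {E : Vec3 → Vec3 → Vec3 → ℂ} (hE : IsInteraction a E) :
    IsSymbol a (fun k => k.2.1 - k.2.2) (fun k => E k.1 k.2.1 (k.1 + k.2.1 - k.2.2)) where
  measurable := hE.measurable.comp
    (by fun_prop : Measurable fun k : Vec3 × Vec3 × Vec3 => (k.1, k.2.1, k.1 + k.2.1 - k.2.2))
  periodic := fun v G₁ h₁ G₂ h₂ G₃ h₃ => by
    simp only [Prod.fst_add, Prod.snd_add]
    rw [show v.1 + G₁ + (v.2.1 + G₂) - (v.2.2 + G₃) = v.1 + v.2.1 - v.2.2 + (G₁ + G₂ - G₃) by abel]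
    exact hE.periodic _ _ _ _ h₁ _ h₂ _ (sub_mem (add_mem h₁ h₂) h₃)
  bound := by
    obtain ⟨D, hD0, hD⟩ := hE.bound
    refine ⟨D, hD0, fun k => (hD _ _ _).1, fun k h η hη hh h8 => ?_⟩
    obtain ⟨h1, h2, h3⟩ := norm_components_le hh
    have e : k.1 + k.2.1 - k.2.2 - k.1 = k.2.1 - k.2.2 := by abel
    have e' : h.1 + h.2.1 - h.2.2 - h.1 = h.2.1 - h.2.2 := by abel
    have hb := (hD k.1 k.2.1 (k.1 + k.2.1 - k.2.2)).2 h.1 h.2.1 (h.1 + h.2.1 - h.2.2) (3 * η)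
      (by positivity) (by linarith) (by linarith)
      (by linarith [norm_sub_le (h.1 + h.2.1) h.2.2, norm_add_le h.1 h.2.1])
      (by rw [e']; linarith [norm_sub_le h.2.1 h.2.2]) (by rw [e', sub_sub_cancel]; linarith)
      (by rw [e]; exact h8)
    rw [e] at hb
    refine hb.congr' fun n _ => ?_
    simp only [Prod.fst_add, Prod.snd_add, Prod.smul_fst, Prod.smul_snd]
    congr 1
    module

theorem isInteraction_eri (hψ : IsBlochOrbitals a ψ) (n₁ n₂ n₃ n₄ : Fin nocc ⊕ Fin nvir)
    (h₁₃ : n₁ ≠ n₃) (h₂₄ : n₂ ≠ n₄) :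
    IsInteraction a fun k₁ k₂ k₃ => eri a ψ n₁ k₁ n₂ k₂ n₃ k₃ n₄ where
  measurable := measurable_eri hψ n₁ n₂ n₃ n₄
  periodic := fun k₁ k₂ k₃ _ h₁ _ h₂ _ h₃ => eri_add hψ n₁ k₁ n₂ k₂ n₃ k₃ n₄ h₁ h₂ h₃
  bound := by
    obtain ⟨D, hD0, hD⟩ := exists_diffBound_eri hψ
    exact ⟨D, hD0, fun k₁ k₂ k₃ => hD n₁ n₂ n₃ n₄ h₁₃ h₂₄ k₁ k₂ k₃⟩

/-- Each pair product couples an occupied with a virtual band, so the orthogonality condition on the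
bands holds automatically. -/
theorem isSymbol_directERI (hψ : IsBlochOrbitals a ψ) (i j : Fin nocc) (c d : Fin nvir) :
    IsSymbol a (fun k => k.2.2 - k.1) (fun k => directERI a ψ i j c d k.1 k.2.1 k.2.2) :=
  (isInteraction_eri hψ (.inl i) (.inl j) (.inr c) (.inr d) (by simp) (by simp)).isSymbol_direct

theorem isSymbol_exchangeERI (hψ : IsBlochOrbitals a ψ) (i j : Fin nocc) (c d : Fin nvir) :
    IsSymbol a (fun k => k.2.1 - k.2.2) (fun k => exchangeERI a ψ i j c d k.1 k.2.1 k.2.2) :=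
  (isInteraction_eri hψ (.inl i) (.inl j) (.inr d) (.inr c) (by simp) (by simp)).isSymbol_exchange

theorem PeriodicCC.MemAmplitudeSpace.isSymbol {f : Vec3 → Vec3 → Vec3 → ℂ}
    (hf : MemAmplitudeSpace a f) :
    IsSymbol a (fun k => k.2.2 - k.1) (fun k => f k.1 k.2.1 k.2.2) where
  measurable := hf.measurable
  periodic := hf.isPeriodic₃
  bound := by
    obtain ⟨D, hD0, hD⟩ := hf.exists_diffBound
    obtain ⟨M, hM0, hM⟩ := hf.exists_bound
    refine ⟨max D M, le_max_of_le_left hD0, fun k => (hM _ _ _).trans (le_max_right _ _),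
      fun k h η hη hh h8 => ?_⟩
    obtain ⟨h1, h2, h3⟩ := norm_components_le hh
    have hb := hD k.1 k.2.1 k.2.2 h.1 h.2.1 h.2.2 (3 * η) (by positivity)
      (by linarith) (by linarith) (by linarith) (by linarith [norm_sub_le h.2.2 h.1]) h8
    exact hb.mono (div_nonneg (by positivity) (latticeDist_nonneg _)) le_rfl (le_max_left _ _)

end Instances

/-! ### Energies -/

section EnergyError

variable {a : Module.Basis (Fin 3) ℝ Vec3} {nocc nvir : ℕ}

theorem energyTDL_eq (V t : AmplitudeFun nocc nvir) :
    energyTDL a V t = ∫ k, energyIntegrand V t k ∂(zoneMeasure₃ a) := by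
  rw [energyTDL, zoneMeasure₃_eq, integral_smul_measure, Complex.real_smul]
  congr 2
  rw [ENNReal.toReal_pow, ENNReal.toReal_inv, one_div, inv_pow]
  rfl

theorem isFiniteMeasure_restrict_zone : IsFiniteMeasure
    ((volume : Measure (Vec3 × Vec3 × Vec3)).restrict
      (brillouinZone a ×ˢ brillouinZone a ×ˢ brillouinZone a)) :=
  ⟨by
    rw [Measure.restrict_apply_univ]
    exact ((isBounded_unitCell _).prod
      ((isBounded_unitCell _).prod (isBounded_unitCell _))).measure_lt_top⟩

theorem integrable_energyIntegrand {V t : AmplitudeFun nocc nvir}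
    {q₁ q₂ : Vec3 × Vec3 × Vec3 → Vec3}
    (hV : ∀ i j c d, IsSymbol a q₁ (fun k => V i j c d k.1 k.2.1 k.2.2))
    (ht : ∀ i j c d, IsSymbol a q₂ (fun k => t i j c d k.1 k.2.1 k.2.2))
    (μ : Measure (Vec3 × Vec3 × Vec3)) [IsFiniteMeasure μ] : Integrable (energyIntegrand V t) μ :=
  integrable_finsetSum _ fun i _ => integrable_finsetSum _ fun j _ =>
    integrable_finsetSum _ fun c _ => integrable_finsetSum _ fun d _ =>
      (hV i j c d).integrable_mul (ht i j c d) μ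

theorem energyMesh_meshEval (V t : AmplitudeFun nocc nvir) (m : ℕ) (s : Fin 3 → ℝ) :
    energyMesh a V m s (meshEval a m s t) =
      ((m : ℂ) ^ 9)⁻¹ * ∑ x, energyIntegrand V t (meshPoint₃ a m s x) := by
  rw [energyMesh, one_div, Fintype.sum_prod_type]
  simp only [Fintype.sum_prod_type]
  congr 1
  push_cast
  ring

theorem exists_energy_error_le {V t : AmplitudeFun nocc nvir} {q₁ q₂ : Vec3 × Vec3 × Vec3 → Vec3}
    (hV : ∀ i j c d, IsSymbol a q₁ (fun k => V i j c d k.1 k.2.1 k.2.2))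
    (ht : ∀ i j c d, IsSymbol a q₂ (fun k => t i j c d k.1 k.2.1 k.2.2))
    (h₁ : IsMeshSummable a q₁) (h₂ : IsMeshSummable a q₂) :
    ∃ C, ∀ m : ℕ, 0 < m → ∀ s : Fin 3 → ℝ,
      ‖energyTDL a V t - energyMesh a V m s (meshEval a m s t)‖ ≤ C * ((m : ℝ) ^ 3)⁻¹ := by
  choose C hC using fun p : Fin nocc × Fin nocc × Fin nvir × Fin nvir =>
    (hV p.1 p.2.1 p.2.2.1 p.2.2.2).exists_quadrature_error_le (ht p.1 p.2.1 p.2.2.1 p.2.2.2) h₁ h₂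
  refine ⟨∑ p, C p, fun m hm s => ?_⟩
  have hsum : ∀ k, energyIntegrand V t k = ∑ p : Fin nocc × Fin nocc × Fin nvir × Fin nvir,
      V p.1 p.2.1 p.2.2.1 p.2.2.2 k.1 k.2.1 k.2.2 * t p.1 p.2.1 p.2.2.1 p.2.2.2 k.1 k.2.1 k.2.2 := by
    intro k
    simp only [energyIntegrand, Fintype.sum_prod_type]
  rw [energyTDL_eq, energyMesh_meshEval]
  simp only [hsum]
  rw [integral_finsetSum _ fun p _ => (hV _ _ _ _).integrable_mul (ht _ _ _ _) _, Finset.sum_comm,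
    Finset.mul_sum, ← Finset.sum_sub_distrib, Finset.sum_mul]
  exact (norm_sum_le _ _).trans (Finset.sum_le_sum fun p _ => hC p m hm s)

end EnergyError

end

/-! ### Direct, exchange and antisymmetrized energies -/

theorem mainTheorem5 (a : Module.Basis (Fin 3) ℝ Vec3) (nocc nvir : ℕ)
    (ψ : Fin nocc ⊕ Fin nvir → Vec3 → Vec3 → ℂ) (hψ : IsBlochOrbitals a ψ)
    (t : AmplitudeFun nocc nvir) (ht : ∀ i j c d, MemAmplitudeSpace a (t i j c d)) :
    (∀ n₁ k₁ n₂ k₂ n₃ k₃ n₄, Summable (eriTerm a ψ n₁ k₁ n₂ k₂ n₃ k₃ n₄)) ∧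
    MeasureTheory.IntegrableOn (energyIntegrand (directERI a ψ) t)
      (brillouinZone a ×ˢ brillouinZone a ×ˢ brillouinZone a) ∧
    MeasureTheory.IntegrableOn (energyIntegrand (exchangeERI a ψ) t)
      (brillouinZone a ×ˢ brillouinZone a ×ˢ brillouinZone a) ∧
    ∃ C : ℝ, ∀ m : ℕ, 0 < m → ∀ s : Fin 3 → ℝ, (∀ l, s l ∈ Set.Ico (0 : ℝ) 1) →
      ‖energyTDL a (antisymERI a ψ) t - energyMesh a (antisymERI a ψ) m s (meshEval a m s t)‖
          ≤ C * (((m ^ 3 : ℕ) : ℝ))⁻¹ ∧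
      ‖energyTDL a (directERI a ψ) t - energyMesh a (directERI a ψ) m s (meshEval a m s t)‖
          ≤ C * (((m ^ 3 : ℕ) : ℝ))⁻¹ ∧
      ‖energyTDL a (exchangeERI a ψ) t - energyMesh a (exchangeERI a ψ) m s (meshEval a m s t)‖
          ≤ C * (((m ^ 3 : ℕ) : ℝ))⁻¹ := by
  have hD := isSymbol_directERI hψ
  have hX := isSymbol_exchangeERI hψ
  have hT := fun i j c d => (ht i j c d).isSymbol
  have : IsFiniteMeasure ((volume : Measure (Vec3 × Vec3 × Vec3)).restrict
      (brillouinZone a ×ˢ brillouinZone a ×ˢ brillouinZone a)) := isFiniteMeasure_restrict_zone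
  obtain ⟨S, -, hS⟩ := exists_tsum_eriTerm_le hψ
  refine ⟨fun n₁ k₁ n₂ k₂ n₃ k₃ n₄ => (hS n₁ k₁ n₂ k₂ n₃ k₃ n₄).1,
    integrable_energyIntegrand hD hT _, integrable_energyIntegrand hX hT _, ?_⟩
  obtain ⟨C₁, h₁⟩ := exists_energy_error_le hD hT isMeshSummable_direct isMeshSummable_direct
  obtain ⟨C₂, h₂⟩ := exists_energy_error_le hX hT isMeshSummable_exchange isMeshSummable_direct
  -- The weights follow W = 2D − X; absolute values make the one constant dominate all three errors.
  refine ⟨2 * |C₁| + |C₂|, fun m hm s _ => ?_⟩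
  have hI : ∀ k, energyIntegrand (antisymERI a ψ) t k =
      2 * energyIntegrand (directERI a ψ) t k - energyIntegrand (exchangeERI a ψ) t k := by
    intro k
    simp only [energyIntegrand, antisymERI, Finset.mul_sum, ← Finset.sum_sub_distrib]
    refine Finset.sum_congr rfl fun i _ => Finset.sum_congr rfl fun j _ =>
      Finset.sum_congr rfl fun c _ => Finset.sum_congr rfl fun d _ => by ring
  have hW : energyTDL a (antisymERI a ψ) t - energyMesh a (antisymERI a ψ) m s (meshEval a m s t) =
      2 * (energyTDL a (directERI a ψ) t - energyMesh a (directERI a ψ) m s (meshEval a m s t)) -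
      (energyTDL a (exchangeERI a ψ) t - energyMesh a (exchangeERI a ψ) m s (meshEval a m s t)) := by
    simp only [energyTDL_eq, energyMesh_meshEval, hI]
    rw [integral_sub ((integrable_energyIntegrand hD hT _).const_mul 2)
      (integrable_energyIntegrand hX hT _), integral_const_mul, Finset.sum_sub_distrib,
      ← Finset.mul_sum]
    ring
  have hm3 : 0 ≤ ((m : ℝ) ^ 3)⁻¹ := by positivity
  have e₁ : ‖energyTDL a (directERI a ψ) t - energyMesh a (directERI a ψ) m s (meshEval a m s t)‖
      ≤ |C₁| * ((m : ℝ) ^ 3)⁻¹ :=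
    (h₁ m hm s).trans (mul_le_mul_of_nonneg_right (le_abs_self _) hm3)
  have e₂ : ‖energyTDL a (exchangeERI a ψ) t - energyMesh a (exchangeERI a ψ) m s (meshEval a m s t)‖
      ≤ |C₂| * ((m : ℝ) ^ 3)⁻¹ :=
    (h₂ m hm s).trans (mul_le_mul_of_nonneg_right (le_abs_self _) hm3)
  have n₁ := mul_nonneg (abs_nonneg C₁) hm3
  have n₂ := mul_nonneg (abs_nonneg C₂) hm3
  push_cast
  rw [add_mul, mul_assoc]
  refine ⟨?_, by linarith, by linarith⟩
  rw [hW]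
  refine (norm_sub_le _ _).trans (add_le_add ?_ e₂)
  rw [norm_mul, Complex.norm_two]
  exact mul_le_mul_of_nonneg_left e₁ zero_le_two
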